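/- Let $r\ge 2$. For $\Lambda\neq0$ and pairwise distinct $z_1,\dots,z_r\in\mathbb C$ with $\sum_\alpha z_\alpha=0$, put $P(x)=\prod_\alpha(x-z_\alpha)=x^r+u_2x^{r-2}+\cdots+u_r$, let $C_{\vec u}$ be the curve $\Lambda^r(w+w^{-1})=P(x)$, i.e. $y^2=P(x)^2-4\Lambda^{2r}$ with $y=\Lambda^r(w-w^{-1})$, and let $$dS=-\frac1{2\pi}\,x\,\frac{dw}{w}=-\frac1{2\pi}\,\frac{x\,P'(x)\,dx}{\sqrt{P(x)^2-4\Lambda^{2r}}}.$$ *Periods.* Let $z_1>\cdots>z_r$ be real and $\Lambda>0$ small, namely $8\Lambda<\min_{\alpha\ne\beta}|z_\alpha-z_\beta|$. Near each $z_\alpha$ there are two branch points $z_\alpha^\pm$, with $P(z_\alpha^\pm)=\pm2\Lambda^r$. Let $A_\alpha$ be the counterclockwise cycle around the cut between $z_\alpha^-$ and $z_\alpha^+$ in the sheet where $\sqrt{P^2-4\Lambda^{2r}}\approx P$. For $\beta=2,\dots,r$ let $C'_\beta$ be the real segment from the branch point of the pair $z_{\beta-1}^\pm$ to the branch point of the pair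 $z_\beta^\pm$ that lie between $z_\beta$ and $z_{\beta-1}$, in the sheet where $\sqrt{P^2-4\Lambda^{2r}}$ has the sign of $P$; let $C_\beta=C'_\beta-\iota C'_\beta$ with $\iota(w)=1/w$, and $B_\alpha=C_2+\cdots+C_\alpha$. Put $$a_\alpha=\int_{A_\alpha}dS\ (1\le\alpha\le r),\qquad a^D_\alpha=2\pi\sqrt{-1}\int_{B_\alpha}dS\ (2\le\alpha\le r).$$ *Prepotential.* Let $\mathcal C$ be the set of $\vec a\in\mathbb C^r$ with $\sum_\alpha a_\alpha=0$ and $\mathrm{Re}(\sqrt{-1}a_1)>\cdots>\mathrm{Re}(\sqrt{-1}a_r)$; use $a_2,\dots,a_r$ as coordinates on it. For a continuous $\rho:\mathcal C\to(0,\infty)$, a Seiberg–Witten prepotential on $\{(\vec a,\Lambda):\vec a\in\mathcal C,\ 0<|\Lambda|<\rho(\vec a)\}$ is a holomorphic function $\mathcal F_0$ of $\vec a$ and $\log\Lambda$ (so it may be multivalued in $\Lambda$) such that 1. $a^D_\alpha=-\partial\mathcal F_0/\partial a_\alpha$ for $\alpha=2,\dots,r$, at the points $(\vec a,\Lambda)$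 of the domain that come from real $z_1>\cdots>z_r$ and $\Lambda>0$ as above (with $\log\Lambda$ real); 2. $\bigl(\sum_{\alpha=2}^r a_\alpha\,\partial/\partial a_\alpha+\Lambda\,\partial/\partial\Lambda\bigr)\mathcal F_0=2\mathcal F_0$; 3. $\mathcal F_0(\vec a,\log\Lambda+\pi\sqrt{-1}/r)-\mathcal F_0(\vec a,\log\Lambda)$ does not depend on $\Lambda$ (that is, continuation from $\Lambda^{2r}$ to $e^{2\pi\sqrt{-1}}\Lambda^{2r}$ changes $\mathcal F_0$ by a term independent of $\Lambda$). **Proposition.** A prepotential exists for some $\rho$, and for each $\rho$ there is at most one. Every prepotential satisfies, near $\Lambda=0$, $$\mathcal F_0=\sum_{\alpha\neq\beta}\gamma_0(a_\alpha-a_\beta;\Lambda)+O(\Lambda^{2r}) =\sum_{\alpha\ne\beta}\left[\tfrac12(a_\alpha-a_\beta)^2\log\Bigl(\frac{a_\alpha-a_\beta}{\Lambda}\Bigr)-\tfrac34(a_\alpha-a_\beta)^2\right]+O(\Lambda^{2r}),$$ where $\gamma_0(x;\Lambda)=\frac12x^2\log(x/\Lambda)-\frac34x^2$: for each compact $K\subset\mathcal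 C$ there are $C$ and $\delta>0$ such that the error is at most $C|\Lambda|^{2r}$ for all $\vec a\in K$, $0<|\Lambda|<\delta$ and all values of $\log\Lambda$. Here $\log(x/\Lambda)=\log x-\log\Lambda$ with the principal branch of $\log x$; thus $\frac12\log\frac{a_\alpha-a_\beta}{\Lambda}+\frac12\log\frac{a_\beta-a_\alpha}{\Lambda}=\log\frac{\sqrt{-1}(a_\alpha-a_\beta)}{\Lambda}$ for $\alpha<\beta$, which is real when $\sqrt{-1}(a_\alpha-a_\beta)>0$ and $\Lambda>0$ (with $\log\Lambda$ real). The sum over $\alpha\neq\beta$ is called the perturbative part of $\mathcal F_0$. Moreover $\gamma_0(x;\Lambda)$ is the coefficient of $1/\varepsilon_1\varepsilon_2$ in $-\gamma_{\varepsilon_1,\varepsilon_2}(x;\Lambda)$, where $$\gamma_{\varepsilon_1,\varepsilon_2}(x;\Lambda)=\left.\frac{d}{ds}\right|_{s=0}\frac{\Lambda^s}{\Gamma(s)}\int_0^\infty\frac{dt}{t}\,t^s\,\frac{e^{-tx}}{(e^{\varepsilon_1t}-1)(e^{\varepsilon_2t}-1)}$$ (continued analytically from $\mathrm{Re}\,s>2$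 to $\mathbb C\setminus\{1,2\}$): for $\mathrm{Re}\,x>0$, each value of $\log\Lambda$ and real nonzero $\varepsilon_1,\varepsilon_2$ it exists, and $-\varepsilon_1\varepsilon_2\gamma_{\varepsilon_1,\varepsilon_2}(x;\Lambda)\to\gamma_0(x;\Lambda)$ as $(\varepsilon_1,\varepsilon_2)\to(0,0)$. -/

import Mathlib

open Filter Topology

noncomputable section

namespace SeibergWitten

/-! ### The curves, the differential and its periods -/

/-- The polynomial `P(x) = ∏ (x - z_α)` of the curve `Λ^r (w + 1/w) = P(x)`.  For `∑ z_α = 0` it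
has the form `x^r + u_2 x^(r-2) + ⋯ + u_r`, and `z` is a local coordinate on the `u`-plane. -/
def curvePoly {R : Type} [CommRing R] {r : ℕ} (z : Fin r → R) : Polynomial R :=
  ∏ α, (Polynomial.X - Polynomial.C (z α))

/-- The smallest distance between two of the points `z_α`. -/
def rootGap {r : ℕ} (z : Fin r → ℂ) : ℝ :=
  ⨅ p : {p : Fin r × Fin r // p.1 ≠ p.2}, ‖z p.1.1 - z p.1.2‖

/-- The coefficient of `dx` in the Seiberg-Witten differential
`dS = -(1/2π) x dw/w = -(1/2π) x P'(x) dx / √(P(x)² - 4Λ^(2r))`, on the part of the sheet with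
`√(P² - 4Λ^(2r)) ≈ P` where `2|Λ|^r < |P(x)|`; there the root is `P √(1 - 4Λ^(2r)/P²)`, with the
principal branch of the second root. -/
def swDiff {r : ℕ} (z : Fin r → ℂ) (Λ x : ℂ) : ℂ :=
  -(1 / (2 * (Real.pi : ℂ))) * (x * (curvePoly z).derivative.eval x) /
    ((curvePoly z).eval x *
      (1 - 4 * Λ ^ (2 * r) / ((curvePoly z).eval x) ^ 2) ^ (1 / 2 : ℂ))

/-- `a_α = ∫_{A_α} dS`.  When `8|Λ| < rootGap z`, the counterclockwise circle around `z_α` of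
radius `rootGap z / 2` encircles, among the branch points (the solutions of `P = ± 2Λ^r`),
exactly the two that are near `z_α`, so it represents `A_α`; on it `16 |Λ|^r < |P|`. -/
def aPeriod {r : ℕ} (z : Fin r → ℂ) (Λ : ℂ) (α : Fin r) : ℂ :=
  ∮ x in C(z α, rootGap z / 2), swDiff z Λ x

/-- The coefficient of `dx` in `dS` on a real interval on which `2Λ^r < |P|`, in the sheet in which
`√(P² - 4Λ^(2r))` has the same sign as `P`. -/
def swDiffReal {r : ℕ} (z : Fin r → ℝ) (Λ x : ℝ) : ℝ :=
  -(1 / (2 * Real.pi)) * (x * (curvePoly z).derivative.eval x) /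
    (SignType.sign ((curvePoly z).eval x) *
      √(((curvePoly z).eval x) ^ 2 - 4 * Λ ^ (2 * r)))

/-- For real `z_1 > ⋯ > z_r` and small `Λ > 0`: the segment strictly between the branch point near
`z_(β-1)` and the branch point near `z_β` that lie between `z_β` and `z_(β-1)`. -/
def gapSegment {r : ℕ} [NeZero r] (z : Fin r → ℝ) (Λ : ℝ) (β : Fin r) : Set ℝ :=
  {x | z β < x ∧ x < z (β - 1) ∧ 2 * Λ ^ r < |(curvePoly z).eval x|}

/-- `∫_{C_β} dS` for `β` not the first index.  The cycle `C_β` is the segment `C'_β` from the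
branch point near `z_(β-1)` to the branch point near `z_β` (thus from right to left), followed by
`-ι C'_β` for the hyperelliptic involution `ι`, which changes the sign of `dS`. -/
def cPeriod {r : ℕ} [NeZero r] (z : Fin r → ℝ) (Λ : ℝ) (β : Fin r) : ℝ :=
  2 * -(∫ x in gapSegment z Λ β, swDiffReal z Λ x)

/-- `a^D_α = 2πi ∫_{B_α} dS`, where `B_α = C_2 + ⋯ + C_α`.  The first index is `0 : Fin r`. -/
def aDual {r : ℕ} [NeZero r] (z : Fin r → ℝ) (Λ : ℝ) (α : Fin r) : ℂ :=
  2 * (Real.pi : ℂ) * Complex.I * ((∑ β ∈ Finset.Ioc 0 α, cPeriod z Λ β : ℝ) : ℂ)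

/-! ### The prepotential -/

/-- The vectors `a` with `∑ a_α = 0` and `Re (i a_1) > Re (i a_2) > ⋯ > Re (i a_r)`: a complex
neighbourhood, inside the hyperplane, of the purely imaginary vectors `a` with
`i a_1 > ⋯ > i a_r`. -/
def chamber (r : ℕ) : Set (Fin r → ℂ) :=
  {a | ∑ α, a α = 0 ∧ ∀ α β, α < β → (Complex.I * a β).re < (Complex.I * a α).re}

/-- The pairs `(a, l)` with `a` in the chamber and `|Λ| < ρ(a)` for `Λ = exp l`.  The variable
`l = log Λ` lives on the universal covering of the punctured `Λ`-disc. -/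
def domain (r : ℕ) (ρ : (Fin r → ℂ) → ℝ) : Set ((Fin r → ℂ) × ℂ) :=
  {p | p.1 ∈ chamber r ∧ Real.exp p.2.re < ρ p.1}

/-- A continuous positive bound for `|Λ|` on the chamber. -/
def IsBound (r : ℕ) (ρ : (Fin r → ℂ) → ℝ) : Prop :=
  ContinuousOn ρ (chamber r) ∧ ∀ a ∈ chamber r, 0 < ρ a

/-- `∂F/∂a_α` at `(a, l)` in the independent coordinates `a_2, …, a_r`, with
`a_1 = -(a_2 + ⋯ + a_r)` (for `α` not the first index). -/
def partialA {r : ℕ} [NeZero r] (F : (Fin r → ℂ) × ℂ → ℂ) (α : Fin r)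
    (p : (Fin r → ℂ) × ℂ) : ℂ :=
  deriv (fun t : ℂ => F (p.1 + t • (Pi.single α 1 - Pi.single 0 1), p.2)) 0

/-- `Λ ∂F/∂Λ = ∂F/∂l` at `(a, l)`. -/
def partialLog {r : ℕ} (F : (Fin r → ℂ) × ℂ → ℂ) (p : (Fin r → ℂ) × ℂ) : ℂ :=
  deriv (fun l : ℂ => F (p.1, l)) p.2

/-- `F` is the Seiberg-Witten prepotential, as a holomorphic function of `(a, l)`, `Λ = exp l`, on
`domain r ρ`. -/
structure IsPrepotential (r : ℕ) [NeZero r] (ρ : (Fin r → ℂ) → ℝ)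
    (F : (Fin r → ℂ) × ℂ → ℂ) : Prop where
  holomorphic : DifferentiableOn ℂ F (domain r ρ)
  /-- `a^D_α = -∂F/∂a_α` in the real region, where the cycles are chosen. -/
  dual_period : ∀ (z : Fin r → ℝ) (Λ : ℝ), StrictAnti z → ∑ α, z α = 0 → 0 < Λ →
    8 * Λ < rootGap (fun α => (z α : ℂ)) →
    (aPeriod (fun α => (z α : ℂ)) Λ, (Real.log Λ : ℂ)) ∈ domain r ρ →
    ∀ α, α ≠ 0 →
      aDual z Λ α = -partialA F α (aPeriod (fun α => (z α : ℂ)) Λ, (Real.log Λ : ℂ))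
  /-- Homogeneity of degree `2`. -/
  euler : ∀ p ∈ domain r ρ,
    (∑ α ∈ Finset.univ.erase 0, p.1 α * partialA F α p) + partialLog F p = 2 * F p
  /-- Dependence on `Λ` through `Λ^(2r)`: under analytic continuation from `Λ^(2r)` to
  `exp (2πi) Λ^(2r)`, the function changes by a term that does not depend on `Λ`.  (The other
  conditions leave a summand `c Λ²` free.) -/
  monodromy : ∀ (a : Fin r → ℂ) (l l' : ℂ), (a, l) ∈ domain r ρ → (a, l') ∈ domain r ρ →
    F (a, l + Real.pi * Complex.I / r) - F (a, l) =
      F (a, l' + Real.pi * Complex.I / r) - F (a, l')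

/-! ### The perturbative part -/

/-- The branch of `log (x/Λ)`, `Λ = exp l`, with the principal branch of `log x`. -/
def logRatio (x l : ℂ) : ℂ := Complex.log x - l

/-- The branch is the one for which `½ log (x/Λ) + ½ log (-x/Λ) = log (i x/Λ)`, and this is real
for `i x > 0`, `Λ > 0`. -/
theorem logRatio_branch (x l : ℂ) (hx : 0 < (Complex.I * x).re) :
    1 / 2 * logRatio x l + 1 / 2 * logRatio (-x) l = logRatio (Complex.I * x) l := by
  have h : x.im < 0 := by simpa using hx
  have hx0 : x ≠ 0 := by
    rintro rfl
    simp at h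
  have h1 : Complex.log (-x) = Complex.log x + Real.pi * Complex.I := by
    rw [Complex.log, Complex.log, Complex.arg_neg_eq_arg_add_pi_of_im_neg h, norm_neg]
    push_cast
    ring
  have h2 : Complex.log (Complex.I * x) = Complex.log x + Real.pi / 2 * Complex.I := by
    rw [Complex.log_mul Complex.I_ne_zero hx0, Complex.log_I]
    · ring
    · rw [Complex.arg_I]
      have := Complex.neg_pi_lt_arg x
      have := Complex.arg_neg_iff.2 h
      have := Real.pi_pos
      constructor <;> linarith
  simp only [logRatio, h1, h2]
  ring

/-- `γ₀(x; Λ) = ½ x² log (x/Λ) - ¾ x²`, with `Λ = exp l`. -/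
def gammaZero (x l : ℂ) : ℂ := 1 / 2 * x ^ 2 * logRatio x l - 3 / 4 * x ^ 2

/-- The perturbative part `∑_{α ≠ β} γ₀(a_α - a_β; Λ)`, with `Λ = exp l`. -/
def pertPart {r : ℕ} (a : Fin r → ℂ) (l : ℂ) : ℂ :=
  ∑ α, ∑ β ∈ Finset.univ.erase α, gammaZero (a α - a β) l

/-- `g` is the value `γ_{ε₁,ε₂}(x; Λ)`, `Λ = exp l`: the derivative at `s = 0` of
`(Λ^s/Γ(s)) ∫₀^∞ t^(s-1) e^(-tx) / ((e^(ε₁t) - 1)(e^(ε₂t) - 1)) dt`, continued analytically from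
`Re s > 2` (it has no poles outside `{1, 2}`). -/
def IsPertGamma (ε₁ ε₂ : ℝ) (x l g : ℂ) : Prop :=
  ∃ Z : ℂ → ℂ, DifferentiableOn ℂ Z {1, 2}ᶜ ∧
    (∀ s : ℂ, 2 < s.re → Z s = Complex.exp (l * s) / Complex.Gamma s *
      ∫ t in Set.Ioi (0 : ℝ), (t : ℂ) ^ (s - 1) * Complex.exp (-(t * x)) /
        ((Complex.exp (ε₁ * t) - 1) * (Complex.exp (ε₂ * t) - 1))) ∧
    deriv Z 0 = g

end SeibergWitten

end

/-!
The curve `Λ^r (w + w⁻¹) = P(x)` is studied through the solutions of `P(x) = 2τu` with `τ = Λ^r`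
and `u ∈ [-1, 1]`. When `τ` is small there is one solution near each `z_α`, found as the fixed point
of a contraction (`root`), and for varying `u` it sweeps out the cut around `z_α`. Each cut carries
the image of the arcsine law, the distribution of `cos θ`. The Stieltjes transform of that law is
`1 / √(v² - 4)`, so that `dS` is an average of logarithmic derivatives of `P - 2τu`, and the period
`i a_α` is the mean of `x` over the cut `α` (`aPeriod_eq`). A second contraction recovers the `z_α`
from the periods (`centers`), so everything becomes a function of `b = i a` and `τ`.

The prepotential is the renormalized logarithmic `energy` of these measures: the sum over all pairs
of cuts of the averages of `-(t² log t / 2 - 3 t² / 4)`, `t = x_α - y_β`. For two points of the same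
cut the logarithm is replaced by means of `∏_γ (x_α - y_γ) = 2τ (u - u')`, which leaves regular
logarithms and the integrable `log |2u - 2u'|`; the resulting function is holomorphic in `(b, τ)`,
also at `τ = 0`. The logarithmic potential of the arcsine law vanishes on `[-2, 2]`, and therefore
the potential of all cuts is constant on each of them (`potential_eq`). Its constant values
(`slope`) have two uses.

* The variation of a cut enters the derivative of the energy only through its mean, so that the
  derivative in `b_α` is a multiple of `slope α` (`hasFDerivAt_energy`). An integration by parts over
  the gaps between the cuts shows that the dual periods are differences of the same numbers
  (`aDual_eq`).
* They give a closed formula for the energy, by Euler's identity for the kernel (`energy_eq`). As the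
  derivative in `log Λ` involves only the second moments of the cuts, this is the homogeneity.

Adding back the dropped `log τ` gives `energyPrepotential`, the function
`energy (i a, Λ^r) - r log Λ ∑ a_α²`. Since `(τ, u)` and `(-τ, -u)` define the same point, the energy
is even in `τ` (`energy_neg`). This gives the monodromy condition, and by the Schwarz lemma the
energy differs from its value at `τ = 0` by `O(τ²) = O(Λ^(2r))` (`exists_norm_energy_sub_le`). That
value is the energy of collapsed cuts, which is the perturbative part (`pertPart_eq`).

For uniqueness, let `h` be the difference of two prepotentials. At purely imaginary `a` every small
`Λ > 0` belongs to a real curve, so the derivatives in `a` agree there, and homogeneity reduces to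
`∂h / ∂ log Λ = 2h`. Hence `h = c Λ²`, and the monodromy condition gives `c = 0` because
`exp (2πi / r) ≠ 1` (`IsPrepotential.eq_of_imaginary`). The identity theorem along a complex line
through an arbitrary `a` extends this to the whole domain (`IsPrepotential.eqOn`).

For the function `γ_{ε₁,ε₂}`, the product of the generating functions `y / (exp y - 1)` at
`y = ε₁ t, ε₂ t` is expanded to second order in `t`. The three terms give explicit Gamma integrals.
The remainder has a Mellin transform which, divided by the Gamma function, is entire
(`exists_differentiable_eq_inv_Gamma_mul_mellin`), and its contribution at `s = 0` tends to zero with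
`ε₁, ε₂` (`exists_norm_gammaTail_le`).
-/

noncomputable section

namespace SeibergWitten

open MeasureTheory Set

/-! ### The arcsine law -/

/-- The arcsine law on `[-1, 1]`: the distribution of `cos θ` for `θ` uniform in `[0, π]`. -/
def arcsine : Measure ℝ :=
  Measure.map Real.cos ((ENNReal.ofReal Real.pi⁻¹) • volume.restrict (Icc 0 Real.pi))

instance arcsine_isProbabilityMeasure : IsProbabilityMeasure arcsine := by
  refine (Measure.isProbabilityMeasure_map_iff Real.continuous_cos.measurable.aemeasurable).2 ⟨?_⟩
  have h := Real.pi_pos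
  simp only [Measure.smul_apply, Measure.restrict_apply MeasurableSet.univ, univ_inter,
    Real.volume_Icc, sub_zero, smul_eq_mul]
  rw [← ENNReal.ofReal_mul (by positivity), inv_mul_cancel₀ h.ne', ENNReal.ofReal_one]

theorem ae_arcsine_mem : ∀ᵐ u ∂arcsine, u ∈ Icc (-1 : ℝ) 1 := by
  rw [arcsine]
  refine (ae_map_iff (p := fun u : ℝ => u ∈ Icc (-1 : ℝ) 1)
    Real.continuous_cos.measurable.aemeasurable measurableSet_Icc).2 ?_
  exact Eventually.of_forall fun θ => ⟨Real.neg_one_le_cos θ, Real.cos_le_one θ⟩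

theorem measurePreserving_neg_arcsine : MeasurePreserving (fun u : ℝ => -u) arcsine arcsine := by
  refine ⟨measurable_neg, ?_⟩
  have h1 : MeasurePreserving (fun θ : ℝ => Real.pi - θ) (volume.restrict (Icc 0 Real.pi))
      (volume.restrict (Icc 0 Real.pi)) := by
    have := (Measure.measurePreserving_sub_left (volume : Measure ℝ) Real.pi).restrict_preimage
      (s := Icc 0 Real.pi) measurableSet_Icc
    simpa using this
  rw [arcsine, Measure.map_map measurable_neg Real.continuous_cos.measurable]
  have h2 : (fun u : ℝ => -u) ∘ Real.cos = Real.cos ∘ (fun θ : ℝ => Real.pi - θ) := by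
    funext θ
    simp [Real.cos_pi_sub]
  rw [h2, ← Measure.map_map Real.continuous_cos.measurable (by fun_prop), Measure.map_smul,
    h1.map_eq]

theorem integral_arcsine_neg {E : Type*} [NormedAddCommGroup E] [NormedSpace ℝ E] (f : ℝ → E) :
    ∫ u, f (-u) ∂arcsine = ∫ u, f u ∂arcsine :=
  measurePreserving_neg_arcsine.integral_comp (Homeomorph.neg ℝ).measurableEmbedding f

theorem integral_cos_two_pi {E : Type*} [NormedAddCommGroup E] [NormedSpace ℝ E] (f : ℝ → E)
    (hf : IntervalIntegrable (fun θ => f (Real.cos θ)) volume 0 (2 * Real.pi)) :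
    ∫ θ in (0)..(2 * Real.pi), f (Real.cos θ) = (2 : ℝ) • ∫ θ in (0)..Real.pi, f (Real.cos θ) := by
  have hp := Real.pi_pos
  have h0 : IntervalIntegrable (fun θ => f (Real.cos θ)) volume 0 Real.pi :=
    hf.mono_set (by rw [uIcc_of_le hp.le, uIcc_of_le (by linarith)]; exact Icc_subset_Icc_right (by linarith))
  have h1 : IntervalIntegrable (fun θ => f (Real.cos θ)) volume Real.pi (2 * Real.pi) :=
    hf.mono_set (by
      rw [uIcc_of_le (by linarith), uIcc_of_le (by linarith)]; exact Icc_subset_Icc_left hp.le)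
  rw [← intervalIntegral.integral_add_adjacent_intervals h0 h1, two_smul]
  congr 1
  have := intervalIntegral.integral_comp_sub_left (a := 0) (b := Real.pi)
    (fun θ => f (Real.cos θ)) (2 * Real.pi)
  simp only [Real.cos_two_pi_sub, sub_zero] at this
  rw [this]
  congr 1
  ring

theorem integrable_arcsine_iff {E : Type*} [NormedAddCommGroup E] {f : ℝ → E}
    (hm : StronglyMeasurable f) :
    Integrable f arcsine ↔ IntervalIntegrable (fun θ => f (Real.cos θ)) volume 0 Real.pi := by
  rw [arcsine, integrable_map_measure hm.aestronglyMeasurable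
    Real.continuous_cos.measurable.aemeasurable, intervalIntegrable_iff_integrableOn_Icc_of_le
    Real.pi_pos.le, integrable_smul_measure (by simp [Real.pi_pos]) (by simp)]
  rfl

theorem integral_arcsine {E : Type*} [NormedAddCommGroup E] [NormedSpace ℝ E] {f : ℝ → E}
    (hm : StronglyMeasurable f) :
    ∫ u, f u ∂arcsine = Real.pi⁻¹ • ∫ θ in (0)..Real.pi, f (Real.cos θ) := by
  rw [arcsine, integral_map Real.continuous_cos.measurable.aemeasurable hm.aestronglyMeasurable,
    integral_smul_measure, intervalIntegral.integral_of_le Real.pi_pos.le,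
    integral_Icc_eq_integral_Ioc, ENNReal.toReal_ofReal (by positivity)]

/-- The average of a function of `cos θ` over the unit circle is an average over the arcsine law;
the function `cos θ` is written as `(ζ + ζ⁻¹) / 2` for `ζ = exp (iθ)`. -/
theorem integral_arcsine_eq_circleAverage {E : Type*} [NormedAddCommGroup E] [NormedSpace ℝ E]
    {f : ℝ → E} (hm : StronglyMeasurable f) {g : ℂ → E} (hg : CircleIntegrable g 0 1)
    (hfg : ∀ θ : ℝ, g (circleMap 0 1 θ) = f (Real.cos θ)) :
    Integrable f arcsine ∧ ∫ u, f u ∂arcsine = Real.circleAverage g 0 1 := by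
  have hp := Real.pi_pos
  have hi : IntervalIntegrable (fun θ => f (Real.cos θ)) volume 0 (2 * Real.pi) := by
    simpa [CircleIntegrable, hfg] using hg
  constructor
  · rw [integrable_arcsine_iff hm]
    exact hi.mono_set (by
      rw [uIcc_of_le hp.le, uIcc_of_le (by linarith)]; exact Icc_subset_Icc_right (by linarith))
  · rw [integral_arcsine hm, Real.circleAverage]
    simp only [hfg]
    rw [integral_cos_two_pi _ hi, smul_smul]
    congr 1
    field_simp

theorem circleMap_add_inv (θ : ℝ) :
    circleMap 0 1 θ + (circleMap 0 1 θ)⁻¹ = 2 * (Real.cos θ : ℂ) := by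
  simp only [circleMap, Complex.ofReal_one, one_mul, zero_add, ← Complex.exp_neg]
  rw [Complex.ofReal_cos, Complex.cos]
  ring_nf

/-- The logarithmic potential of the arcsine law, in the uniformizing coordinate `v = w + 1/w`. -/
theorem integral_log_arcsine_of_eq_add_inv (v : ℝ) (w : ℂ) (hw : w ≠ 0) (hv : (v : ℂ) = w + w⁻¹) :
    Integrable (fun u => Real.log |v - 2 * u|) arcsine ∧
      ∫ u, Real.log |v - 2 * u| ∂arcsine = Real.posLog ‖w‖ + Real.posLog ‖w⁻¹‖ := by
  have hf2 : CircleIntegrable (fun ζ : ℂ => Real.log ‖ζ - w‖ + Real.log ‖ζ - w⁻¹‖) 0 1 :=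
    (circleIntegrable_log_norm_sub_const 1).add (circleIntegrable_log_norm_sub_const 1)
  -- `v - (ζ + ζ⁻¹) = -(ζ - w) (ζ - w⁻¹) ζ⁻¹`; the two sides may differ where `ζ` is a root,
  -- because `log 0 = 0`
  have hcod : (fun ζ : ℂ => Real.log ‖ζ - w‖ + Real.log ‖ζ - w⁻¹‖)
      =ᶠ[codiscreteWithin (Metric.sphere 0 |1|)] fun ζ : ℂ => Real.log ‖(v : ℂ) - (ζ + ζ⁻¹)‖ := by
    have : ({w, w⁻¹} : Set ℂ)ᶜ ∈ codiscreteWithin (Metric.sphere (0 : ℂ) |1|) := by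
      have h := (Set.toFinite ({w, w⁻¹} : Set ℂ)).compl_mem_codiscrete
      exact Filter.codiscreteWithin_mono (subset_univ _) h
    filter_upwards [this, Filter.self_mem_codiscreteWithin (Metric.sphere (0 : ℂ) |1|)] with ζ h1 h2
    have h3 : ‖ζ‖ = 1 := by simpa using h2
    have hζ : ζ ≠ 0 := by
      rintro rfl
      simp at h3
    have h1a : ζ ≠ w := fun h => h1 (by simp [h])
    have h1b : ζ ≠ w⁻¹ := fun h => h1 (by simp [h])
    have h4 : (v : ℂ) - (ζ + ζ⁻¹) = -((ζ - w) * (ζ - w⁻¹)) * ζ⁻¹ := by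
      rw [hv]
      field_simp
      ring
    rw [h4, norm_mul, norm_neg, norm_mul, norm_inv, h3, inv_one, mul_one, Real.log_mul
      (norm_ne_zero_iff.2 (sub_ne_zero.2 h1a)) (norm_ne_zero_iff.2 (sub_ne_zero.2 h1b))]
  have hf1 : CircleIntegrable (fun ζ : ℂ => Real.log ‖(v : ℂ) - (ζ + ζ⁻¹)‖) 0 1 :=
    hf2.congr_codiscreteWithin hcod
  have hm : StronglyMeasurable (fun u : ℝ => Real.log |v - 2 * u|) :=
    Measurable.stronglyMeasurable (by fun_prop)
  obtain ⟨h1, h2⟩ := integral_arcsine_eq_circleAverage hm hf1 (by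
    intro θ
    rw [circleMap_add_inv, ← Real.norm_eq_abs]
    congr 1
    rw [← Complex.norm_real]
    push_cast
    rfl)
  refine ⟨h1, ?_⟩
  rw [h2, ← Real.circleAverage_congr_codiscreteWithin hcod one_ne_zero,
    Real.circleAverage_fun_add (circleIntegrable_log_norm_sub_const 1)
      (circleIntegrable_log_norm_sub_const 1), circleAverage_log_norm_sub_const_eq_posLog,
    circleAverage_log_norm_sub_const_eq_posLog]

/-- On `[-2, 2]` the logarithmic potential vanishes. -/
theorem integral_log_arcsine_of_abs_le {v : ℝ} (hv : |v| ≤ 2) :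
    ∫ u, Real.log |v - 2 * u| ∂arcsine = 0 := by
  have h := abs_le.1 hv
  obtain ⟨φ, hφ⟩ : ∃ φ, Real.cos φ = v / 2 :=
    ⟨Real.arccos (v / 2), Real.cos_arccos (by linarith) (by linarith)⟩
  have h1 := circleMap_add_inv φ
  have h2 : ‖circleMap 0 1 φ‖ = 1 := by simp
  have h3 : circleMap 0 1 φ ≠ 0 := by
    rw [← norm_ne_zero_iff, h2]
    exact one_ne_zero
  rw [(integral_log_arcsine_of_eq_add_inv v (circleMap 0 1 φ) h3 (by rw [h1, hφ]; push_cast; ring)).2,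
    norm_inv, h2]
  simp

/-- Outside `[-2, 2]` the logarithmic potential is `log |w|` for the root `w` of `w + 1/w = v` with
`|w| ≥ 1`. -/
theorem integral_log_arcsine_of_le_abs {v : ℝ} (hv : 2 ≤ |v|) :
    ∫ u, Real.log |v - 2 * u| ∂arcsine = Real.log ((|v| + √(v ^ 2 - 4)) / 2) := by
  have hsq : 0 ≤ v ^ 2 - 4 := by nlinarith [sq_abs v]
  have hss := Real.mul_self_sqrt hsq
  set S := √(v ^ 2 - 4)
  have hS : 0 ≤ S := Real.sqrt_nonneg _
  -- `σ` is the sign of `v`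
  obtain ⟨σ, hσ, hσv⟩ : ∃ σ : ℝ, σ ^ 2 = 1 ∧ σ * |v| = v := by
    rcases le_total 0 v with h | h
    · exact ⟨1, by norm_num, by rw [abs_of_nonneg h, one_mul]⟩
    · exact ⟨-1, by norm_num, by rw [abs_of_nonpos h]; ring⟩
  have hw1 : 1 ≤ (|v| + S) / 2 := by linarith
  have hσ0 : σ ≠ 0 := by
    rintro rfl
    norm_num at hσ
  have hσa : |σ| = 1 := by
    have := sq_abs σ
    nlinarith [abs_nonneg σ]
  set w : ℝ := σ * ((|v| + S) / 2)
  have hw0 : w ≠ 0 := mul_ne_zero hσ0 (by linarith)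
  have hwi : v = w + w⁻¹ := by
    have : w⁻¹ = σ * ((|v| - S) / 2) := by
      rw [inv_eq_iff_eq_inv, eq_comm, inv_eq_iff_eq_inv, eq_comm]
      refine inv_eq_of_mul_eq_one_right ?_
      have := sq_abs v
      simp only [w]
      linear_combination ((|v| ^ 2 - S * S) / 4) * hσ + this / 4 - hss / 4
    rw [this]
    simp only [w]
    linear_combination -hσv
  have habs : |w| = (|v| + S) / 2 := by
    simp only [w]
    rw [abs_mul, hσa, one_mul, abs_of_nonneg (by linarith)]
  rw [(integral_log_arcsine_of_eq_add_inv v w (by exact_mod_cast hw0) (by exact_mod_cast hwi)).2, norm_inv,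
    Complex.norm_real, Real.norm_eq_abs, habs, Real.posLog_eq_log (by
      rw [abs_of_nonneg (by linarith)]; exact hw1)]
  have : Real.posLog ((|v| + S) / 2)⁻¹ = 0 := by
    rw [Real.posLog_eq_zero_iff, abs_of_nonneg (by positivity)]
    exact inv_le_one_of_one_le₀ hw1
  rw [this, add_zero]

theorem integrable_log_arcsine (v : ℝ) : Integrable (fun u => Real.log |v - 2 * u|) arcsine := by
  -- `w² - v w + 1 = 0` has a root, and it is not zero
  obtain ⟨w, hw⟩ : ∃ w : ℂ, w * w = v * w - 1 := by
    obtain ⟨d, hd⟩ := IsSquare.exists_mul_self ((v : ℂ) ^ 2 - 4) (by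
      obtain ⟨d, hd⟩ := IsAlgClosed.exists_pow_nat_eq ((v : ℂ) ^ 2 - 4) (n := 2) (by norm_num)
      exact ⟨d, by rw [← hd, sq]⟩)
    exact ⟨(v + d) / 2, by linear_combination -hd / 4⟩
  have hw0 : w ≠ 0 := by
    rintro rfl
    norm_num at hw
  exact (integral_log_arcsine_of_eq_add_inv v w hw0 (by field_simp; linear_combination -hw)).1

/-- The Stieltjes transform of the arcsine law.  The principal branch of the root has positive
real part, which selects the root `w` of `w + 1/w = v` with `|w| > 1`. -/
theorem integral_inv_arcsine {v : ℂ} (hv : 2 < ‖v‖) :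
    ∫ u, (v - 2 * (u : ℂ))⁻¹ ∂arcsine = (v * (1 - 4 / v ^ 2) ^ (1 / 2 : ℂ))⁻¹ := by
  have hv0 : v ≠ 0 := by
    rintro rfl
    simp at hv
    linarith
  set R : ℂ := (1 - 4 / v ^ 2) ^ (1 / 2 : ℂ) with hR
  have hnorm : ‖4 / v ^ 2‖ < 1 := by
    rw [norm_div, norm_pow, div_lt_one (by positivity)]
    norm_num
    nlinarith
  have hslit : 0 < (1 - 4 / v ^ 2 : ℂ).re := by
    have := Complex.abs_re_le_norm (4 / v ^ 2)
    have := (abs_le.1 this).2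
    simp only [Complex.sub_re, Complex.one_re]
    linarith
  have hne : (1 - 4 / v ^ 2 : ℂ) ≠ 0 := by
    intro h
    rw [h] at hslit
    simp at hslit
  have hR2 : R ^ 2 = 1 - 4 / v ^ 2 := by
    rw [hR, ← Complex.cpow_nat_mul]
    norm_num
  have hRre : 0 < R.re := by
    rw [hR, Complex.cpow_def_of_ne_zero hne, Complex.exp_re]
    refine mul_pos (Real.exp_pos _) (Real.cos_pos_of_mem_Ioo ?_)
    have h1 := Complex.abs_arg_lt_pi_div_two_iff.2 (Or.inl hslit)
    have h2 := abs_lt.1 h1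
    have h3 : (Complex.log (1 - 4 / v ^ 2) * (1 / 2 : ℂ)).im = (1 - 4 / v ^ 2 : ℂ).arg / 2 := by
      have : (1 / 2 : ℂ) = ((1 / 2 : ℝ) : ℂ) := by push_cast; rfl
      rw [this, Complex.im_mul_ofReal, Complex.log_im]
      ring
    rw [h3]
    constructor <;> linarith
  have hR0 : R ≠ 0 := by
    intro h
    rw [h] at hRre
    simp at hRre
  -- the two roots of `ζ + ζ⁻¹ = v`, with product `1`; since `Re R > 0`, the root `w` is the larger
  -- one
  set w := v * (1 + R) / 2 with hw
  set w' := v * (1 - R) / 2 with hw'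
  have hvv : v ^ 2 * (4 / v ^ 2) = 4 := by field_simp
  have hww : w * w' = 1 := by
    simp only [hw, hw']
    linear_combination -v ^ 2 / 4 * hR2 + hvv / 4
  have hlt : ‖w'‖ < ‖w‖ := by
    simp only [hw, hw', norm_div, norm_mul]
    have : ‖1 - R‖ < ‖1 + R‖ := by
      rw [← sq_lt_sq₀ (norm_nonneg _) (norm_nonneg _), Complex.sq_norm, Complex.sq_norm,
        Complex.normSq_apply, Complex.normSq_apply]
      simp
      nlinarith
    have := norm_pos_iff.2 hv0
    have : 0 < ‖(2 : ℂ)‖ := by norm_num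
    gcongr
  have hprod : ‖w‖ * ‖w'‖ = 1 := by rw [← norm_mul, hww, norm_one]
  have hw1 : 1 < ‖w‖ := by nlinarith [norm_nonneg w, norm_nonneg w']
  have hw'1 : ‖w'‖ < 1 := by nlinarith [norm_nonneg w, norm_nonneg w']
  have hsum : w + w' = v := by simp only [hw, hw']; ring
  have hkey : ∀ ζ : ℂ, ζ ≠ 0 → (v - (ζ + ζ⁻¹)) = -((ζ - w') * (ζ - w)) * ζ⁻¹ := by
    intro ζ hζ
    field_simp
    linear_combination (-ζ) * hsum + hww
  have hne1 : ∀ ζ : ℂ, ‖ζ‖ = 1 → ζ - w ≠ 0 := by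
    intro ζ hζ h
    rw [sub_eq_zero.1 h] at hζ
    linarith
  have hne2 : ∀ ζ : ℂ, ‖ζ‖ = 1 → ζ - w' ≠ 0 := by
    intro ζ hζ h
    rw [sub_eq_zero.1 h] at hζ
    linarith
  have hne0 : ∀ ζ : ℂ, ‖ζ‖ = 1 → ζ ≠ 0 := by
    rintro ζ hζ rfl
    simp at hζ
  have hcont : ContinuousOn (fun ζ : ℂ => (v - (ζ + ζ⁻¹))⁻¹) (Metric.sphere 0 1) := by
    refine ContinuousOn.inv₀ ?_ ?_
    · refine continuousOn_const.sub (continuousOn_id.add (continuousOn_id.inv₀ ?_))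
      intro ζ hζ
      exact hne0 ζ (by simpa using hζ)
    · intro ζ hζ
      have hζ' : ‖ζ‖ = 1 := by simpa using hζ
      rw [hkey ζ (hne0 ζ hζ')]
      exact mul_ne_zero (neg_ne_zero.2 (mul_ne_zero (hne2 ζ hζ') (hne1 ζ hζ')))
        (inv_ne_zero (hne0 ζ hζ'))
  have hm : StronglyMeasurable (fun u : ℝ => (v - 2 * (u : ℂ))⁻¹) :=
    Measurable.stronglyMeasurable (by fun_prop)
  rw [(integral_arcsine_eq_circleAverage hm (hcont.circleIntegrable zero_le_one) (by
    intro θ; rw [circleMap_add_inv])).2, Real.circleAverage_eq_circleIntegral one_ne_zero]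
  -- on the unit circle the integrand is the Cauchy kernel at the inner root, applied to a
  -- function that is holomorphic on the disc
  have hci : (∮ z in C(0, 1), (z - 0)⁻¹ • (v - (z + z⁻¹))⁻¹) =
      ∮ z in C(0, 1), (z - w')⁻¹ • (-(z - w)⁻¹) := by
    refine circleIntegral.integral_congr zero_le_one ?_
    intro ζ hζ
    have hζ' : ‖ζ‖ = 1 := by simpa using hζ
    have a0 := hne0 ζ hζ'
    have a1 := hne1 ζ hζ'
    have a2 := hne2 ζ hζ'
    simp only [smul_eq_mul, sub_zero]
    rw [hkey ζ a0]
    field_simp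
  have hcl : DiffContOnCl ℂ (fun z : ℂ => -(z - w)⁻¹) (Metric.ball 0 1) := by
    refine DifferentiableOn.diffContOnCl ?_
    rw [closure_ball _ one_ne_zero]
    intro z hz
    have : ‖z‖ ≤ 1 := by simpa using hz
    refine DifferentiableAt.differentiableWithinAt ?_
    refine ((differentiableAt_id.sub_const w).inv ?_).neg
    intro (h : z - w = 0)
    rw [sub_eq_zero.1 h] at this
    linarith
  rw [hci, hcl.circleIntegral_sub_inv_smul (by simpa using hw'1), smul_smul,
    inv_mul_cancel₀ (by simp [Real.pi_ne_zero]), one_smul]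
  have : w' - w = -(v * R) := by simp only [hw, hw']; ring
  rw [this, inv_neg, neg_neg]

/-- Uniformly in `u ∈ [-1, 1]`, the function `log |2u - 2u'|` has a bounded `L¹` norm. -/
theorem integral_norm_log_arcsine_le {u : ℝ} (hu : u ∈ Icc (-1 : ℝ) 1) :
    ∫ u', ‖Real.log |2 * u - 2 * u'|‖ ∂arcsine ≤ 2 * Real.log 4 := by
  have h0 := integral_log_arcsine_of_abs_le (v := 2 * u) (abs_le.2 ⟨by linarith [hu.1], by linarith [hu.2]⟩)
  have hi := integrable_log_arcsine (2 * u)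
  -- `log ≤ log 4`, hence `|log| ≤ 2 log 4 - log`, and the average of the logarithm is zero
  have : ∫ u', ‖Real.log |2 * u - 2 * u'|‖ ∂arcsine ≤
      ∫ u', (2 * Real.log 4 - Real.log |2 * u - 2 * u'|) ∂arcsine := by
    refine integral_mono_ae hi.norm ((integrable_const _).sub hi) ?_
    filter_upwards [ae_arcsine_mem] with u' hu'
    have hle : |2 * u - 2 * u'| ≤ 4 := abs_le.2
      ⟨by linarith [hu.1, hu'.2], by linarith [hu.2, hu'.1]⟩
    have hl4 : 0 ≤ Real.log 4 := Real.log_nonneg (by norm_num)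
    have hle2 : Real.log |2 * u - 2 * u'| ≤ Real.log 4 := by
      rcases (abs_nonneg (2 * u - 2 * u')).eq_or_lt with h | h
      · rw [← h, Real.log_zero]
        exact hl4
      · exact Real.log_le_log h hle
    exact abs_le.2 ⟨by linarith, by linarith⟩
  refine this.trans ?_
  rw [integral_sub (integrable_const _) hi, h0]
  simp

theorem integrable_log_prod_arcsine (μ : Measure ℝ) [IsFiniteMeasure μ]
    (hμ : ∀ᵐ u ∂μ, u ∈ Icc (-1 : ℝ) 1) :
    Integrable (fun p : ℝ × ℝ => Real.log |2 * p.1 - 2 * p.2|) (μ.prod arcsine) := by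
  have hm : Measurable (fun p : ℝ × ℝ => Real.log |2 * p.1 - 2 * p.2|) := by fun_prop
  rw [integrable_prod_iff hm.aestronglyMeasurable]
  refine ⟨Eventually.of_forall fun u => integrable_log_arcsine (2 * u), ?_⟩
  refine Integrable.of_bound (C := 2 * Real.log 4) ?_ ?_
  · exact (hm.norm.stronglyMeasurable.integral_prod_right (ν := arcsine)).aestronglyMeasurable
  · filter_upwards [hμ] with u hu
    rw [Real.norm_of_nonneg (integral_nonneg fun _ => norm_nonneg _)]
    exact integral_norm_log_arcsine_le hu

/-! ### Fixed points of contractions, and their dependence on parameters -/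

theorem exists_fixedPoint_of_contraction {W : Type*} [NormedAddCommGroup W] [CompleteSpace W]
    {f : W → W} {c : W} {R : ℝ} {K : NNReal} (hR : 0 ≤ R) (hK : K < 1)
    (hmaps : MapsTo f (Metric.closedBall c R) (Metric.closedBall c R))
    (hlip : LipschitzOnWith K f (Metric.closedBall c R)) :
    ∃ w ∈ Metric.closedBall c R, f w = w := by
  obtain ⟨w, hw, hfix, -⟩ := ContractingWith.exists_fixedPoint' (K := K)
    Metric.isClosed_closedBall.isComplete hmaps
    ⟨hK, hlip.mapsToRestrict hmaps⟩ (Metric.mem_closedBall_self hR) (edist_ne_top _ _)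
  exact ⟨w, hw, hfix⟩

theorem eq_of_fixedPoint_of_contraction {W : Type*} [NormedAddCommGroup W] {f : W → W}
    {s : Set W} {K : NNReal} (hK : K < 1) (hlip : LipschitzOnWith K f s) {v w : W} (hv : v ∈ s)
    (hw : w ∈ s) (hfv : f v = v) (hfw : f w = w) : v = w := by
  have h := hlip.dist_le_mul v hv w hw
  rw [hfv, hfw] at h
  have h1 : (K : ℝ) < 1 := by exact_mod_cast hK
  have h2 : dist v w ≤ 0 := by nlinarith [dist_nonneg (x := v) (y := w)]
  exact dist_le_zero.1 h2

/-- A locally unique fixed point `w p` of a contraction `v ↦ Φ (p, v)` is as smooth in the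
parameter `p` as `Φ` is. -/
theorem contDiffAt_fixedPoint {E W : Type*} [NormedAddCommGroup E] [NormedSpace ℂ E]
    [CompleteSpace E] [NormedAddCommGroup W] [NormedSpace ℂ W] [CompleteSpace W]
    {Φ : E × W → W} {w : E → W} {p₀ : E} (hΦ : ContDiffAt ℂ 1 Φ (p₀, w p₀)) {K : NNReal}
    (hK : K < 1) {V : Set W} (hV : V ∈ 𝓝 (w p₀)) (hlip : LipschitzOnWith K (fun v => Φ (p₀, v)) V)
    (hfix : Φ (p₀, w p₀) = w p₀)
    (huniq : ∀ᶠ q in 𝓝 (p₀, w p₀), Φ q = q.2 → q.2 = w q.1) : ContDiffAt ℂ 1 w p₀ := by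
  -- the implicit function theorem for `v - Φ (p, v) = 0`: its derivative in `v` is `1 - A` with
  -- `‖A‖ < 1`
  set f : E × W → W := fun q => q.2 - Φ q
  have hf : ContDiffAt ℂ 1 f (p₀, w p₀) := contDiffAt_snd.sub hΦ
  have hdΦ : DifferentiableAt ℂ Φ (p₀, w p₀) := hΦ.differentiableAt one_ne_zero
  set A : W →L[ℂ] W := fderiv ℂ Φ (p₀, w p₀) ∘L .inr ℂ E W with hA
  have hAderiv : HasFDerivAt (fun v => Φ (p₀, v)) A (w p₀) :=
    hdΦ.hasFDerivAt.comp (w p₀) (hasFDerivAt_prodMk_right p₀ (w p₀))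
  have hAn : ‖A‖ < 1 := (hAderiv.le_of_lipschitzOn hV hlip).trans_lt (by exact_mod_cast hK)
  have hd : fderiv ℂ f (p₀, w p₀) ∘L .inr ℂ E W = 1 - A := by
    have : fderiv ℂ f (p₀, w p₀) = ContinuousLinearMap.snd ℂ E W - fderiv ℂ Φ (p₀, w p₀) :=
      (hasFDerivAt_snd.sub hdΦ.hasFDerivAt).fderiv
    rw [this, hA]
    ext v
    simp
  have hinv : (fderiv ℂ f (p₀, w p₀) ∘L .inr ℂ E W).IsInvertible := by
    rw [hd]
    obtain ⟨e, he⟩ := isUnit_one_sub_of_norm_lt_one hAn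
    exact ⟨ContinuousLinearEquiv.ofUnit e, by rw [← he]; rfl⟩
  set ψ := hf.implicitFunction one_ne_zero hinv
  have hψ : ContDiffAt ℂ 1 ψ p₀ := hf.contDiffAt_implicitFunction one_ne_zero hinv
  have hψ0 : ψ p₀ = w p₀ := hf.implicitFunction_apply_self one_ne_zero hinv
  have hψe : ∀ᶠ p in 𝓝 p₀, f (p, ψ p) = f (p₀, w p₀) :=
    hf.eventually_apply_implicitFunction one_ne_zero hinv
  have ht : Tendsto (fun p => (p, ψ p)) (𝓝 p₀) (𝓝 (p₀, w p₀)) := by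
    rw [← hψ0]
    exact tendsto_id.prodMk_nhds hψ.continuousAt
  refine hψ.congr_of_eventuallyEq ?_
  filter_upwards [hψe, ht.eventually huniq] with p h1 h2
  refine (h2 ?_).symm
  simp only [f, hfix, sub_self] at h1
  exact (sub_eq_zero.1 h1).symm

/-! ### Integrals depending on parameters -/

section Parametric

variable {E H G Y : Type*} [NormedAddCommGroup E] [NormedSpace ℂ E] [ProperSpace E]
  [NormedAddCommGroup H] [NormedSpace ℂ H] [NormedAddCommGroup G] [NormedSpace ℂ G]
  [TopologicalSpace Y] [MeasurableSpace Y] [OpensMeasurableSpace Y] [SecondCountableTopology Y]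

theorem aestronglyMeasurable_of_continuousOn_ae {G : Type*} [TopologicalSpace G]
    [TopologicalSpace.PseudoMetrizableSpace G] {μ : Measure Y} {K : Set Y}
    (hKm : MeasurableSet K) (hμ : ∀ᵐ y ∂μ, y ∈ K) {f : Y → G} (hf : ContinuousOn f K) :
    AEStronglyMeasurable f μ := by
  rw [← Measure.restrict_eq_self_of_ae_mem hμ]
  exact hf.aestronglyMeasurable hKm

theorem integrable_smul_of_continuousOn {G : Type*} [NormedAddCommGroup G] [NormedSpace ℝ G]
    {μ : Measure Y} {K : Set Y} (hK : IsCompact K)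
    (hKm : MeasurableSet K) (hμ : ∀ᵐ y ∂μ, y ∈ K) {g : Y → ℝ} (hg : Integrable g μ) {f : Y → G}
    (hf : ContinuousOn f K) : Integrable (fun y => g y • f y) μ := by
  obtain ⟨C, hC⟩ := hK.exists_bound_of_continuousOn hf
  refine hg.smul_bdd C (aestronglyMeasurable_of_continuousOn_ae hKm hμ hf) ?_
  filter_upwards [hμ] with y hy using hC y hy

/-- Differentiation under an integral against an integrable weight over a compact set. -/
theorem hasFDerivAt_integral_smul {μ : Measure Y} {K : Set Y} (hK : IsCompact K)
    (hKm : MeasurableSet K) (hμ : ∀ᵐ y ∂μ, y ∈ K) {g : Y → ℝ} (hg : Integrable g μ)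
    {e : Y → H} (he : Continuous e) {ξ : E × H → G} {U : Set E} (hU : IsOpen U)
    (hξ : ∀ p ∈ U, ∀ y ∈ K, ContDiffAt ℂ 1 ξ (p, e y)) :
    ContinuousOn (fun p => ∫ y, g y • (fderiv ℂ ξ (p, e y) ∘L .inl ℂ E H) ∂μ) U ∧
    ∀ p ∈ U, Integrable (fun y => g y • (fderiv ℂ ξ (p, e y) ∘L .inl ℂ E H)) μ ∧
      HasFDerivAt (fun p => ∫ y, g y • ξ (p, e y) ∂μ)
        (∫ y, g y • (fderiv ℂ ξ (p, e y) ∘L .inl ℂ E H) ∂μ) p := by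
  set f' : E → Y → E →L[ℂ] G := fun p y => fderiv ℂ ξ (p, e y) ∘L .inl ℂ E H with hf'
  have hcontξ : ContinuousOn (fun q : E × Y => ξ (q.1, e q.2)) (U ×ˢ K) := by
    rintro ⟨p, y⟩ ⟨hp, hy⟩
    have h1 : ContinuousAt (fun q : E × Y => (q.1, e q.2)) (p, y) := by fun_prop
    exact (ContinuousAt.comp (f := fun q : E × Y => (q.1, e q.2)) (x := (p, y))
      (hξ p hp y hy).continuousAt h1).continuousWithinAt
  have hcont' : ContinuousOn (fun q : E × Y => f' q.1 q.2) (U ×ˢ K) := by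
    rintro ⟨p, y⟩ ⟨hp, hy⟩
    have h1 : ContinuousAt (fun q : E × Y => (q.1, e q.2)) (p, y) := by fun_prop
    have h2 : ContinuousAt (fderiv ℂ ξ) (p, e y) := (hξ p hp y hy).continuousAt_fderiv one_ne_zero
    have h3 : ContinuousAt (fun q : E × Y => fderiv ℂ ξ (q.1, e q.2)) (p, y) :=
      ContinuousAt.comp (f := fun q : E × Y => (q.1, e q.2)) (x := (p, y)) h2 h1
    exact (h3.clm_comp continuousAt_const).continuousWithinAt
  have hsecξ : ∀ p ∈ U, ContinuousOn (fun y => ξ (p, e y)) K := fun p hp =>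
    hcontξ.comp (f := fun y => (p, y)) (by fun_prop) fun y hy => ⟨hp, hy⟩
  have hsec' : ∀ p ∈ U, ContinuousOn (fun y => f' p y) K := fun p hp =>
    hcont'.comp (f := fun y => (p, y)) (by fun_prop) fun y hy => ⟨hp, hy⟩
  have key : ∀ p ∈ U, ∃ ε > 0, ∃ C : ℝ, Metric.closedBall p ε ⊆ U ∧
      ∀ q ∈ Metric.closedBall p ε, ∀ y ∈ K, ‖f' q y‖ ≤ C := by
    intro p hp
    obtain ⟨ε, hε, hsub⟩ := Metric.nhds_basis_closedBall.mem_iff.1 (hU.mem_nhds hp)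
    obtain ⟨C, hC⟩ := ((isCompact_closedBall p ε).prod hK).exists_bound_of_continuousOn
      (hcont'.mono (prod_mono hsub le_rfl))
    exact ⟨ε, hε, C, hsub, fun q hq y hy => hC (q, y) ⟨hq, hy⟩⟩
  have hmeas' : ∀ p ∈ U, AEStronglyMeasurable (fun y => g y • f' p y) μ := fun p hp =>
    hg.aestronglyMeasurable.smul
      (aestronglyMeasurable_of_continuousOn_ae hKm hμ (hsec' p hp))
  constructor
  · intro p hp
    obtain ⟨ε, hε, C, hsub, hC⟩ := key p hp
    refine ContinuousAt.continuousWithinAt ?_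
    refine continuousAt_of_dominated (bound := fun y => ‖g y‖ * C) ?_ ?_ (hg.norm.mul_const C) ?_
    · filter_upwards [Metric.closedBall_mem_nhds p hε] with q hq using hmeas' q (hsub hq)
    · filter_upwards [Metric.closedBall_mem_nhds p hε] with q hq
      filter_upwards [hμ] with y hy
      rw [norm_smul]
      exact mul_le_mul_of_nonneg_left (hC q hq y hy) (norm_nonneg _)
    · filter_upwards [hμ] with y hy
      have h1 : ContinuousAt (fun q => f' q y) p := by
        have h2 : ContinuousWithinAt (fun q : E × Y => f' q.1 q.2) (U ×ˢ K) (p, y) :=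
          hcont' (p, y) ⟨hp, hy⟩
        have h3 : ContinuousWithinAt (fun q => f' q y) U p :=
          ContinuousWithinAt.comp (f := fun q : E => (q, y)) (x := p) h2 (by fun_prop)
            fun q hq => ⟨hq, hy⟩
        exact h3.continuousAt (hU.mem_nhds hp)
      exact h1.const_smul (g y)
  · intro p hp
    refine ⟨integrable_smul_of_continuousOn hK hKm hμ hg (hsec' p hp), ?_⟩
    obtain ⟨ε, hε, C, hsub, hC⟩ := key p hp
    refine hasFDerivAt_integral_of_dominated_of_fderiv_le (F := fun q y => g y • ξ (q, e y))
      (F' := fun q y => g y • f' q y) (bound := fun y => ‖g y‖ * C)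
      (Metric.closedBall_mem_nhds p hε) ?_ ?_ (hmeas' p hp) ?_ (hg.norm.mul_const C) ?_
    · filter_upwards [Metric.closedBall_mem_nhds p hε] with q hq
      exact hg.aestronglyMeasurable.smul
        (aestronglyMeasurable_of_continuousOn_ae hKm hμ (hsecξ q (hsub hq)))
    · exact integrable_smul_of_continuousOn hK hKm hμ hg (hsecξ p hp)
    · filter_upwards [hμ] with y hy q hq
      rw [norm_smul]
      exact mul_le_mul_of_nonneg_left (hC q hq y hy) (norm_nonneg _)
    · filter_upwards [hμ] with y hy q hq
      have h1 : HasFDerivAt ξ (fderiv ℂ ξ (q, e y)) (q, e y) :=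
        ((hξ q (hsub hq) y hy).differentiableAt one_ne_zero).hasFDerivAt
      have h2 : HasFDerivAt (fun q => ξ (q, e y)) (f' q y) q :=
        h1.comp q (hasFDerivAt_prodMk_left q (e y))
      exact h2.const_smul (g y)

end Parametric

/-- The average over the arcsine law of a function that is holomorphic in the parameters near the
segment `[-1, 1]` is continuously differentiable, and the derivative passes under the integral. -/
theorem contDiffAt_integral_arcsine {E G : Type*} [NormedAddCommGroup E] [NormedSpace ℂ E]
    [ProperSpace E] [NormedAddCommGroup G] [NormedSpace ℂ G] {ξ : E × ℂ → G} {U : Set E}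
    (hU : IsOpen U) (hξ : ∀ p ∈ U, ∀ u ∈ Icc (-1 : ℝ) 1, ContDiffAt ℂ 1 ξ (p, (u : ℂ))) {p : E}
    (hp : p ∈ U) :
    ContDiffAt ℂ 1 (fun p => ∫ u, ξ (p, ((u : ℝ) : ℂ)) ∂arcsine) p ∧
    Integrable (fun u : ℝ => fderiv ℂ ξ (p, (u : ℂ)) ∘L .inl ℂ E ℂ) arcsine ∧
    HasFDerivAt (fun p => ∫ u, ξ (p, ((u : ℝ) : ℂ)) ∂arcsine)
      (∫ u, (fderiv ℂ ξ (p, ((u : ℝ) : ℂ)) ∘L .inl ℂ E ℂ) ∂arcsine) p := by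
  have h := hasFDerivAt_integral_smul (μ := arcsine) isCompact_Icc measurableSet_Icc
    ae_arcsine_mem (integrable_const (1 : ℝ)) Complex.continuous_ofReal hU hξ
  simp only [one_smul] at h
  exact ⟨contDiffAt_one_iff.2 ⟨_, U, hU.mem_nhds hp, h.1, fun p hp => (h.2 p hp).2⟩, h.2 p hp⟩

/-! ### Even holomorphic functions -/

/-- Schwarz lemma for an even function: it vanishes to second order. -/
theorem norm_sub_le_of_even {f : ℂ → ℂ} {R M : ℝ} (hR : 0 < R)
    (hd : DifferentiableOn ℂ f (Metric.ball 0 R)) (heven : ∀ τ ∈ Metric.ball (0 : ℂ) R, f (-τ) = f τ)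
    (hM : ∀ τ ∈ Metric.ball (0 : ℂ) R, ‖f τ - f 0‖ ≤ M) {τ : ℂ} (hτ : τ ∈ Metric.ball (0 : ℂ) R) :
    ‖f τ - f 0‖ ≤ M * (‖τ‖ / R) ^ 2 := by
  have hnhds : Metric.ball (0 : ℂ) R ∈ 𝓝 0 := Metric.ball_mem_nhds _ hR
  have hd0 : DifferentiableAt ℂ f 0 := hd.differentiableAt hnhds
  have h0 : deriv f 0 = 0 := by
    have h1 : HasDerivAt (fun τ => f (-τ)) (-deriv f 0) 0 := by
      have h2 : HasDerivAt f (deriv f 0) (-(0 : ℂ)) := by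
        rw [neg_zero]
        exact hd0.hasDerivAt
      have h5 := h2.scomp (0 : ℂ) (hasDerivAt_neg (0 : ℂ))
      rw [neg_one_smul] at h5
      exact h5
    have h3 : HasDerivAt f (-deriv f 0) 0 := h1.congr_of_eventuallyEq (by
      filter_upwards [hnhds] with τ hτ using (heven τ hτ).symm)
    have h4 := h3.unique hd0.hasDerivAt
    linear_combination -h4 / 2
  have hlo : (f · - f 0) =o[𝓝 0] (fun w : ℂ => ‖w - 0‖ ^ 1) := by
    have h1 := hd0.hasDerivAt
    rw [h0, hasDerivAt_iff_isLittleO] at h1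
    simpa using h1.norm_right
  have h := Complex.dist_le_mul_div_pow_of_mapsTo_ball_of_isLittleO (n := 1) hd
    (fun τ hτ => by simpa [dist_eq_norm] using hM τ hτ) hlo hτ
  simpa [dist_eq_norm] using h

/-! ### The ordered gap of a configuration -/

/-- The smallest of the numbers `Re (z_α - z_β)`, `α < β`. -/
def orderGap {r : ℕ} (z : Fin r → ℂ) : ℝ :=
  ⨅ p : {p : Fin r × Fin r // p.1 < p.2}, (z p.1.1 - z p.1.2).re

theorem orderGap_le {r : ℕ} (z : Fin r → ℂ) {α β : Fin r} (h : α < β) :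
    orderGap z ≤ (z α - z β).re :=
  ciInf_le (Finite.bddBelow_range _) (⟨(α, β), h⟩ : {p : Fin r × Fin r // p.1 < p.2})

theorem le_orderGap {r : ℕ} (hr : 2 ≤ r) {z : Fin r → ℂ} {d : ℝ}
    (h : ∀ α β, α < β → d ≤ (z α - z β).re) : d ≤ orderGap z := by
  have : Nonempty {p : Fin r × Fin r // p.1 < p.2} :=
    ⟨⟨(⟨0, by omega⟩, ⟨1, by omega⟩), by simp⟩⟩
  exact le_ciInf fun p => h _ _ p.2

theorem lt_orderGap {r : ℕ} (hr : 2 ≤ r) {z : Fin r → ℂ} {d : ℝ}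
    (h : ∀ α β, α < β → d < (z α - z β).re) : d < orderGap z := by
  have : Nonempty {p : Fin r × Fin r // p.1 < p.2} :=
    ⟨⟨(⟨0, by omega⟩, ⟨1, by omega⟩), by simp⟩⟩
  obtain ⟨p, hp⟩ := exists_eq_ciInf_of_finite
    (f := fun p : {p : Fin r × Fin r // p.1 < p.2} => (z p.1.1 - z p.1.2).re)
  rw [orderGap, ← hp]
  exact h _ _ p.2

theorem orderGap_le_norm {r : ℕ} (z : Fin r → ℂ) {α β : Fin r} (h : α ≠ β) :
    orderGap z ≤ ‖z α - z β‖ := by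
  rcases lt_or_gt_of_ne h with h | h
  · exact (orderGap_le z h).trans (Complex.re_le_norm _)
  · rw [norm_sub_rev]
    exact (orderGap_le z h).trans (Complex.re_le_norm _)

theorem orderGap_sub_le {r : ℕ} (hr : 2 ≤ r) (z z' : Fin r → ℂ) :
    orderGap z - 2 * ‖z - z'‖ ≤ orderGap z' := by
  refine le_orderGap hr fun α β h => ?_
  have h1 := orderGap_le z h
  have h2 : |((z - z') α).re| ≤ ‖z - z'‖ := (Complex.abs_re_le_norm _).trans (norm_le_pi_norm _ α)
  have h3 : |((z - z') β).re| ≤ ‖z - z'‖ := (Complex.abs_re_le_norm _).trans (norm_le_pi_norm _ β)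
  have h4 := (abs_le.1 h2).2
  have h5 := (abs_le.1 h3).1
  simp only [Pi.sub_apply, Complex.sub_re] at *
  linarith

theorem continuous_orderGap {r : ℕ} (hr : 2 ≤ r) : Continuous (orderGap (r := r)) := by
  have : LipschitzWith 2 (orderGap (r := r)) := LipschitzWith.of_dist_le_mul fun z z' => by
    have h1 := orderGap_sub_le hr z z'
    have h2 := orderGap_sub_le hr z' z
    rw [norm_sub_rev z' z] at h2
    rw [Real.dist_eq, dist_eq_norm, abs_le]
    push_cast
    constructor <;> linarith
  exact this.continuous

/-! ### The roots of `P(x) = s` -/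

/-- A product of factors in the unit disc is 1-Lipschitz in each factor. -/
theorem norm_prod_sub_prod_le_sum {ι : Type*} (t : Finset ι) (x y : ι → ℂ)
    (hx : ∀ i ∈ t, ‖x i‖ ≤ 1) (hy : ∀ i ∈ t, ‖y i‖ ≤ 1) :
    ‖∏ i ∈ t, x i - ∏ i ∈ t, y i‖ ≤ ∑ i ∈ t, ‖x i - y i‖ := by
  classical
  induction t using Finset.induction_on with
  | empty => simp
  | insert i t hi ih =>
    rw [Finset.prod_insert hi, Finset.prod_insert hi, Finset.sum_insert hi]
    have h1 : x i * ∏ j ∈ t, x j - y i * ∏ j ∈ t, y j =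
        (x i - y i) * ∏ j ∈ t, x j + y i * (∏ j ∈ t, x j - ∏ j ∈ t, y j) := by ring
    have h2 : ‖∏ j ∈ t, x j‖ ≤ 1 := by
      rw [norm_prod]
      exact Finset.prod_le_one (fun _ _ => norm_nonneg _)
        fun j hj => hx j (Finset.mem_insert_of_mem hj)
    have h3 := ih (fun j hj => hx j (Finset.mem_insert_of_mem hj))
      fun j hj => hy j (Finset.mem_insert_of_mem hj)
    have h4 := hy i (Finset.mem_insert_self i t)
    rw [h1]
    refine (norm_add_le _ _).trans (add_le_add ?_ ?_)
    · rw [norm_mul]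
      exact mul_le_of_le_one_right (norm_nonneg _) h2
    · rw [norm_mul]
      calc ‖y i‖ * ‖∏ j ∈ t, x j - ∏ j ∈ t, y j‖
          ≤ 1 * ‖∏ j ∈ t, x j - ∏ j ∈ t, y j‖ := by gcongr
        _ ≤ _ := by rw [one_mul]; exact h3

theorem card_erase_univ {r : ℕ} (α : Fin r) : (Finset.univ.erase α).card = r - 1 := by
  simp

theorem pow_scale {g : ℝ} (hg : 0 < g) {r : ℕ} (hr : 2 ≤ r) :
    2 * (g / 8) ^ r / (g / 2) ^ (r - 1) = g / 4 / 4 ^ (r - 1) := by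
  obtain ⟨n, rfl⟩ : ∃ n, r = n + 1 := ⟨r - 1, by omega⟩
  have h : (g / 8) ^ n = (g / 2) ^ n / 4 ^ n := by
    rw [← div_pow]
    congr 1
    ring
  rw [Nat.add_sub_cancel, pow_succ, h]
  field_simp
  norm_num

/-- The map whose fixed point is the displacement `x - z_α` of the root is small. -/
theorem norm_div_cofactor_le {r : ℕ} (hr : 2 ≤ r) {g : ℝ} (hg : 0 < g) {s : ℂ}
    (hs : ‖s‖ ≤ 2 * (g / 8) ^ r) {α : Fin r} {d : Fin r → ℂ} (hd : ∀ β ≠ α, g / 2 ≤ ‖d β‖) :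
    ‖s / ∏ β ∈ Finset.univ.erase α, d β‖ ≤ g / 16 := by
  have h1 : (g / 2) ^ (r - 1) ≤ ‖∏ β ∈ Finset.univ.erase α, d β‖ := by
    rw [norm_prod, ← card_erase_univ α, ← Finset.prod_const]
    exact Finset.prod_le_prod (fun _ _ => by positivity)
      fun β hβ => hd β (Finset.ne_of_mem_erase hβ)
  rw [norm_div]
  calc ‖s‖ / ‖∏ β ∈ Finset.univ.erase α, d β‖ ≤ 2 * (g / 8) ^ r / (g / 2) ^ (r - 1) := by gcongr
    _ = g / 4 / 4 ^ (r - 1) := pow_scale hg hr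
    _ ≤ g / 4 / 4 := by
        have : (4 : ℝ) ^ 1 ≤ 4 ^ (r - 1) := pow_le_pow_right₀ (by norm_num) (by omega)
        gcongr
        simpa using this
    _ = g / 16 := by ring

/-- The map whose fixed point is the displacement `x - z_α` of the root is a contraction. -/
theorem norm_div_cofactor_sub_le {r : ℕ} (hr : 2 ≤ r) {g : ℝ} (hg : 0 < g) {s : ℂ}
    (hs : ‖s‖ ≤ 2 * (g / 8) ^ r) {α : Fin r} {d d' : Fin r → ℂ} (hd : ∀ β ≠ α, g / 2 ≤ ‖d β‖)
    (hd' : ∀ β ≠ α, g / 2 ≤ ‖d' β‖) {δ : ℝ} (hδ : ∀ β ≠ α, ‖d β - d' β‖ ≤ δ) (hδ0 : 0 ≤ δ) :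
    ‖s / ∏ β ∈ Finset.univ.erase α, d β - s / ∏ β ∈ Finset.univ.erase α, d' β‖ ≤ δ / 8 := by
  have hg2 : ((g / 2 : ℝ) : ℂ) ≠ 0 := by exact_mod_cast (by positivity : g / 2 ≠ 0)
  have hnorm : ‖((g / 2 : ℝ) : ℂ)‖ = g / 2 := by
    rw [Complex.norm_real, Real.norm_of_nonneg (by positivity)]
  -- the factors are rescaled so that the cofactors become products of numbers in the unit disc
  have h1 : ∀ e : Fin r → ℂ, s / ∏ β ∈ Finset.univ.erase α, e β =
      s / ((g / 2 : ℝ) : ℂ) ^ (r - 1) * ∏ β ∈ Finset.univ.erase α, ((g / 2 : ℝ) : ℂ) / e β := by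
    intro e
    rw [Finset.prod_div_distrib, Finset.prod_const, card_erase_univ]
    field_simp
  have hle : ∀ e : Fin r → ℂ, (∀ β ≠ α, g / 2 ≤ ‖e β‖) →
      ∀ β ∈ Finset.univ.erase α, ‖((g / 2 : ℝ) : ℂ) / e β‖ ≤ 1 := by
    intro e he β hβ
    have := he β (Finset.ne_of_mem_erase hβ)
    rw [norm_div, hnorm]
    exact div_le_one_of_le₀ this (norm_nonneg _)
  have h2 : ∀ β ∈ Finset.univ.erase α,
      ‖((g / 2 : ℝ) : ℂ) / d β - ((g / 2 : ℝ) : ℂ) / d' β‖ ≤ δ * (2 / g) := by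
    intro β hβ
    have a1 := hd β (Finset.ne_of_mem_erase hβ)
    have a2 := hd' β (Finset.ne_of_mem_erase hβ)
    have a3 := hδ β (Finset.ne_of_mem_erase hβ)
    have b1 : d β ≠ 0 := norm_pos_iff.1 (by linarith)
    have b2 : d' β ≠ 0 := norm_pos_iff.1 (by linarith)
    rw [div_sub_div _ _ b1 b2, norm_div, norm_mul (d β)]
    have : ((g / 2 : ℝ) : ℂ) * d' β - d β * ((g / 2 : ℝ) : ℂ) =
        -(((g / 2 : ℝ) : ℂ) * (d β - d' β)) := by ring
    rw [this, norm_neg, norm_mul, hnorm]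
    calc g / 2 * ‖d β - d' β‖ / (‖d β‖ * ‖d' β‖) ≤ g / 2 * δ / (g / 2 * (g / 2)) := by gcongr
      _ = δ * (2 / g) := by field_simp
  have h3 : ‖s / ((g / 2 : ℝ) : ℂ) ^ (r - 1)‖ ≤ g / 4 / 4 ^ (r - 1) := by
    rw [norm_div, norm_pow, hnorm, ← pow_scale hg hr]
    gcongr
  have h4 : ((r - 1 : ℕ) : ℝ) ≤ 4 ^ (r - 1) / 4 := by
    obtain ⟨n, rfl⟩ : ∃ n, r = n + 2 := ⟨r - 2, by omega⟩
    have : n + 1 ≤ 4 ^ n := Nat.lt_pow_self (by norm_num)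
    have h : ((n + 1 : ℕ) : ℝ) ≤ 4 ^ n := by exact_mod_cast this
    rw [show n + 2 - 1 = n + 1 by omega, pow_succ]
    linarith
  rw [h1 d, h1 d', ← mul_sub, norm_mul]
  calc _ ≤ g / 4 / 4 ^ (r - 1) * ∑ β ∈ Finset.univ.erase α,
        ‖((g / 2 : ℝ) : ℂ) / d β - ((g / 2 : ℝ) : ℂ) / d' β‖ := by
        gcongr
        exact norm_prod_sub_prod_le_sum _ _ _ (hle d hd) (hle d' hd')
    _ ≤ g / 4 / 4 ^ (r - 1) * ∑ β ∈ Finset.univ.erase α, δ * (2 / g) := by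
        gcongr with β hβ
        exact h2 β hβ
    _ = g / 4 / 4 ^ (r - 1) * ((r - 1 : ℕ) * (δ * (2 / g))) := by
        rw [Finset.sum_const, card_erase_univ, nsmul_eq_mul]
    _ ≤ g / 4 / 4 ^ (r - 1) * ((4 ^ (r - 1) / 4) * (δ * (2 / g))) := by gcongr
    _ = δ / 8 := by field_simp; ring

/-- The map `η ↦ s / ∏_{β ≠ α} (η + z_α - z_β)`: its fixed points are the displacements
`η = x - z_α` of the solutions `x` of `P(x) = s`. -/
def shiftMap {r : ℕ} (z : Fin r → ℂ) (s : ℂ) (α : Fin r) (η : ℂ) : ℂ :=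
  s / ∏ β ∈ Finset.univ.erase α, (η + z α - z β)

/-- The pairs `(z, s)` for which the solutions of `P(x) = s` are separated. -/
def rootDomain (r : ℕ) : Set ((Fin r → ℂ) × ℂ) :=
  {p | 0 < orderGap p.1 ∧ ‖p.2‖ < 2 * (orderGap p.1 / 8) ^ r}

theorem isOpen_rootDomain {r : ℕ} (hr : 2 ≤ r) : IsOpen (rootDomain r) := by
  have h1 : Continuous fun p : (Fin r → ℂ) × ℂ => orderGap p.1 :=
    (continuous_orderGap hr).comp continuous_fst
  exact (isOpen_lt continuous_const h1).inter
    (isOpen_lt continuous_snd.norm (((h1.div_const 8).pow r).const_mul 2))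

theorem half_gap_le_norm {r : ℕ} {z : Fin r → ℂ} {g : ℝ} (hg : 0 < g) (hz : g ≤ orderGap z)
    {α β : Fin r} (h : β ≠ α) {η : ℂ} (hη : ‖η‖ ≤ orderGap z / 4) : g / 2 ≤ ‖η + z α - z β‖ := by
  have h1 := orderGap_le_norm z h.symm
  have h2 : ‖z α - z β‖ ≤ ‖η + z α - z β‖ + ‖η‖ := by
    have : z α - z β = (η + z α - z β) - η := by ring
    calc ‖z α - z β‖ = ‖(η + z α - z β) - η‖ := by rw [← this]
      _ ≤ _ := norm_sub_le _ _
  linarith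

theorem lipschitzOnWith_shiftMap {r : ℕ} (hr : 2 ≤ r) {z : Fin r → ℂ} {s : ℂ}
    (h : (z, s) ∈ rootDomain r) (α : Fin r) :
    LipschitzOnWith (1 / 8) (shiftMap z s α) (Metric.closedBall 0 (orderGap z / 4)) := by
  refine LipschitzOnWith.of_dist_le_mul fun v hv w hw => ?_
  rw [dist_eq_norm, dist_eq_norm]
  have hv' : ‖v‖ ≤ orderGap z / 4 := by simpa using hv
  have hw' : ‖w‖ ≤ orderGap z / 4 := by simpa using hw
  refine (norm_div_cofactor_sub_le hr h.1 h.2.le (δ := ‖v - w‖)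
    (fun β hβ => half_gap_le_norm h.1 le_rfl hβ hv')
    (fun β hβ => half_gap_le_norm h.1 le_rfl hβ hw') (fun β _ => le_of_eq ?_)
    (norm_nonneg _)).trans (le_of_eq ?_)
  · congr 1
    ring
  · push_cast
    ring

theorem exists_shift {r : ℕ} (hr : 2 ≤ r) {z : Fin r → ℂ} {s : ℂ} (h : (z, s) ∈ rootDomain r)
    (α : Fin r) : ∃ η ∈ Metric.closedBall (0 : ℂ) (orderGap z / 4), shiftMap z s α η = η := by
  have hg := h.1
  refine exists_fixedPoint_of_contraction (by linarith) (K := 1 / 8)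
    (by rw [← NNReal.coe_lt_coe]; norm_num) (fun v hv => ?_) (lipschitzOnWith_shiftMap hr h α)
  have hv' : ‖v‖ ≤ orderGap z / 4 := by simpa using hv
  have := norm_div_cofactor_le hr hg h.2.le (α := α) (d := fun β => v + z α - z β)
    (fun β hβ => half_gap_le_norm hg le_rfl hβ hv')
  rw [mem_closedBall_zero_iff, shiftMap]
  simp only at *
  linarith

open Classical in
/-- The displacement `x - z_α` of the solution `x` of `P(x) = s` near `z_α`. -/
def rootShift {r : ℕ} (z : Fin r → ℂ) (s : ℂ) (α : Fin r) : ℂ :=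
  if h : ∃ η ∈ Metric.closedBall (0 : ℂ) (orderGap z / 4), shiftMap z s α η = η then h.choose else 0

theorem shiftMap_rootShift {r : ℕ} (hr : 2 ≤ r) {z : Fin r → ℂ} {s : ℂ}
    (h : (z, s) ∈ rootDomain r) (α : Fin r) :
    shiftMap z s α (rootShift z s α) = rootShift z s α := by
  have he := exists_shift hr h α
  rw [rootShift, dif_pos he]
  exact he.choose_spec.2

theorem norm_rootShift_le {r : ℕ} (hr : 2 ≤ r) {z : Fin r → ℂ} {s : ℂ}
    (h : (z, s) ∈ rootDomain r) (α : Fin r) : ‖rootShift z s α‖ ≤ orderGap z / 16 := by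
  have he := exists_shift hr h α
  have h1 : ‖rootShift z s α‖ ≤ orderGap z / 4 := by
    rw [rootShift, dif_pos he]
    simpa using he.choose_spec.1
  rw [← shiftMap_rootShift hr h α]
  exact norm_div_cofactor_le hr h.1 h.2.le (fun β hβ => half_gap_le_norm h.1 le_rfl hβ h1)

theorem eq_rootShift {r : ℕ} (hr : 2 ≤ r) {z : Fin r → ℂ} {s : ℂ}
    (h : (z, s) ∈ rootDomain r) {α : Fin r} {η : ℂ} (hη : ‖η‖ ≤ orderGap z / 4)
    (hfix : shiftMap z s α η = η) : η = rootShift z s α := by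
  have hg := h.1
  have h2 := norm_rootShift_le hr h α
  simp only at hg
  exact eq_of_fixedPoint_of_contraction (K := 1 / 8) (by rw [← NNReal.coe_lt_coe]; norm_num)
    (lipschitzOnWith_shiftMap hr h α) (by simpa using hη)
    (by rw [mem_closedBall_zero_iff]; linarith) hfix (shiftMap_rootShift hr h α)

theorem contDiffAt_rootShift {r : ℕ} (hr : 2 ≤ r) {q : (Fin r → ℂ) × ℂ} (h : q ∈ rootDomain r)
    (α : Fin r) : ContDiffAt ℂ 1 (fun q : (Fin r → ℂ) × ℂ => rootShift q.1 q.2 α) q := by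
  obtain ⟨z, s⟩ := q
  have hg : 0 < orderGap z := h.1
  have hle := norm_rootShift_le hr h α
  have hlt : ‖rootShift z s α‖ < orderGap z / 4 := by linarith
  refine contDiffAt_fixedPoint (Φ := fun q : ((Fin r → ℂ) × ℂ) × ℂ => shiftMap q.1.1 q.1.2 α q.2)
    (w := fun q : (Fin r → ℂ) × ℂ => rootShift q.1 q.2 α)
    (K := 1 / 8) ?_ (by rw [← NNReal.coe_lt_coe]; norm_num)
    (V := Metric.closedBall 0 (orderGap z / 4)) ?_ (lipschitzOnWith_shiftMap hr h α)
    (shiftMap_rootShift hr h α) ?_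
  · simp only [shiftMap]
    refine ContDiffAt.div (by fun_prop) ?_ ?_
    · refine contDiffAt_prod fun β _ => ?_
      fun_prop
    · refine Finset.prod_ne_zero_iff.2 fun β hβ => ?_
      have := half_gap_le_norm hg le_rfl (Finset.ne_of_mem_erase hβ) hlt.le
      exact norm_pos_iff.1 (by linarith)
  · exact Metric.closedBall_mem_nhds_of_mem (by simpa using hlt)
  · have hc : Continuous fun q : ((Fin r → ℂ) × ℂ) × ℂ => orderGap q.1.1 / 4 :=
      ((continuous_orderGap hr).comp (by fun_prop)).div_const 4
    have h1 : ∀ᶠ q : ((Fin r → ℂ) × ℂ) × ℂ in 𝓝 ((z, s), rootShift z s α),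
        ‖q.2‖ < orderGap q.1.1 / 4 :=
      (continuous_norm.comp continuous_snd).continuousAt.eventually_lt hc.continuousAt hlt
    have h2 : ∀ᶠ q : ((Fin r → ℂ) × ℂ) × ℂ in 𝓝 ((z, s), rootShift z s α),
        q.1 ∈ rootDomain r :=
      continuous_fst.continuousAt.eventually ((isOpen_rootDomain hr).mem_nhds h)
    filter_upwards [h1, h2] with q h1 h2 hfix
    exact eq_rootShift hr h2 h1.le hfix

/-- The displacement of the root is a Lipschitz function of the configuration. The fixed point
equation bounds the change `δ` of the displacement by `(δ + 2 ‖z - z'‖) / 8`. -/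
theorem norm_rootShift_sub_le {r : ℕ} (hr : 2 ≤ r) {z z' : Fin r → ℂ} {s : ℂ} {g : ℝ}
    (hg : 0 < g) (hz : g ≤ orderGap z) (hz' : g ≤ orderGap z') (hs : ‖s‖ < 2 * (g / 8) ^ r)
    (α : Fin r) : ‖rootShift z s α - rootShift z' s α‖ ≤ 2 / 7 * ‖z - z'‖ := by
  have hmem : ∀ {y : Fin r → ℂ}, g ≤ orderGap y → (y, s) ∈ rootDomain r := fun hy =>
    ⟨hg.trans_le hy, hs.trans_le (by gcongr)⟩
  have hn : ∀ {y : Fin r → ℂ}, g ≤ orderGap y → ‖rootShift y s α‖ ≤ orderGap y / 4 := fun {y} hy => by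
    have := norm_rootShift_le hr (hmem hy) α
    linarith
  have key := norm_div_cofactor_sub_le hr hg hs.le (α := α)
    (d := fun β => rootShift z s α + z α - z β) (d' := fun β => rootShift z' s α + z' α - z' β)
    (δ := ‖rootShift z s α - rootShift z' s α‖ + 2 * ‖z - z'‖)
    (fun β hβ => half_gap_le_norm hg hz hβ (hn hz))
    (fun β hβ => half_gap_le_norm hg hz' hβ (hn hz')) (fun β _ => ?_) (by positivity)
  · have e1 := shiftMap_rootShift hr (hmem hz) α
    have e2 := shiftMap_rootShift hr (hmem hz') α
    simp only [shiftMap] at e1 e2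
    rw [e1, e2] at key
    linarith
  · have h1 : ‖(z - z') α‖ ≤ ‖z - z'‖ := norm_le_pi_norm _ α
    have h2 : ‖(z - z') β‖ ≤ ‖z - z'‖ := norm_le_pi_norm _ β
    have h3 : rootShift z s α + z α - z β - (rootShift z' s α + z' α - z' β) =
        (rootShift z s α - rootShift z' s α) + (z - z') α - (z - z') β := by
      simp only [Pi.sub_apply]
      ring
    rw [h3]
    have h4 := norm_sub_le ((rootShift z s α - rootShift z' s α) + (z - z') α) ((z - z') β)
    have h5 := norm_add_le (rootShift z s α - rootShift z' s α) ((z - z') α)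
    linarith

/-- The solution of `P(x) = s` near `z_α`. -/
def root {r : ℕ} (z : Fin r → ℂ) (s : ℂ) (α : Fin r) : ℂ := z α + rootShift z s α

theorem contDiffAt_root {r : ℕ} (hr : 2 ≤ r) {q : (Fin r → ℂ) × ℂ} (h : q ∈ rootDomain r)
    (α : Fin r) : ContDiffAt ℂ 1 (fun q : (Fin r → ℂ) × ℂ => root q.1 q.2 α) q := by
  simp only [root]
  exact ContDiffAt.add (by fun_prop) (contDiffAt_rootShift hr h α)

theorem eval_curvePoly {R : Type} [CommRing R] {r : ℕ} (z : Fin r → R) (x : R) :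
    (curvePoly z).eval x = ∏ α, (x - z α) := by
  simp [curvePoly, Polynomial.eval_prod]

theorem monic_curvePoly {R : Type} [CommRing R] {r : ℕ} (z : Fin r → R) : (curvePoly z).Monic :=
  Polynomial.monic_prod_of_monic _ _ fun α _ => Polynomial.monic_X_sub_C (z α)

theorem natDegree_curvePoly {R : Type} [CommRing R] [Nontrivial R] {r : ℕ} (z : Fin r → R) :
    (curvePoly z).natDegree = r := by
  rw [curvePoly, Polynomial.natDegree_prod_of_monic _ _ fun α _ => Polynomial.monic_X_sub_C (z α)]
  simp

theorem eval_root {r : ℕ} (hr : 2 ≤ r) {z : Fin r → ℂ} {s : ℂ} (h : (z, s) ∈ rootDomain r)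
    (α : Fin r) : (curvePoly z).eval (root z s α) = s := by
  have hg : 0 < orderGap z := h.1
  have h1 := norm_rootShift_le hr h α
  have h2 := shiftMap_rootShift hr h α
  have h3 : ∏ β ∈ Finset.univ.erase α, (rootShift z s α + z α - z β) ≠ 0 := by
    refine Finset.prod_ne_zero_iff.2 fun β hβ => ?_
    have := half_gap_le_norm hg le_rfl (Finset.ne_of_mem_erase hβ)
      (by linarith : ‖rootShift z s α‖ ≤ orderGap z / 4)
    exact norm_pos_iff.1 (by linarith)
  rw [shiftMap, div_eq_iff h3] at h2
  rw [eval_curvePoly, ← Finset.mul_prod_erase _ _ (Finset.mem_univ α)]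
  refine Eq.trans ?_ h2.symm
  simp only [root]
  congr 1
  · ring
  · exact Finset.prod_congr rfl fun β _ => by ring

/-- The roots for two values of `s` are ordered by their real parts. -/
theorem orderGap_half_le_root_sub {r : ℕ} (hr : 2 ≤ r) {z : Fin r → ℂ} {s s' : ℂ}
    (h : (z, s) ∈ rootDomain r) (h' : (z, s') ∈ rootDomain r) {α β : Fin r} (hαβ : α < β) :
    orderGap z / 2 ≤ (root z s α - root z s' β).re := by
  have h1 := (Complex.abs_re_le_norm _).trans (norm_rootShift_le hr h α)
  have h2 := (Complex.abs_re_le_norm _).trans (norm_rootShift_le hr h' β)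
  have h3 := orderGap_le z hαβ
  have h4 := (abs_le.1 h1).1
  have h5 := (abs_le.1 h2).2
  have hg : 0 < orderGap z := h.1
  simp only [root, Complex.sub_re, Complex.add_re] at *
  linarith

theorem root_injective {r : ℕ} (hr : 2 ≤ r) {z : Fin r → ℂ} {s : ℂ} (h : (z, s) ∈ rootDomain r) :
    Function.Injective (root z s) := by
  intro α β hαβ
  by_contra hne
  have hg : 0 < orderGap z := h.1
  rcases lt_or_gt_of_ne hne with hlt | hlt
  · have := orderGap_half_le_root_sub hr h h hlt
    rw [hαβ, sub_self, Complex.zero_re] at this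
    linarith
  · have := orderGap_half_le_root_sub hr h h hlt
    rw [hαβ, sub_self, Complex.zero_re] at this
    linarith

/-- The solutions `root z s` are all the roots of `P - s`, so `P - s` is the polynomial of the
configuration `root z s`. -/
theorem curvePoly_sub_C {r : ℕ} (hr : 2 ≤ r) {z : Fin r → ℂ} {s : ℂ} (h : (z, s) ∈ rootDomain r) :
    curvePoly z - Polynomial.C s = curvePoly (root z s) := by
  have hdeg : (Polynomial.C s).degree < (curvePoly z).degree := by
    refine Polynomial.degree_C_le.trans_lt ?_
    rw [Polynomial.degree_eq_natDegree (monic_curvePoly z).ne_zero, natDegree_curvePoly]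
    exact_mod_cast (by omega : 0 < r)
  have hmon : (curvePoly z - Polynomial.C s).Monic := (monic_curvePoly z).sub_of_left hdeg
  have hnd : (curvePoly z - Polynomial.C s).natDegree = r := by
    rw [Polynomial.natDegree_sub_C, natDegree_curvePoly]
  have hdvd : curvePoly (root z s) ∣ curvePoly z - Polynomial.C s := by
    refine Finset.prod_dvd_of_coprime ?_ fun α _ => ?_
    · intro α _ β _ hαβ
      exact Polynomial.pairwise_coprime_X_sub_C (root_injective hr h) hαβ
    · rw [Polynomial.dvd_iff_isRoot, Polynomial.IsRoot, Polynomial.eval_sub, Polynomial.eval_C,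
        eval_root hr h, sub_self]
  refine (Polynomial.eq_of_monic_of_dvd_of_natDegree_le (monic_curvePoly _) hmon hdvd ?_)
  rw [hnd, natDegree_curvePoly]

theorem prod_sub_root {r : ℕ} (hr : 2 ≤ r) {z : Fin r → ℂ} {s : ℂ} (h : (z, s) ∈ rootDomain r)
    (x : ℂ) : ∏ γ, (x - root z s γ) = (curvePoly z).eval x - s := by
  rw [← eval_curvePoly, ← curvePoly_sub_C hr h, Polynomial.eval_sub, Polynomial.eval_C]

/-- Since `r ≥ 2`, the coefficient of `x ^ (r - 1)` does not depend on `s`, so the centre of mass is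
that of `z`. -/
theorem sum_root {r : ℕ} (hr : 2 ≤ r) {z : Fin r → ℂ} {s : ℂ} (h : (z, s) ∈ rootDomain r) :
    ∑ γ, root z s γ = ∑ γ, z γ := by
  have h1 : ∀ y : Fin r → ℂ, (curvePoly y).coeff (r - 1) = -∑ γ, y γ := by
    intro y
    have := Polynomial.prod_X_sub_C_coeff_card_pred Finset.univ y (by simp; omega)
    simpa [curvePoly] using this
  have h2 := congrArg (fun p : Polynomial ℂ => p.coeff (r - 1)) (curvePoly_sub_C hr h)
  simp only [Polynomial.coeff_sub, Polynomial.coeff_C, h1] at h2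
  rw [if_neg (by omega)] at h2
  linear_combination h2

/-! ### The normalized periods as coordinates -/

theorem mem_rootDomain {r : ℕ} {z : Fin r → ℂ} {g : ℝ} (hg : 0 < g) (hz : g ≤ orderGap z)
    {τ : ℂ} (hτ : ‖τ‖ < (g / 8) ^ r) {u : ℝ} (hu : u ∈ Icc (-1 : ℝ) 1) :
    (z, 2 * τ * (u : ℂ)) ∈ rootDomain r := by
  refine ⟨hg.trans_le hz, ?_⟩
  have h1 : |u| ≤ 1 := abs_le.2 hu
  have h2 : (g / 8) ^ r ≤ (orderGap z / 8) ^ r := by gcongr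
  simp only [norm_mul, Complex.norm_real, Real.norm_eq_abs, Complex.norm_ofNat]
  nlinarith [norm_nonneg τ, abs_nonneg u]

/-- The pairs `(z, τ)`, `τ = Λ^r`, for which the cuts around the `z_α` are separated. -/
def cutDomain (r : ℕ) : Set ((Fin r → ℂ) × ℂ) :=
  {p | 0 < orderGap p.1 ∧ ‖p.2‖ < (orderGap p.1 / 8) ^ r}

theorem isOpen_cutDomain {r : ℕ} (hr : 2 ≤ r) : IsOpen (cutDomain r) := by
  have h1 : Continuous fun p : (Fin r → ℂ) × ℂ => orderGap p.1 :=
    (continuous_orderGap hr).comp continuous_fst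
  exact (isOpen_lt continuous_const h1).inter
    (isOpen_lt continuous_snd.norm ((h1.div_const 8).pow r))

theorem mem_rootDomain_of_cutDomain {r : ℕ} {p : (Fin r → ℂ) × ℂ} (hp : p ∈ cutDomain r) {u : ℝ}
    (hu : u ∈ Icc (-1 : ℝ) 1) : (p.1, 2 * p.2 * (u : ℂ)) ∈ rootDomain r :=
  mem_rootDomain hp.1 le_rfl hp.2 hu

/-- The average of the displacement of the root over the cut, with `s = 2τ cos θ` for uniform
`θ`.  The point `z_α` plus this average is `i a_α`. -/
def meanShift {r : ℕ} (z : Fin r → ℂ) (τ : ℂ) : Fin r → ℂ := fun α =>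
  ∫ u : ℝ, rootShift z (2 * τ * (u : ℂ)) α ∂arcsine

theorem contDiffAt_meanShift {r : ℕ} (hr : 2 ≤ r) {p : (Fin r → ℂ) × ℂ} (hp : p ∈ cutDomain r) :
    ContDiffAt ℂ 1 (fun p : (Fin r → ℂ) × ℂ => meanShift p.1 p.2) p := by
  rw [contDiffAt_pi]
  intro α
  refine (contDiffAt_integral_arcsine
    (ξ := fun q : ((Fin r → ℂ) × ℂ) × ℂ => rootShift q.1.1 (2 * q.1.2 * q.2) α)
    (isOpen_cutDomain hr) ?_ hp).1
  intro p hp u hu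
  exact ContDiffAt.comp (g := fun q : (Fin r → ℂ) × ℂ => rootShift q.1 q.2 α)
    (f := fun q : ((Fin r → ℂ) × ℂ) × ℂ => (q.1.1, 2 * q.1.2 * q.2)) (p, (u : ℂ))
    (contDiffAt_rootShift hr (mem_rootDomain_of_cutDomain hp hu) α) (by fun_prop)

theorem integrable_rootShift {r : ℕ} (hr : 2 ≤ r) {p : (Fin r → ℂ) × ℂ} (hp : p ∈ cutDomain r)
    (α : Fin r) : Integrable (fun u : ℝ => rootShift p.1 (2 * p.2 * (u : ℂ)) α) arcsine := by
  have h : ContinuousOn (fun u : ℝ => rootShift p.1 (2 * p.2 * (u : ℂ)) α) (Icc (-1) 1) := by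
    intro u hu
    have h1 := (contDiffAt_rootShift hr (mem_rootDomain_of_cutDomain hp hu) α).continuousAt
    exact (ContinuousAt.comp (g := fun q : (Fin r → ℂ) × ℂ => rootShift q.1 q.2 α)
      (f := fun u : ℝ => (p.1, 2 * p.2 * (u : ℂ))) h1 (by fun_prop)).continuousWithinAt
  have := integrable_smul_of_continuousOn isCompact_Icc measurableSet_Icc ae_arcsine_mem
    (integrable_const (1 : ℝ)) h
  simpa using this

theorem norm_integral_arcsine_le {E : Type*} [NormedAddCommGroup E] [NormedSpace ℝ E] {f : ℝ → E}
    {C : ℝ} (h : ∀ u ∈ Icc (-1 : ℝ) 1, ‖f u‖ ≤ C) : ‖∫ u, f u ∂arcsine‖ ≤ C := by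
  have := norm_integral_le_of_norm_le_const (μ := arcsine) (f := f) (C := C)
    (by filter_upwards [ae_arcsine_mem] with u hu using h u hu)
  simpa using this

theorem norm_meanShift_le {r : ℕ} (hr : 2 ≤ r) {p : (Fin r → ℂ) × ℂ} (hp : p ∈ cutDomain r) :
    ‖meanShift p.1 p.2‖ ≤ orderGap p.1 / 16 := by
  have := hp.1
  rw [pi_norm_le_iff_of_nonneg (by positivity)]
  intro α
  exact norm_integral_arcsine_le fun u hu =>
    norm_rootShift_le hr (mem_rootDomain_of_cutDomain hp hu) α

theorem norm_meanShift_sub_le {r : ℕ} (hr : 2 ≤ r) {z z' : Fin r → ℂ} {τ : ℂ} {g : ℝ}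
    (hg : 0 < g) (hz : g ≤ orderGap z) (hz' : g ≤ orderGap z') (hτ : ‖τ‖ < (g / 8) ^ r) :
    ‖meanShift z τ - meanShift z' τ‖ ≤ 2 / 7 * ‖z - z'‖ := by
  have hmem : ∀ {y : Fin r → ℂ}, g ≤ orderGap y → (y, τ) ∈ cutDomain r := fun hy =>
    ⟨hg.trans_le hy, hτ.trans_le (by gcongr)⟩
  rw [pi_norm_le_iff_of_nonneg (by positivity)]
  intro α
  have h1 := integral_sub (integrable_rootShift hr (hmem hz) α) (integrable_rootShift hr (hmem hz') α)
  simp only at h1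
  rw [Pi.sub_apply, meanShift, meanShift, ← h1]
  refine norm_integral_arcsine_le fun u hu => norm_rootShift_sub_le hr hg hz hz' ?_ α
  have h1 : |u| ≤ 1 := abs_le.2 hu
  simp only [norm_mul, Complex.norm_real, Real.norm_eq_abs, Complex.norm_ofNat]
  nlinarith [norm_nonneg τ, abs_nonneg u]

/-- The pairs `(b, τ)`, `b = i a`, `τ = Λ^r`, on which the prepotential is constructed. -/
def periodDomain (r : ℕ) : Set ((Fin r → ℂ) × ℂ) :=
  {p | 0 < orderGap p.1 ∧ ‖p.2‖ < (orderGap p.1 / 16) ^ r}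

theorem isOpen_periodDomain {r : ℕ} (hr : 2 ≤ r) : IsOpen (periodDomain r) := by
  have h1 : Continuous fun p : (Fin r → ℂ) × ℂ => orderGap p.1 :=
    (continuous_orderGap hr).comp continuous_fst
  exact (isOpen_lt continuous_const h1).inter
    (isOpen_lt continuous_snd.norm ((h1.div_const 16).pow r))

theorem orderGap_of_mem_closedBall {r : ℕ} (hr : 2 ≤ r) {b z : Fin r → ℂ}
    (hz : z ∈ Metric.closedBall b (orderGap b / 8)) :
    3 / 4 * orderGap b ≤ orderGap z ∧ orderGap z ≤ 5 / 4 * orderGap b := by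
  rw [mem_closedBall_iff_norm] at hz
  have h1 := orderGap_sub_le hr b z
  have h2 := orderGap_sub_le hr z b
  rw [norm_sub_rev b z] at h1
  constructor <;> linarith

theorem mem_cutDomain_of_mem_closedBall {r : ℕ} (hr : 2 ≤ r) {p : (Fin r → ℂ) × ℂ}
    (hp : p ∈ periodDomain r) {z : Fin r → ℂ}
    (hz : z ∈ Metric.closedBall p.1 (orderGap p.1 / 8)) : (z, p.2) ∈ cutDomain r := by
  have h1 := (orderGap_of_mem_closedBall hr hz).1
  have h2 := hp.1
  refine ⟨by simp only; linarith, hp.2.trans_le ?_⟩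
  simp only
  gcongr ?_ ^ r
  linarith

/-- The configuration with given periods `b = i a` is the fixed point of the contraction `z ↦ b -
meanShift z τ`. -/
theorem lipschitzOnWith_meanShift {r : ℕ} (hr : 2 ≤ r) {p : (Fin r → ℂ) × ℂ}
    (hp : p ∈ periodDomain r) : LipschitzOnWith (2 / 7) (fun z => p.1 - meanShift z p.2)
      (Metric.closedBall p.1 (orderGap p.1 / 8)) := by
  refine LipschitzOnWith.of_dist_le_mul fun z hz z' hz' => ?_
  have h0 := hp.1
  have h1 := (orderGap_of_mem_closedBall hr hz).1
  have h2 := (orderGap_of_mem_closedBall hr hz').1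
  have h3 := norm_meanShift_sub_le hr (g := orderGap p.1 / 2) (by linarith) (by linarith)
    (by linarith : _ ≤ orderGap z') (τ := p.2) (z := z)
    (hp.2.trans_le (le_of_eq (by congr 1; ring)))
  rw [dist_eq_norm, dist_eq_norm, sub_sub_sub_cancel_left, norm_sub_rev]
  push_cast
  exact h3

theorem norm_sub_meanShift {r : ℕ} (hr : 2 ≤ r) {p : (Fin r → ℂ) × ℂ}
    (hp : p ∈ periodDomain r) {z : Fin r → ℂ}
    (hz : z ∈ Metric.closedBall p.1 (orderGap p.1 / 8)) :
    ‖p.1 - meanShift z p.2 - p.1‖ < orderGap p.1 / 8 := by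
  have h0 := hp.1
  have h1 := norm_meanShift_le hr (mem_cutDomain_of_mem_closedBall hr hp hz)
  have h2 := (orderGap_of_mem_closedBall hr hz).2
  rw [sub_sub_cancel_left, norm_neg]
  simp only at h1
  linarith

theorem exists_centers {r : ℕ} (hr : 2 ≤ r) {p : (Fin r → ℂ) × ℂ} (hp : p ∈ periodDomain r) :
    ∃ z ∈ Metric.closedBall p.1 (orderGap p.1 / 8), p.1 - meanShift z p.2 = z :=
  exists_fixedPoint_of_contraction (f := fun z => p.1 - meanShift z p.2) (K := 2 / 7)
    (by linarith [hp.1]) (by rw [← NNReal.coe_lt_coe]; norm_num)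
    (fun z hz => mem_closedBall_iff_norm.2 (norm_sub_meanShift hr hp hz).le)
    (lipschitzOnWith_meanShift hr hp)

open Classical in
/-- The configuration `z` with `i a_α = b_α`, as a function of `(b, τ)`. -/
def centers {r : ℕ} (p : (Fin r → ℂ) × ℂ) : Fin r → ℂ :=
  if h : ∃ z ∈ Metric.closedBall p.1 (orderGap p.1 / 8), p.1 - meanShift z p.2 = z then h.choose
  else p.1

theorem centers_spec {r : ℕ} (hr : 2 ≤ r) {p : (Fin r → ℂ) × ℂ} (hp : p ∈ periodDomain r) :
    centers p ∈ Metric.closedBall p.1 (orderGap p.1 / 8) ∧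
      p.1 - meanShift (centers p) p.2 = centers p := by
  have he := exists_centers hr hp
  rw [centers, dif_pos he]
  exact he.choose_spec

theorem eq_centers {r : ℕ} (hr : 2 ≤ r) {p : (Fin r → ℂ) × ℂ} (hp : p ∈ periodDomain r)
    {z : Fin r → ℂ} (hz : z ∈ Metric.closedBall p.1 (orderGap p.1 / 8))
    (hfix : p.1 - meanShift z p.2 = z) : z = centers p :=
  eq_of_fixedPoint_of_contraction (K := 2 / 7) (by rw [← NNReal.coe_lt_coe]; norm_num)
    (lipschitzOnWith_meanShift hr hp) hz (centers_spec hr hp).1 hfix (centers_spec hr hp).2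

theorem centers_mem_cutDomain {r : ℕ} (hr : 2 ≤ r) {p : (Fin r → ℂ) × ℂ}
    (hp : p ∈ periodDomain r) : (centers p, p.2) ∈ cutDomain r :=
  mem_cutDomain_of_mem_closedBall hr hp (centers_spec hr hp).1

theorem contDiffAt_centers {r : ℕ} (hr : 2 ≤ r) {p : (Fin r → ℂ) × ℂ} (hp : p ∈ periodDomain r) :
    ContDiffAt ℂ 1 (centers (r := r)) p := by
  obtain ⟨hc1, hc2⟩ := centers_spec hr hp
  have hlt : ‖centers p - p.1‖ < orderGap p.1 / 8 := by
    have := norm_sub_meanShift hr hp hc1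
    rwa [hc2] at this
  refine contDiffAt_fixedPoint
    (Φ := fun q : ((Fin r → ℂ) × ℂ) × (Fin r → ℂ) => q.1.1 - meanShift q.2 q.1.2)
    (K := 2 / 7) ?_ (by rw [← NNReal.coe_lt_coe]; norm_num)
    (V := Metric.closedBall p.1 (orderGap p.1 / 8)) ?_ (lipschitzOnWith_meanShift hr hp) hc2 ?_
  · refine ContDiffAt.sub (by fun_prop) ?_
    exact ContDiffAt.comp (g := fun p : (Fin r → ℂ) × ℂ => meanShift p.1 p.2)
      (f := fun q : ((Fin r → ℂ) × ℂ) × (Fin r → ℂ) => (q.2, q.1.2)) (p, centers p)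
      (contDiffAt_meanShift hr (centers_mem_cutDomain hr hp)) (by fun_prop)
  · exact Metric.closedBall_mem_nhds_of_mem (by rwa [mem_ball_iff_norm])
  · have hc : Continuous fun q : ((Fin r → ℂ) × ℂ) × (Fin r → ℂ) => orderGap q.1.1 / 8 :=
      ((continuous_orderGap hr).comp (by fun_prop)).div_const 8
    have h1 : ∀ᶠ q : ((Fin r → ℂ) × ℂ) × (Fin r → ℂ) in 𝓝 (p, centers p),
        ‖q.2 - q.1.1‖ < orderGap q.1.1 / 8 :=
      ContinuousAt.eventually_lt (by fun_prop) hc.continuousAt hlt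
    have h2 : ∀ᶠ q : ((Fin r → ℂ) × ℂ) × (Fin r → ℂ) in 𝓝 (p, centers p),
        q.1 ∈ periodDomain r :=
      continuous_fst.continuousAt.eventually ((isOpen_periodDomain hr).mem_nhds hp)
    filter_upwards [h1, h2] with q h1 h2 hfix
    exact eq_centers hr h2 (mem_closedBall_iff_norm.2 h1.le) hfix

/-- The point `x_α` of the cut near `z_α` where `P(x_α) = 2τu`, as a function of `((b, τ), u)`. -/
def cutPoint {r : ℕ} (α : Fin r) (q : ((Fin r → ℂ) × ℂ) × ℂ) : ℂ :=
  root (centers q.1) (2 * q.1.2 * q.2) α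

theorem centers_mem_rootDomain {r : ℕ} (hr : 2 ≤ r) {p : (Fin r → ℂ) × ℂ}
    (hp : p ∈ periodDomain r) {u : ℝ} (hu : u ∈ Icc (-1 : ℝ) 1) :
    (centers p, 2 * p.2 * (u : ℂ)) ∈ rootDomain r :=
  mem_rootDomain_of_cutDomain (centers_mem_cutDomain hr hp) hu

theorem contDiffAt_cutPoint {r : ℕ} (hr : 2 ≤ r) {p : (Fin r → ℂ) × ℂ} (hp : p ∈ periodDomain r)
    {u : ℝ} (hu : u ∈ Icc (-1 : ℝ) 1) (α : Fin r) :
    ContDiffAt ℂ 1 (cutPoint α) (p, (u : ℂ)) := by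
  have h1 : ContDiffAt ℂ 1 (fun q : ((Fin r → ℂ) × ℂ) × ℂ => centers q.1) (p, (u : ℂ)) :=
    ContDiffAt.comp (g := centers) (f := Prod.fst) (p, (u : ℂ)) (contDiffAt_centers hr hp)
      contDiffAt_fst
  exact ContDiffAt.comp (g := fun q : (Fin r → ℂ) × ℂ => root q.1 q.2 α)
    (f := fun q : ((Fin r → ℂ) × ℂ) × ℂ => (centers q.1, 2 * q.1.2 * q.2)) (p, (u : ℂ))
    (contDiffAt_root hr (centers_mem_rootDomain hr hp hu) α) (h1.prodMk (by fun_prop))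

theorem continuousOn_cutPoint {r : ℕ} (hr : 2 ≤ r) {p : (Fin r → ℂ) × ℂ} (hp : p ∈ periodDomain r)
    (α : Fin r) : ContinuousOn (fun u : ℝ => cutPoint α (p, (u : ℂ))) (Icc (-1) 1) := by
  intro u hu
  exact (ContinuousAt.comp (g := cutPoint α) (f := fun u : ℝ => (p, (u : ℂ)))
    (contDiffAt_cutPoint hr hp hu α).continuousAt (by fun_prop)).continuousWithinAt

theorem integrable_arcsine_of_continuousOn {G : Type*} [NormedAddCommGroup G] [NormedSpace ℝ G]
    {f : ℝ → G} (hf : ContinuousOn f (Icc (-1) 1)) : Integrable f arcsine := by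
  have := integrable_smul_of_continuousOn isCompact_Icc measurableSet_Icc ae_arcsine_mem
    (integrable_const (1 : ℝ)) hf
  simpa using this

/-- The defining property of `centers`: the average of `x` over the cut `α` is `b_α = i a_α`. -/
theorem integral_cutPoint {r : ℕ} (hr : 2 ≤ r) {p : (Fin r → ℂ) × ℂ} (hp : p ∈ periodDomain r)
    (α : Fin r) : ∫ u : ℝ, cutPoint α (p, (u : ℂ)) ∂arcsine = p.1 α := by
  have h1 := congrFun (centers_spec hr hp).2 α
  simp only [cutPoint, root]
  rw [integral_add (integrable_const _) (integrable_rootShift hr (centers_mem_cutDomain hr hp) α)]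
  simp only [Pi.sub_apply, meanShift] at h1
  simp only [integral_const, probReal_univ, one_smul]
  linear_combination -h1

theorem cutPoint_sub_re_pos {r : ℕ} (hr : 2 ≤ r) {p : (Fin r → ℂ) × ℂ} (hp : p ∈ periodDomain r)
    {u u' : ℝ} (hu : u ∈ Icc (-1 : ℝ) 1) (hu' : u' ∈ Icc (-1 : ℝ) 1) {α β : Fin r} (h : α < β) :
    0 < (cutPoint α (p, (u : ℂ)) - cutPoint β (p, (u' : ℂ))).re := by
  have h1 := orderGap_half_le_root_sub hr (centers_mem_rootDomain hr hp hu)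
    (centers_mem_rootDomain hr hp hu') h
  have h2 : 0 < orderGap (centers p) := (centers_mem_cutDomain hr hp).1
  simp only [cutPoint]
  linarith

/-- The factorization `∏_γ (x - y_γ) = P(x) - P(y)` for a point `x` and all points `y_γ` with the
same value of `P`. -/
theorem prod_sub_cutPoint {r : ℕ} (hr : 2 ≤ r) {p : (Fin r → ℂ) × ℂ} (hp : p ∈ periodDomain r)
    {u u' : ℝ} (hu : u ∈ Icc (-1 : ℝ) 1) (hu' : u' ∈ Icc (-1 : ℝ) 1) (α : Fin r) :
    ∏ γ, (cutPoint α (p, (u : ℂ)) - cutPoint γ (p, (u' : ℂ))) = 2 * p.2 * ((u : ℂ) - u') := by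
  simp only [cutPoint]
  rw [prod_sub_root hr (centers_mem_rootDomain hr hp hu'),
    eval_root hr (centers_mem_rootDomain hr hp hu)]
  ring

theorem meanShift_neg {r : ℕ} (z : Fin r → ℂ) (τ : ℂ) : meanShift z (-τ) = meanShift z τ := by
  funext α
  simp only [meanShift]
  rw [← integral_arcsine_neg (fun u : ℝ => rootShift z (2 * τ * (u : ℂ)) α)]
  congr 1
  funext u
  congr 1
  push_cast
  ring

theorem neg_mem_periodDomain {r : ℕ} {b : Fin r → ℂ} {τ : ℂ} (hp : (b, τ) ∈ periodDomain r) :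
    (b, -τ) ∈ periodDomain r := ⟨hp.1, by simpa using hp.2⟩

theorem centers_neg {r : ℕ} (hr : 2 ≤ r) {b : Fin r → ℂ} {τ : ℂ} (hp : (b, τ) ∈ periodDomain r) :
    centers (b, -τ) = centers (b, τ) := by
  refine (eq_centers hr (neg_mem_periodDomain hp) (centers_spec hr hp).1 ?_).symm
  rw [meanShift_neg]
  exact (centers_spec hr hp).2

/-- The curve depends on `τ²` only: `(τ, u)` and `(-τ, -u)` give the same point. -/
theorem cutPoint_neg {r : ℕ} (hr : 2 ≤ r) {b : Fin r → ℂ} {τ : ℂ} (hp : (b, τ) ∈ periodDomain r)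
    (α : Fin r) (u : ℂ) : cutPoint α ((b, -τ), u) = cutPoint α ((b, τ), -u) := by
  simp only [cutPoint, centers_neg hr hp]
  congr 1
  ring

theorem rootShift_zero {r : ℕ} (hr : 2 ≤ r) {z : Fin r → ℂ} (hz : 0 < orderGap z) (α : Fin r) :
    rootShift z 0 α = 0 := by
  refine (eq_rootShift hr ⟨hz, ?_⟩ ?_ ?_).symm
  · simp only [norm_zero]
    positivity
  · rw [norm_zero]
    positivity
  · simp [shiftMap]

theorem centers_zero {r : ℕ} (hr : 2 ≤ r) {b : Fin r → ℂ} (hb : 0 < orderGap b) :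
    centers (b, 0) = b := by
  have hp : (b, (0 : ℂ)) ∈ periodDomain r := ⟨hb, by simp only [norm_zero]; positivity⟩
  refine (eq_centers hr hp (Metric.mem_closedBall_self (by positivity)) ?_).symm
  funext α
  simp [meanShift, rootShift_zero hr hb]

theorem cutPoint_zero {r : ℕ} (hr : 2 ≤ r) {b : Fin r → ℂ} (hb : 0 < orderGap b) (α : Fin r)
    (u : ℂ) : cutPoint α ((b, 0), u) = b α := by
  simp [cutPoint, centers_zero hr hb, root, rootShift_zero hr hb]

/-! ### Complex conjugation and real configurations -/

/-- The complex configuration given by real points. -/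
def ofRealVec {r : ℕ} (z : Fin r → ℝ) : Fin r → ℂ := fun α => (z α : ℂ)

theorem orderGap_star {r : ℕ} (z : Fin r → ℂ) : orderGap (star z) = orderGap z := by
  simp [orderGap]

theorem star_ofRealVec {r : ℕ} (z : Fin r → ℝ) : star (ofRealVec z) = ofRealVec z := by
  funext α
  simp [ofRealVec]

theorem exists_ofRealVec {r : ℕ} {z : Fin r → ℂ} (h : star z = z) :
    ∃ y : Fin r → ℝ, z = ofRealVec y :=
  ⟨fun α => (z α).re, funext fun α => (Complex.conj_eq_iff_re.1 (congrFun h α)).symm⟩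

theorem rootShift_star {r : ℕ} (hr : 2 ≤ r) {z : Fin r → ℂ} {s : ℂ}
    (h : (z, s) ∈ rootDomain r) (α : Fin r) :
    rootShift (star z) (star s) α = star (rootShift z s α) := by
  have h1 := norm_rootShift_le hr h α
  have h0 : 0 < orderGap z := h.1
  refine (eq_rootShift hr ⟨by rwa [orderGap_star], ?_⟩ ?_ ?_).symm
  · rw [norm_star, orderGap_star]
    exact h.2
  · rw [norm_star, orderGap_star]
    linarith
  · have h2 := congrArg (starRingEnd ℂ) (shiftMap_rootShift hr h α)
    refine Eq.trans ?_ h2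
    simp [shiftMap]

theorem meanShift_star {r : ℕ} (hr : 2 ≤ r) {z : Fin r → ℂ} {τ : ℂ} (h : (z, τ) ∈ cutDomain r) :
    meanShift (star z) (star τ) = star (meanShift z τ) := by
  funext α
  simp only [meanShift, Pi.star_apply, RCLike.star_def]
  rw [← integral_conj]
  refine integral_congr_ae ?_
  filter_upwards [ae_arcsine_mem] with u hu
  have h1 := rootShift_star hr (mem_rootDomain_of_cutDomain h hu) α
  simpa using h1

/-- Real periods come from real configurations, by uniqueness of the fixed point and invariance
under complex conjugation. -/
theorem exists_centers_eq_ofRealVec {r : ℕ} (hr : 2 ≤ r) {b : Fin r → ℝ} {τ : ℝ}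
    (hp : (ofRealVec b, (τ : ℂ)) ∈ periodDomain r) :
    ∃ z : Fin r → ℝ, centers (ofRealVec b, (τ : ℂ)) = ofRealVec z := by
  refine exists_ofRealVec (eq_centers hr hp ?_ ?_)
  · have h1 := (centers_spec hr hp).1
    rw [mem_closedBall_iff_norm] at h1 ⊢
    rwa [← norm_star, star_sub, star_star, star_ofRealVec]
  · have h1 := congrArg star (centers_spec hr hp).2
    rw [star_sub, ← meanShift_star hr (centers_mem_cutDomain hr hp)] at h1
    simpa [star_ofRealVec] using h1

/-- The root of `P(x) = s` near `z_α`, for real data. -/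
def realRoot {r : ℕ} (z : Fin r → ℝ) (s : ℝ) (α : Fin r) : ℝ := (root (ofRealVec z) s α).re

theorem ofReal_realRoot {r : ℕ} (hr : 2 ≤ r) {z : Fin r → ℝ} {s : ℝ}
    (h : (ofRealVec z, (s : ℂ)) ∈ rootDomain r) (α : Fin r) :
    (realRoot z s α : ℂ) = root (ofRealVec z) s α := by
  refine Complex.conj_eq_iff_re.1 ?_
  have h1 := rootShift_star hr h α
  rw [star_ofRealVec] at h1
  rw [root, map_add]
  congr 1
  · simp [ofRealVec]
  · have h2 : star (s : ℂ) = s := Complex.conj_ofReal s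
    rw [h2] at h1
    exact h1.symm

/-! ### The energy density and its first variation -/

/-- The branch of `log (± t)` used for the difference `t` of a point of the cut `α` and a point of
the cut `β`: the sign is chosen so that the argument lies in the right half plane. -/
def orderedLog {r : ℕ} (α β : Fin r) (t : ℂ) : ℂ :=
  if α < β then Complex.log t else Complex.log (-t)

/-- Two tuples of points of the cuts, with different cuts ordered by real parts. -/
def Separated {r : ℕ} (x y : Fin r → ℂ) : Prop :=
  ∀ α β, α < β → 0 < (x α - y β).re ∧ 0 < (y α - x β).re

theorem Separated.symm {r : ℕ} {x y : Fin r → ℂ} (h : Separated x y) : Separated y x :=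
  fun α β hαβ => (h α β hαβ).symm

theorem Separated.ne {r : ℕ} {x y : Fin r → ℂ} (h : Separated x y) {α β : Fin r} (hαβ : α ≠ β) :
    x α - y β ≠ 0 := by
  intro h0
  rcases lt_or_gt_of_ne hαβ with hlt | hlt
  · have := (h α β hlt).1
    rw [h0] at this
    simp at this
  · have := (h β α hlt).2
    rw [← neg_sub, h0] at this
    simp at this

theorem Separated.contDiffAt_orderedLog {r : ℕ} {x y : Fin r → ℂ} (h : Separated x y)
    {α β : Fin r} (hαβ : α ≠ β) : ContDiffAt ℂ 1 (orderedLog α β) (x α - y β) := by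
  rcases lt_or_gt_of_ne hαβ with hlt | hlt
  · have : orderedLog α β = fun t => Complex.log t := funext fun t => if_pos hlt
    rw [this]
    exact Complex.contDiffAt_log (Or.inl (h α β hlt).1)
  · have : orderedLog α β = fun t => Complex.log (-t) := funext fun t => if_neg hlt.not_gt
    rw [this]
    have h1 : -(x α - y β) ∈ Complex.slitPlane := Or.inl (by simpa using (h β α hlt).2)
    exact (Complex.contDiffAt_log h1).comp (x α - y β) contDiff_neg.contDiffAt

theorem Separated.hasDerivAt_orderedLog {r : ℕ} {x y : Fin r → ℂ} (h : Separated x y)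
    {α β : Fin r} (hαβ : α ≠ β) : HasDerivAt (orderedLog α β) (x α - y β)⁻¹ (x α - y β) := by
  rcases lt_or_gt_of_ne hαβ with hlt | hlt
  · have : orderedLog α β = fun t => Complex.log t := funext fun t => if_pos hlt
    rw [this]
    exact Complex.hasDerivAt_log (Or.inl (h α β hlt).1)
  · have : orderedLog α β = fun t => Complex.log (-t) := funext fun t => if_neg hlt.not_gt
    rw [this]
    have h1 : -(x α - y β) ∈ Complex.slitPlane := Or.inl (by simpa using (h β α hlt).2)
    have h2 := (hasDerivAt_neg (x α - y β)).clog h1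
    convert! h2 using 1
    rw [neg_div_neg_eq, one_div]

theorem orderedLog_swap {r : ℕ} {α β : Fin r} (hαβ : α ≠ β) (t : ℂ) :
    orderedLog α β (-t) = orderedLog β α t := by
  rcases lt_or_gt_of_ne hαβ with hlt | hlt
  · rw [orderedLog, orderedLog, if_pos hlt, if_neg hlt.not_gt]
  · rw [orderedLog, orderedLog, if_neg hlt.not_gt, if_pos hlt, neg_neg]

theorem exp_orderedLog {r : ℕ} (α β : Fin r) {t : ℂ} (ht : t ≠ 0) :
    Complex.exp (orderedLog α β t) = (if α < β then 1 else -1) * t := by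
  rw [orderedLog]
  split_ifs with h
  · rw [Complex.exp_log ht, one_mul]
  · rw [Complex.exp_log (neg_ne_zero.2 ht), neg_one_mul]

/-- The logarithm of `x_α - y_β`.  For `α = β` the points collide; since `∏_γ (x_α - y_γ)` equals
`s - s'` when `P(x) = s` and `P(y) = s'`, the logarithm of `x_α - y_α` is expressed through
`ℓ = log (s - s')` and the regular logarithms of the other factors. -/
def kernelLog {r : ℕ} (α β : Fin r) (x y : Fin r → ℂ) (ℓ : ℂ) : ℂ :=
  if α = β then ℓ - ∑ γ ∈ Finset.univ.erase α, orderedLog α γ (x α - y γ)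
  else orderedLog α β (x α - y β)

/-- The kernel `t (log t - 1)` for `t = x_α - y_β`, a primitive of `log t`. -/
def kernel {r : ℕ} (α β : Fin r) (x y : Fin r → ℂ) (ℓ : ℂ) : ℂ :=
  (x α - y β) * (kernelLog α β x y ℓ - 1)

/-- The sum over all pairs of cuts of `-(t² log t / 2 - 3 t² / 4)` for `t = x_α - y_β`. -/
def energyDensity {r : ℕ} (x y : Fin r → ℂ) (ℓ : ℂ) : ℂ :=
  ∑ α, ∑ β, (-(1 / 2) * ((x α - y β) * kernel α β x y ℓ) + 1 / 4 * (x α - y β) ^ 2)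

theorem kernel_eq_add {r : ℕ} (α β : Fin r) (x y : Fin r → ℂ) (ℓ : ℂ) :
    kernel α β x y ℓ = kernel α β x y 0 + ℓ * (if α = β then x α - y β else 0) := by
  rw [kernel, kernel, kernelLog, kernelLog]
  split_ifs <;> ring

theorem energyDensity_eq_add {r : ℕ} (x y : Fin r → ℂ) (ℓ : ℂ) :
    energyDensity x y ℓ = energyDensity x y 0 + ℓ * (-(1 / 2) * ∑ α, (x α - y α) ^ 2) := by
  have h : ∀ α : Fin r, (x α - y α) ^ 2 =
      ∑ β, (x α - y β) * (if α = β then x α - y β else 0) := by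
    intro α
    simp [mul_ite, sq]
  simp only [energyDensity, h]
  rw [Finset.mul_sum, Finset.mul_sum, ← Finset.sum_add_distrib]
  refine Finset.sum_congr rfl fun α _ => ?_
  rw [Finset.mul_sum, Finset.mul_sum, ← Finset.sum_add_distrib]
  refine Finset.sum_congr rfl fun β _ => ?_
  rw [kernel_eq_add α β x y ℓ]
  ring

theorem Separated.contDiffAt_kernel {r : ℕ} {x y : Fin r → ℂ} (h : Separated x y) (α β : Fin r)
    (ℓ : ℂ) :
    ContDiffAt ℂ 1 (fun q : (Fin r → ℂ) × (Fin r → ℂ) => kernel α β q.1 q.2 ℓ) (x, y) := by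
  have hlog : ∀ γ ≠ α, ContDiffAt ℂ 1
      (fun q : (Fin r → ℂ) × (Fin r → ℂ) => orderedLog α γ (q.1 α - q.2 γ)) (x, y) := by
    intro γ hγ
    exact ContDiffAt.comp (g := orderedLog α γ)
      (f := fun q : (Fin r → ℂ) × (Fin r → ℂ) => q.1 α - q.2 γ) (x, y)
      (h.contDiffAt_orderedLog hγ.symm) (by fun_prop)
  simp only [kernel, kernelLog]
  refine ContDiffAt.mul (by fun_prop) (ContDiffAt.sub ?_ contDiffAt_const)
  split_ifs with hαβ
  · exact contDiffAt_const.sub (ContDiffAt.sum fun γ hγ => hlog γ (Finset.ne_of_mem_erase hγ))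
  · exact hlog β (Ne.symm hαβ)

theorem Separated.contDiffAt_energyDensity {r : ℕ} {x y : Fin r → ℂ} (h : Separated x y) (ℓ : ℂ) :
    ContDiffAt ℂ 1 (fun q : (Fin r → ℂ) × (Fin r → ℂ) => energyDensity q.1 q.2 ℓ) (x, y) := by
  simp only [energyDensity]
  refine ContDiffAt.sum fun α _ => ContDiffAt.sum fun β _ => ?_
  exact (contDiffAt_const.mul (ContDiffAt.mul (by fun_prop) (h.contDiffAt_kernel α β ℓ))).add
    (by fun_prop)

theorem kernel_swap_of_ne {r : ℕ} {α β : Fin r} (hαβ : α ≠ β) (x y : Fin r → ℂ) (ℓ : ℂ) :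
    kernel α β x y ℓ = -kernel β α y x ℓ := by
  rw [kernel, kernel, kernelLog, kernelLog, if_neg hαβ, if_neg hαβ.symm,
    ← orderedLog_swap hαβ, neg_sub]
  ring

/-- Derivative of the energy density along a curve of configurations.  The hypothesis on `c` is the
logarithmic derivative of `∏_γ (x_α - y_γ) = s - s'`. -/
theorem hasDerivAt_energyDensity {r : ℕ} {x y : ℂ → Fin r → ℂ} {dx dy : Fin r → ℂ} {t c : ℂ}
    (ℓ : ℂ) (h : Separated (x t) (y t)) (hx : ∀ α, HasDerivAt (fun t => x t α) (dx α) t)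
    (hy : ∀ α, HasDerivAt (fun t => y t α) (dy α) t)
    (hc : ∀ α, (x t α - y t α) *
      ∑ γ ∈ Finset.univ.erase α, (dx α - dy γ) / (x t α - y t γ) =
        (x t α - y t α) * c - (dx α - dy α)) :
    HasDerivAt (fun t => energyDensity (x t) (y t) ℓ)
      (∑ α, ∑ β, -(kernel α β (x t) (y t) ℓ * (dx α - dy β)) +
        1 / 2 * c * ∑ α, (x t α - y t α) ^ 2) t := by
  have hd : ∀ α β, HasDerivAt (fun t => x t α - y t β) (dx α - dy β) t :=
    fun α β => (hx α).sub (hy β)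
  have hlog : ∀ α γ, γ ≠ α → HasDerivAt (fun t => orderedLog α γ (x t α - y t γ))
      ((dx α - dy γ) / (x t α - y t γ)) t := by
    intro α γ hγ
    have := (h.hasDerivAt_orderedLog hγ.symm).comp t (hd α γ)
    rw [div_eq_inv_mul]
    exact this
  have hterm : ∀ α β, HasDerivAt
      (fun t => -(1 / 2) * ((x t α - y t β) * kernel α β (x t) (y t) ℓ) +
        1 / 4 * (x t α - y t β) ^ 2)
      (-(kernel α β (x t) (y t) ℓ * (dx α - dy β)) +
        if α = β then 1 / 2 * c * (x t α - y t β) ^ 2 else 0) t := by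
    intro α β
    have hL : HasDerivAt (fun t => kernelLog α β (x t) (y t) ℓ)
        (if α = β then -∑ γ ∈ Finset.univ.erase α, (dx α - dy γ) / (x t α - y t γ)
          else (dx α - dy β) / (x t α - y t β)) t := by
      simp only [kernelLog]
      split_ifs with hαβ
      · have := HasDerivAt.fun_sum (u := Finset.univ.erase α)
          (A := fun γ t => orderedLog α γ (x t α - y t γ)) (x := t)
          (fun γ hγ => hlog α γ (Finset.ne_of_mem_erase hγ))
        have h2 := (hasDerivAt_const t ℓ).sub this
        rw [zero_sub] at h2
        exact h2
      · exact hlog α β (Ne.symm hαβ)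
    have hk := (hd α β).fun_mul ((hd α β).fun_mul (hL.sub_const 1))
    have hsq := (hd α β).fun_pow 2
    refine ((hk.const_mul (-(1 / 2) : ℂ)).fun_add (hsq.const_mul (1 / 4 : ℂ))).congr_deriv ?_
    simp only [kernel]
    split_ifs with hαβ
    -- on the diagonal the logarithm has the derivative `(dx - dy) / (x - y) - c`, by the hypothesis
    -- `hc`; the second summand gives the last term of the claim
    · subst hαβ
      have h1 := hc α
      simp only [Nat.cast_ofNat, Nat.add_one_sub_one, pow_one]
      linear_combination (1 / 2 * (x t α - y t α)) * h1
    · have hne := h.ne hαβ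
      field_simp
      ring
  have hsum := HasDerivAt.fun_sum (u := Finset.univ) (x := t) fun α _ =>
    HasDerivAt.fun_sum (u := Finset.univ) (x := t) fun β _ => hterm α β
  refine hsum.congr_deriv ?_
  rw [Finset.mul_sum, ← Finset.sum_add_distrib]
  refine Finset.sum_congr rfl fun α _ => ?_
  rw [Finset.sum_add_distrib]
  simp

/-- Derivative of `∑_β kernel α β` in the first point; here `c` is the logarithmic derivative both
of `s - s'` and of `exp ℓ`. -/
theorem hasDerivAt_sum_kernel {r : ℕ} {α : Fin r} {x : ℝ → Fin r → ℂ} {y : Fin r → ℂ} {dx : ℂ}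
    {t : ℝ} {c : ℂ} {ℓ : ℝ → ℂ} (h : Separated (x t) y)
    (hx : HasDerivAt (fun t => x t α) dx t) (hℓ : HasDerivAt ℓ c t)
    (hc : (x t α - y α) * ∑ γ ∈ Finset.univ.erase α, dx / (x t α - y γ) =
      (x t α - y α) * c - dx) :
    HasDerivAt (fun t => ∑ β, kernel α β (x t) y (ℓ t)) (dx * ℓ t) t := by
  have hd : ∀ β, HasDerivAt (fun t => x t α - y β) dx t := fun β => hx.sub_const _
  have hlog : ∀ γ, γ ≠ α → HasDerivAt (fun t => orderedLog α γ (x t α - y γ))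
      (dx / (x t α - y γ)) t := by
    intro γ hγ
    have := (h.hasDerivAt_orderedLog hγ.symm).comp t (hd γ)
    rw [div_eq_inv_mul]
    exact this
  have hsplit : (fun t => ∑ β, kernel α β (x t) y (ℓ t)) = fun t =>
      (x t α - y α) * (ℓ t - ∑ γ ∈ Finset.univ.erase α, orderedLog α γ (x t α - y γ) - 1) +
        ∑ β ∈ Finset.univ.erase α, (x t α - y β) * (orderedLog α β (x t α - y β) - 1) := by
    funext t
    rw [← Finset.add_sum_erase _ _ (Finset.mem_univ α)]
    congr 1
    · rw [kernel, kernelLog, if_pos rfl]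
    · refine Finset.sum_congr rfl fun β hβ => ?_
      rw [kernel, kernelLog, if_neg (Finset.ne_of_mem_erase hβ).symm]
  rw [hsplit]
  have h1 := (hd α).fun_mul ((hℓ.fun_sub (HasDerivAt.fun_sum (u := Finset.univ.erase α) (x := t)
    fun γ hγ => hlog γ (Finset.ne_of_mem_erase hγ))).sub_const 1)
  have h2 := HasDerivAt.fun_sum (u := Finset.univ.erase α) (x := t)
    fun γ hγ => (hd γ).fun_mul ((hlog γ (Finset.ne_of_mem_erase hγ)).sub_const 1)
  refine (h1.fun_add h2).congr_deriv ?_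
  have h3 : ∑ γ ∈ Finset.univ.erase α, (dx * (orderedLog α γ (x t α - y γ) - 1) +
      (x t α - y γ) * (dx / (x t α - y γ))) =
      dx * ∑ γ ∈ Finset.univ.erase α, orderedLog α γ (x t α - y γ) := by
    rw [Finset.mul_sum]
    refine Finset.sum_congr rfl fun γ hγ => ?_
    have := h.ne (Finset.ne_of_mem_erase hγ).symm
    field_simp
    ring
  rw [h3]
  linear_combination (-1 : ℂ) * hc

/-- Logarithmic derivative of a product identity `∏_γ f_γ = g`. -/
theorem sum_div_eq_of_hasDerivAt_prod {𝕜 : Type*} [NontriviallyNormedField 𝕜] [NormedAlgebra 𝕜 ℂ]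
    {r : ℕ} {f : Fin r → 𝕜 → ℂ} {df : Fin r → ℂ} {g : 𝕜 → ℂ}
    {dg : ℂ} {t : 𝕜} (hf : ∀ γ, HasDerivAt (f γ) (df γ) t) (hg : HasDerivAt g dg t)
    (heq : (fun t => ∏ γ, f γ t) =ᶠ[𝓝 t] g) (hne : g t ≠ 0) :
    ∑ γ, df γ / f γ t = dg / g t := by
  have h1 := HasDerivAt.fun_finsetProd (u := Finset.univ) (x := t) fun γ _ => hf γ
  have h2 := (hg.congr_of_eventuallyEq heq).unique h1
  have h0 : ∏ γ, f γ t = g t := heq.eq_of_nhds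
  have hne' : ∀ γ, f γ t ≠ 0 := fun γ => by
    rw [← h0] at hne
    exact Finset.prod_ne_zero_iff.1 hne γ (Finset.mem_univ γ)
  rw [h2, Finset.sum_div]
  refine Finset.sum_congr rfl fun γ _ => ?_
  rw [← h0, ← Finset.mul_prod_erase _ _ (Finset.mem_univ γ), smul_eq_mul]
  have : ∏ x ∈ Finset.univ.erase γ, f x t ≠ 0 := Finset.prod_ne_zero_iff.2 fun i _ => hne' i
  have := hne' γ
  field_simp

/-! ### Weighted averages over pairs of points of the cuts -/

/-- The logarithm of the distance of two points of the cut, in the coordinate `s / τ = 2u`. -/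
def logDist (u u' : ℝ) : ℝ := Real.log |2 * u - 2 * u'|

theorem logDist_comm (u u' : ℝ) : logDist u u' = logDist u' u := by
  rw [logDist, logDist, abs_sub_comm]

/-- The product of two copies of the arcsine law. -/
def arcsine₂ : Measure (ℝ × ℝ) := arcsine.prod arcsine

instance : IsProbabilityMeasure arcsine₂ := inferInstanceAs (IsProbabilityMeasure (arcsine.prod arcsine))

theorem ae_arcsine₂_mem : ∀ᵐ y ∂arcsine₂, y ∈ Icc (-1 : ℝ) 1 ×ˢ Icc (-1 : ℝ) 1 := by
  rw [arcsine₂, Measure.ae_prod_mem_iff_ae_ae_mem (measurableSet_Icc.prod measurableSet_Icc)]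
  filter_upwards [ae_arcsine_mem] with u hu
  filter_upwards [ae_arcsine_mem] with u' hu' using ⟨hu, hu'⟩

theorem integrable_logDist₂ : Integrable (fun y : ℝ × ℝ => logDist y.1 y.2) arcsine₂ :=
  integrable_log_prod_arcsine arcsine ae_arcsine_mem

theorem isCompact_square : IsCompact (Icc (-1 : ℝ) 1 ×ˢ Icc (-1 : ℝ) 1) :=
  isCompact_Icc.prod isCompact_Icc

theorem measurableSet_square : MeasurableSet (Icc (-1 : ℝ) 1 ×ˢ Icc (-1 : ℝ) 1) :=
  measurableSet_Icc.prod measurableSet_Icc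

theorem integrable_arcsine₂ {f : ℝ × ℝ → ℂ}
    (hf : ContinuousOn f (Icc (-1 : ℝ) 1 ×ˢ Icc (-1 : ℝ) 1)) : Integrable f arcsine₂ := by
  have := integrable_smul_of_continuousOn isCompact_square measurableSet_square ae_arcsine₂_mem
    (integrable_const (1 : ℝ)) hf
  simpa using this

theorem integrable_logDist_mul₂ {f : ℝ × ℝ → ℂ}
    (hf : ContinuousOn f (Icc (-1 : ℝ) 1 ×ˢ Icc (-1 : ℝ) 1)) :
    Integrable (fun y => (logDist y.1 y.2 : ℂ) * f y) arcsine₂ := by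
  have := integrable_smul_of_continuousOn isCompact_square measurableSet_square ae_arcsine₂_mem
    integrable_logDist₂ hf
  simpa using this

theorem integrable_logDist_mul {u : ℝ} {f : ℝ → ℂ} (hf : ContinuousOn f (Icc (-1 : ℝ) 1)) :
    Integrable (fun u' => (logDist u u' : ℂ) * f u') arcsine := by
  have := integrable_smul_of_continuousOn isCompact_Icc measurableSet_Icc ae_arcsine_mem
    (integrable_log_arcsine (2 * u)) hf
  simp only [Complex.real_smul] at this
  exact this

theorem integral_arcsine₂_swap (f : ℝ × ℝ → ℂ) :
    ∫ y, f y.swap ∂arcsine₂ = ∫ y, f y ∂arcsine₂ :=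
  integral_prod_swap f

/-! ### The pair of points of the cuts -/

/-- The points of all cuts with the same value `2τu` of `P`. -/
def cutVec {r : ℕ} (q : ((Fin r → ℂ) × ℂ) × ℂ) : Fin r → ℂ := fun α => cutPoint α q

theorem separated_cutVec {r : ℕ} (hr : 2 ≤ r) {p : (Fin r → ℂ) × ℂ} (hp : p ∈ periodDomain r)
    {u u' : ℝ} (hu : u ∈ Icc (-1 : ℝ) 1) (hu' : u' ∈ Icc (-1 : ℝ) 1) :
    Separated (cutVec (p, (u : ℂ))) (cutVec (p, (u' : ℂ))) := fun _ _ h =>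
  ⟨cutPoint_sub_re_pos hr hp hu hu' h, cutPoint_sub_re_pos hr hp hu' hu h⟩

theorem contDiffAt_cutVec {r : ℕ} (hr : 2 ≤ r) {p : (Fin r → ℂ) × ℂ} (hp : p ∈ periodDomain r)
    {u : ℝ} (hu : u ∈ Icc (-1 : ℝ) 1) : ContDiffAt ℂ 1 (cutVec (r := r)) (p, (u : ℂ)) := by
  rw [contDiffAt_pi]
  exact fun α => contDiffAt_cutPoint hr hp hu α

/-- The inclusion of the pairs `(u, u')` of real numbers into the pairs of complex numbers. -/
def ofRealPair (y : ℝ × ℝ) : ℂ × ℂ := ((y.1 : ℂ), (y.2 : ℂ))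

theorem continuous_ofRealPair : Continuous ofRealPair := by
  unfold ofRealPair
  fun_prop

theorem contDiffAt_cutVec₂ {r : ℕ} (hr : 2 ≤ r) {p : (Fin r → ℂ) × ℂ} (hp : p ∈ periodDomain r)
    {y : ℝ × ℝ} (hy : y ∈ Icc (-1 : ℝ) 1 ×ˢ Icc (-1 : ℝ) 1) :
    ContDiffAt ℂ 1 (fun q : ((Fin r → ℂ) × ℂ) × (ℂ × ℂ) =>
      (cutVec (q.1, q.2.1), cutVec (q.1, q.2.2))) (p, ofRealPair y) := by
  refine ContDiffAt.prodMk ?_ ?_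
  · exact ContDiffAt.comp (g := cutVec)
      (f := fun q : ((Fin r → ℂ) × ℂ) × (ℂ × ℂ) => (q.1, q.2.1)) (p, ofRealPair y)
      (contDiffAt_cutVec hr hp hy.1) (by fun_prop)
  · exact ContDiffAt.comp (g := cutVec)
      (f := fun q : ((Fin r → ℂ) × ℂ) × (ℂ × ℂ) => (q.1, q.2.2)) (p, ofRealPair y)
      (contDiffAt_cutVec hr hp hy.2) (by fun_prop)

theorem contDiffAt_comp_cutVec₂ {r : ℕ} (hr : 2 ≤ r) {p : (Fin r → ℂ) × ℂ}
    (hp : p ∈ periodDomain r) {Ψ : (Fin r → ℂ) × (Fin r → ℂ) → ℂ}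
    (hΨ : ∀ x y, Separated x y → ContDiffAt ℂ 1 Ψ (x, y))
    {y : ℝ × ℝ} (hy : y ∈ Icc (-1 : ℝ) 1 ×ˢ Icc (-1 : ℝ) 1) :
    ContDiffAt ℂ 1 (fun q : ((Fin r → ℂ) × ℂ) × (ℂ × ℂ) =>
      Ψ (cutVec (q.1, q.2.1), cutVec (q.1, q.2.2))) (p, ofRealPair y) :=
  ContDiffAt.comp (g := Ψ) (f := fun q : ((Fin r → ℂ) × ℂ) × (ℂ × ℂ) =>
      (cutVec (q.1, q.2.1), cutVec (q.1, q.2.2))) (p, ofRealPair y)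
    (hΨ _ _ (separated_cutVec hr hp hy.1 hy.2)) (contDiffAt_cutVec₂ hr hp hy)

theorem continuousOn_comp_cutVec₂ {r : ℕ} (hr : 2 ≤ r) {p : (Fin r → ℂ) × ℂ}
    (hp : p ∈ periodDomain r) {Ψ : (Fin r → ℂ) × (Fin r → ℂ) → ℂ}
    (hΨ : ∀ x y, Separated x y → ContDiffAt ℂ 1 Ψ (x, y)) :
    ContinuousOn (fun y : ℝ × ℝ => Ψ (cutVec (p, (y.1 : ℂ)), cutVec (p, (y.2 : ℂ))))
      (Icc (-1 : ℝ) 1 ×ˢ Icc (-1 : ℝ) 1) := by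
  intro y hy
  exact (ContinuousAt.comp (g := fun q : ((Fin r → ℂ) × ℂ) × (ℂ × ℂ) =>
      Ψ (cutVec (q.1, q.2.1), cutVec (q.1, q.2.2))) (f := fun y : ℝ × ℝ => (p, ofRealPair y))
    (contDiffAt_comp_cutVec₂ hr hp hΨ hy).continuousAt
    (continuousAt_const.prodMk continuous_ofRealPair.continuousAt)).continuousWithinAt

/-- The kernel between a point of the cut `α` and a point of the cut `β`. -/
def cutKernel {r : ℕ} (p : (Fin r → ℂ) × ℂ) (α β : Fin r) (u u' : ℝ) : ℂ :=
  kernel α β (cutVec (p, (u : ℂ))) (cutVec (p, (u' : ℂ))) (logDist u u')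

theorem cutKernel_eq {r : ℕ} (p : (Fin r → ℂ) × ℂ) (α β : Fin r) (u u' : ℝ) :
    cutKernel p α β u u' = kernel α β (cutVec (p, (u : ℂ))) (cutVec (p, (u' : ℂ))) 0 +
      (logDist u u' : ℂ) * (if α = β then cutPoint α (p, (u : ℂ)) - cutPoint β (p, (u' : ℂ)) else 0) :=
  kernel_eq_add _ _ _ _ _

theorem continuousOn_kernel_zero {r : ℕ} (hr : 2 ≤ r) {p : (Fin r → ℂ) × ℂ}
    (hp : p ∈ periodDomain r) (α β : Fin r) :
    ContinuousOn (fun y : ℝ × ℝ => kernel α β (cutVec (p, (y.1 : ℂ))) (cutVec (p, (y.2 : ℂ))) 0)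
      (Icc (-1 : ℝ) 1 ×ˢ Icc (-1 : ℝ) 1) :=
  continuousOn_comp_cutVec₂ hr hp
    (Ψ := fun q : (Fin r → ℂ) × (Fin r → ℂ) => kernel α β q.1 q.2 0)
    fun _ _ h => h.contDiffAt_kernel α β 0

theorem continuousOn_cutPoint_sub {r : ℕ} (hr : 2 ≤ r) {p : (Fin r → ℂ) × ℂ}
    (hp : p ∈ periodDomain r) (α β : Fin r) :
    ContinuousOn (fun y : ℝ × ℝ => cutPoint α (p, (y.1 : ℂ)) - cutPoint β (p, (y.2 : ℂ)))
      (Icc (-1 : ℝ) 1 ×ˢ Icc (-1 : ℝ) 1) :=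
  ((continuousOn_cutPoint hr hp α).comp continuousOn_fst fun _ hy => hy.1).sub
    ((continuousOn_cutPoint hr hp β).comp continuousOn_snd fun _ hy => hy.2)

theorem integrable_mul_cutKernel₂ {r : ℕ} (hr : 2 ≤ r) {p : (Fin r → ℂ) × ℂ}
    (hp : p ∈ periodDomain r) (α β : Fin r) {f : ℝ × ℝ → ℂ}
    (hf : ContinuousOn f (Icc (-1 : ℝ) 1 ×ˢ Icc (-1 : ℝ) 1)) :
    Integrable (fun y => f y * cutKernel p α β y.1 y.2) arcsine₂ := by
  have h2 : ContinuousOn (fun y : ℝ × ℝ => f y *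
      (if α = β then cutPoint α (p, (y.1 : ℂ)) - cutPoint β (p, (y.2 : ℂ)) else 0))
      (Icc (-1 : ℝ) 1 ×ˢ Icc (-1 : ℝ) 1) := by
    split_ifs
    · exact hf.mul (continuousOn_cutPoint_sub hr hp α β)
    · exact hf.mul continuousOn_const
  refine ((integrable_arcsine₂ (hf.mul (continuousOn_kernel_zero hr hp α β))).add
    (integrable_logDist_mul₂ h2)).congr (Eventually.of_forall fun y => ?_)
  simp only [Pi.add_apply, Pi.mul_apply]
  rw [cutKernel_eq]
  ring

theorem integrable_cutKernel {r : ℕ} (hr : 2 ≤ r) {p : (Fin r → ℂ) × ℂ}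
    (hp : p ∈ periodDomain r) (α β : Fin r) {u : ℝ} (hu : u ∈ Icc (-1 : ℝ) 1) :
    Integrable (fun u' => cutKernel p α β u u') arcsine := by
  have hmk : ContinuousOn (fun u' : ℝ => (u, u')) (Icc (-1 : ℝ) 1) := by fun_prop
  have h1 : ContinuousOn (fun u' : ℝ => kernel α β (cutVec (p, (u : ℂ))) (cutVec (p, (u' : ℂ))) 0)
      (Icc (-1 : ℝ) 1) :=
    (continuousOn_kernel_zero hr hp α β).comp (f := fun u' : ℝ => (u, u')) hmk
      fun u' hu' => ⟨hu, hu'⟩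
  have h2 : ContinuousOn (fun u' : ℝ =>
      (if α = β then cutPoint α (p, (u : ℂ)) - cutPoint β (p, (u' : ℂ)) else 0))
      (Icc (-1 : ℝ) 1) := by
    split_ifs
    · exact (continuousOn_cutPoint_sub hr hp α β).comp (f := fun u' : ℝ => (u, u')) hmk
        fun u' hu' => ⟨hu, hu'⟩
    · exact continuousOn_const
  refine ((integrable_arcsine_of_continuousOn h1).add (integrable_logDist_mul (u := u) h2)).congr
    (Eventually.of_forall fun u' => ?_)
  simp only [Pi.add_apply]
  rw [cutKernel_eq]

/-! ### Antisymmetry of the kernel -/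

/-- A continuous function with values in `2πiℤ` is constant on a connected set. -/
theorem eq_of_continuousOn_of_exp_eq_one {D : ℝ → ℂ} {s : Set ℝ} (hs : IsPreconnected s)
    (hD : ContinuousOn D s) (hexp : ∀ u ∈ s, Complex.exp (D u) = 1) {u u' : ℝ} (hu : u ∈ s)
    (hu' : u' ∈ s) : D u = D u' := by
  -- `D / (2πi)` takes integer values
  have hint : ∀ v ∈ s, ∃ n : ℤ, D v = n * (2 * Real.pi * Complex.I) := fun v hv =>
    Complex.exp_eq_one_iff.1 (hexp v hv)
  have hc : ContinuousOn (fun v => (D v).im / (2 * Real.pi)) s :=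
    (Complex.continuous_im.comp_continuousOn hD).div_const _
  have hmaps : MapsTo (fun v => (D v).im / (2 * Real.pi)) s (range ((↑) : ℤ → ℝ)) := by
    intro v hv
    obtain ⟨n, hn⟩ := hint v hv
    refine ⟨n, ?_⟩
    simp only
    rw [hn]
    simp [Real.pi_ne_zero]
  have hdisc : IsDiscrete (range ((↑) : ℤ → ℝ)) := isDiscrete_iff_discreteTopology.2 <|
    Int.isClosedEmbedding_coe_real.isEmbedding.toHomeomorph.symm.isEmbedding.discreteTopology
  have h := hs.constant_of_mapsTo hdisc hc hmaps hu hu'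
  obtain ⟨n, hn⟩ := hint u hu
  obtain ⟨m, hm⟩ := hint u' hu'
  rw [hn, hm] at h
  have h' : (n : ℝ) = m := by
    have := Real.pi_ne_zero
    simpa [this] using h
  rw [hn, hm]
  congr 1
  exact_mod_cast h'

theorem continuousOn_sum_orderedLog {r : ℕ} (hr : 2 ≤ r) {p : (Fin r → ℂ) × ℂ}
    (hp : p ∈ periodDomain r) (α : Fin r) :
    ContinuousOn (fun y : ℝ × ℝ => ∑ γ ∈ Finset.univ.erase α,
      orderedLog α γ (cutPoint α (p, (y.1 : ℂ)) - cutPoint γ (p, (y.2 : ℂ))))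
      (Icc (-1 : ℝ) 1 ×ˢ Icc (-1 : ℝ) 1) := by
  refine continuousOn_finsetSum _ fun γ hγ => ?_
  refine continuousOn_comp_cutVec₂ hr hp
    (Ψ := fun q : (Fin r → ℂ) × (Fin r → ℂ) => orderedLog α γ (q.1 α - q.2 γ)) fun x y h => ?_
  exact ContDiffAt.comp (g := orderedLog α γ)
      (f := fun q : (Fin r → ℂ) × (Fin r → ℂ) => q.1 α - q.2 γ) (x, y)
      (h.contDiffAt_orderedLog (Finset.ne_of_mem_erase hγ).symm) (by fun_prop)

theorem exp_sum_orderedLog {r : ℕ} {x y : Fin r → ℂ} (h : Separated x y) (α : Fin r) :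
    Complex.exp (∑ γ ∈ Finset.univ.erase α, orderedLog α γ (x α - y γ)) =
      (∏ γ ∈ Finset.univ.erase α, if α < γ then (1 : ℂ) else -1) *
        ∏ γ ∈ Finset.univ.erase α, (x α - y γ) := by
  rw [Complex.exp_sum, ← Finset.prod_mul_distrib]
  exact Finset.prod_congr rfl fun γ hγ =>
    exp_orderedLog α γ (h.ne (Finset.ne_of_mem_erase hγ).symm)

/-- Both sides are logarithms of the same number `± ∏_γ (x_α - y_γ) / (x_α - y_α)`, which is
symmetric in `x` and `y`. Their difference is continuous on the square with values in `2πiℤ`, and it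
vanishes on the diagonal. -/
theorem sum_orderedLog_comm {r : ℕ} (hr : 2 ≤ r) {p : (Fin r → ℂ) × ℂ}
    (hp : p ∈ periodDomain r) (hτ : p.2 ≠ 0) (α : Fin r) {u u' : ℝ} (hu : u ∈ Icc (-1 : ℝ) 1)
    (hu' : u' ∈ Icc (-1 : ℝ) 1) :
    ∑ γ ∈ Finset.univ.erase α,
        orderedLog α γ (cutPoint α (p, (u : ℂ)) - cutPoint γ (p, (u' : ℂ))) =
      ∑ γ ∈ Finset.univ.erase α,
        orderedLog α γ (cutPoint α (p, (u' : ℂ)) - cutPoint γ (p, (u : ℂ))) := by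
  set L : ℝ → ℝ → ℂ := fun v v' => ∑ γ ∈ Finset.univ.erase α,
        orderedLog α γ (cutPoint α (p, (v : ℂ)) - cutPoint γ (p, (v' : ℂ))) with hL
  have hc1 : ContinuousOn (fun v => L u v) (Icc (-1) 1) :=
    (continuousOn_sum_orderedLog hr hp α).comp (f := fun v => (u, v)) (by fun_prop)
      fun v hv => ⟨hu, hv⟩
  have hc2 : ContinuousOn (fun v => L v u) (Icc (-1) 1) :=
    (continuousOn_sum_orderedLog hr hp α).comp (f := fun v => (v, u)) (by fun_prop)
      fun v hv => ⟨hv, hu⟩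
  have hexp : ∀ v ∈ Icc (-1 : ℝ) 1, Complex.exp (L u v - L v u) = 1 := by
    intro v hv
    rcases eq_or_ne u v with rfl | hne
    · simp
    have hsep := separated_cutVec hr hp hu hv
    have h1 := exp_sum_orderedLog hsep α
    have h2 := exp_sum_orderedLog hsep.symm α
    have h3 := prod_sub_cutPoint hr hp hu hv α
    have h4 := prod_sub_cutPoint hr hp hv hu α
    rw [← Finset.mul_prod_erase _ _ (Finset.mem_univ α)] at h3 h4
    have hne' : (u : ℂ) - v ≠ 0 := sub_ne_zero.2 (by exact_mod_cast hne)
    have hx : cutPoint α (p, (u : ℂ)) - cutPoint α (p, (v : ℂ)) ≠ 0 := by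
      intro h0
      rw [h0, zero_mul] at h3
      exact mul_ne_zero (mul_ne_zero two_ne_zero hτ) hne' h3.symm
    -- the full products are `± 2τ (u - v)`, and cancelling the factors of index `α` removes the
    -- sign
    have h5 : ∏ γ ∈ Finset.univ.erase α, (cutPoint α (p, (u : ℂ)) - cutPoint γ (p, (v : ℂ))) =
        ∏ γ ∈ Finset.univ.erase α, (cutPoint α (p, (v : ℂ)) - cutPoint γ (p, (u : ℂ))) := by
      refine mul_left_cancel₀ hx ?_
      rw [h3]
      linear_combination h4
    rw [Complex.exp_sub]
    simp only [cutVec] at h1 h2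
    simp only [hL]
    rw [h1, h2, h5, ← h2, div_self (Complex.exp_ne_zero _)]
  have h := eq_of_continuousOn_of_exp_eq_one isPreconnected_Icc (hc1.sub hc2) hexp hu' hu
  simp only [Pi.sub_apply, sub_self] at h
  exact sub_eq_zero.1 h

/-- The kernel is antisymmetric. Off the diagonal this is the choice of the branches in
`orderedLog`; on the diagonal it is `sum_orderedLog_comm`. -/
theorem cutKernel_swap {r : ℕ} (hr : 2 ≤ r) {p : (Fin r → ℂ) × ℂ} (hp : p ∈ periodDomain r)
    (hτ : p.2 ≠ 0) (α β : Fin r) {u u' : ℝ} (hu : u ∈ Icc (-1 : ℝ) 1) (hu' : u' ∈ Icc (-1 : ℝ) 1) :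
    cutKernel p α β u u' = -cutKernel p β α u' u := by
  rw [cutKernel, cutKernel, logDist_comm u' u]
  by_cases hαβ : α = β
  · subst hαβ
    rw [kernel, kernel, kernelLog, kernelLog, if_pos rfl, if_pos rfl]
    simp only [cutVec]
    rw [sum_orderedLog_comm hr hp hτ α hu hu']
    ring
  · exact kernel_swap_of_ne hαβ _ _ _

/-! ### The potential is constant on each cut -/

/-- The derivative of the point of the cut `α` in the coordinate `u`. -/
def cutSpeed {r : ℕ} (p : (Fin r → ℂ) × ℂ) (α : Fin r) (u : ℝ) : ℂ :=
  fderiv ℂ (cutPoint α) (p, (u : ℂ)) (0, 1)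

theorem hasDerivAt_cutPoint {r : ℕ} (hr : 2 ≤ r) {p : (Fin r → ℂ) × ℂ} (hp : p ∈ periodDomain r)
    (α : Fin r) {u : ℝ} (hu : u ∈ Icc (-1 : ℝ) 1) :
    HasDerivAt (fun u : ℝ => cutPoint α (p, (u : ℂ))) (cutSpeed p α u) u := by
  have h1 := ((contDiffAt_cutPoint hr hp hu α).differentiableAt one_ne_zero).hasFDerivAt
  have h2 : HasDerivAt (fun v : ℂ => (p, v)) ((0 : (Fin r → ℂ) × ℂ), (1 : ℂ)) (u : ℂ) :=
    (hasDerivAt_const _ p).prodMk (hasDerivAt_id _)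
  exact (h1.comp_hasDerivAt (u : ℂ) h2).comp_ofReal

theorem continuousOn_cutSpeed {r : ℕ} (hr : 2 ≤ r) {p : (Fin r → ℂ) × ℂ} (hp : p ∈ periodDomain r)
    (α : Fin r) : ContinuousOn (cutSpeed p α) (Icc (-1) 1) := by
  intro u hu
  have h1 := (contDiffAt_cutPoint hr hp hu α).continuousAt_fderiv one_ne_zero
  have h2 : ContinuousAt (fun u : ℝ => fderiv ℂ (cutPoint α) (p, (u : ℂ))) u :=
    ContinuousAt.comp (g := fderiv ℂ (cutPoint α)) (f := fun u : ℝ => (p, (u : ℂ))) h1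
      (by fun_prop)
  exact (h2.clm_apply continuousAt_const).continuousWithinAt

theorem cutPoint_ne_of_ne {r : ℕ} (hr : 2 ≤ r) {p : (Fin r → ℂ) × ℂ} (hp : p ∈ periodDomain r)
    (hτ : p.2 ≠ 0) (α : Fin r) {u u' : ℝ} (hu : u ∈ Icc (-1 : ℝ) 1) (hu' : u' ∈ Icc (-1 : ℝ) 1)
    (hne : u ≠ u') : cutPoint α (p, (u : ℂ)) - cutPoint α (p, (u' : ℂ)) ≠ 0 := by
  intro h0
  have h := prod_sub_cutPoint hr hp hu hu' α
  rw [← Finset.mul_prod_erase _ _ (Finset.mem_univ α), h0, zero_mul] at h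
  exact mul_ne_zero (mul_ne_zero two_ne_zero hτ) (sub_ne_zero.2 (by exact_mod_cast hne)) h.symm

/-- Since `kernel` is a primitive of the logarithm, the derivative of the sum is `x'` times the
logarithm of `∏_γ (x_α - y_γ)`, without the constant `log τ` that is dropped in `logDist`. -/
theorem hasDerivAt_sum_cutKernel {r : ℕ} (hr : 2 ≤ r) {p : (Fin r → ℂ) × ℂ}
    (hp : p ∈ periodDomain r) (hτ : p.2 ≠ 0) (α : Fin r) {u u' : ℝ} (hu : u ∈ Ioo (-1 : ℝ) 1)
    (hu' : u' ∈ Icc (-1 : ℝ) 1) (hne : u ≠ u') :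
    HasDerivAt (fun u => ∑ β, cutKernel p α β u u') (cutSpeed p α u * logDist u u') u := by
  have huI := Ioo_subset_Icc_self hu
  have hsep := separated_cutVec hr hp huI hu'
  have hne' : (u : ℂ) - u' ≠ 0 := sub_ne_zero.2 (by exact_mod_cast hne)
  have hℓ : HasDerivAt (fun u => (logDist u u' : ℂ)) (((u : ℂ) - u')⁻¹) u := by
    have h1 : HasDerivAt (fun u : ℝ => 2 * u - 2 * u') 2 u := by
      simpa using ((hasDerivAt_id u).const_mul 2).sub_const (2 * u')
    have h2 := h1.log (by
      intro h
      exact hne (by linarith))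
    have h3 : HasDerivAt (fun u => logDist u u') (u - u')⁻¹ u := by
      simp only [logDist, Real.log_abs]
      refine h2.congr_deriv ?_
      have : u - u' ≠ 0 := sub_ne_zero.2 hne
      rw [← mul_sub]
      field_simp
    have := h3.ofReal_comp
    push_cast at this
    exact this
  have hx := hasDerivAt_cutPoint hr hp α huI
  refine hasDerivAt_sum_kernel (α := α) (x := fun u : ℝ => cutVec (p, (u : ℂ)))
    (y := cutVec (p, (u' : ℂ))) (c := ((u : ℂ) - u')⁻¹) (ℓ := fun u => (logDist u u' : ℂ)) hsep hx
    hℓ ?_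
  have hf : ∀ γ, HasDerivAt (fun u : ℝ => cutPoint α (p, (u : ℂ)) - cutPoint γ (p, (u' : ℂ)))
      (cutSpeed p α u) u := fun γ => hx.sub_const _
  have hg : HasDerivAt (fun u : ℝ => 2 * p.2 * ((u : ℂ) - u')) (2 * p.2) u := by
    have := (((hasDerivAt_id (u : ℂ)).sub_const (u' : ℂ)).const_mul (2 * p.2)).comp_ofReal
    simpa using this
  have hev : (fun u : ℝ => ∏ γ, (cutPoint α (p, (u : ℂ)) - cutPoint γ (p, (u' : ℂ)))) =ᶠ[𝓝 u]
      fun u : ℝ => 2 * p.2 * ((u : ℂ) - u') := by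
    filter_upwards [Icc_mem_nhds hu.1 hu.2] with v hv using prod_sub_cutPoint hr hp hv hu' α
  have h2τ : 2 * p.2 ≠ 0 := mul_ne_zero two_ne_zero hτ
  have hkey := sum_div_eq_of_hasDerivAt_prod hf hg hev (mul_ne_zero h2τ hne')
  have hx0 := cutPoint_ne_of_ne hr hp hτ α huI hu' hne
  rw [← Finset.add_sum_erase _ _ (Finset.mem_univ α)] at hkey
  have h3 : 2 * p.2 / (2 * p.2 * ((u : ℂ) - u')) = ((u : ℂ) - u')⁻¹ := by
    field_simp
  rw [h3] at hkey
  simp only [cutVec]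
  rw [← hkey]
  field_simp
  ring

/-- The zero of `g u - g u'` cancels the logarithmic singularity at `u = u'`. -/
theorem continuousOn_logDist_mul_sub {g : ℝ → ℂ} {s : Set ℝ} (hg : ∀ u ∈ s, DifferentiableAt ℝ g u)
    {u' : ℝ} (hu' : u' ∈ s) : ContinuousOn (fun u => (logDist u u' : ℂ) * (g u - g u')) s := by
  intro u hu
  have h1 : ContinuousAt (dslope g u') u := by
    rcases eq_or_ne u u' with rfl | hne
    · exact continuousAt_dslope_same.2 (hg u hu)
    · exact (continuousAt_dslope_of_ne hne).2 (hg u hu).continuousAt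
  have h2 : Continuous fun u : ℝ => (u - u') * Real.log (2 * u - 2 * u') := by
    have h3 : (fun u : ℝ => (u - u') * Real.log (2 * u - 2 * u')) = fun u : ℝ =>
        (1 / 2 : ℝ) * ((2 * u - 2 * u') * Real.log (2 * u - 2 * u')) := by
      funext u
      ring
    rw [h3]
    exact continuous_const.mul (Real.continuous_mul_log.comp (f := fun u : ℝ => 2 * u - 2 * u')
      (by fun_prop))
  have h4 : (fun u => (logDist u u' : ℂ) * (g u - g u')) = fun u : ℝ =>
      (((u - u') * Real.log (2 * u - 2 * u') : ℝ) : ℂ) * dslope g u' u := by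
    funext u
    rw [← sub_smul_dslope g u' u, logDist, Real.log_abs, Complex.real_smul]
    push_cast
    ring
  rw [h4]
  exact ((Complex.continuous_ofReal.comp h2).continuousAt.mul h1).continuousWithinAt

theorem continuousOn_sum_cutKernel {r : ℕ} (hr : 2 ≤ r) {p : (Fin r → ℂ) × ℂ}
    (hp : p ∈ periodDomain r) (α : Fin r) {u' : ℝ} (hu' : u' ∈ Icc (-1 : ℝ) 1) :
    ContinuousOn (fun u => ∑ β, cutKernel p α β u u') (Icc (-1) 1) := by
  refine continuousOn_finsetSum _ fun β _ => ?_
  simp only [cutKernel_eq]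
  refine ContinuousOn.add ?_ ?_
  · exact (continuousOn_kernel_zero hr hp α β).comp (f := fun u : ℝ => (u, u')) (by fun_prop)
      fun u hu => ⟨hu, hu'⟩
  · split_ifs with hαβ
    · subst hαβ
      exact continuousOn_logDist_mul_sub (g := fun u : ℝ => cutPoint α (p, (u : ℂ)))
        (fun u hu => (hasDerivAt_cutPoint hr hp α hu).differentiableAt) hu'
    · simp only [mul_zero]
      exact continuousOn_const

/-- The potential at the point `u` of the cut `α` generated by all cuts. -/
def potential {r : ℕ} (p : (Fin r → ℂ) × ℂ) (α : Fin r) (u : ℝ) : ℂ :=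
  ∫ u', ∑ β, cutKernel p α β u u' ∂arcsine

/-- The potential does not depend on the point of the cut: its derivative is the average of
`log |2u - 2u'|` over the arcsine law, which vanishes. -/
theorem potential_eq {r : ℕ} (hr : 2 ≤ r) {p : (Fin r → ℂ) × ℂ} (hp : p ∈ periodDomain r)
    (hτ : p.2 ≠ 0) (α : Fin r) {u₁ u₂ : ℝ} (h1 : u₁ ∈ Icc (-1 : ℝ) 1) (h2 : u₂ ∈ Icc (-1 : ℝ) 1)
    (h12 : u₁ ≤ u₂) : potential p α u₂ = potential p α u₁ := by
  have hsub : Icc u₁ u₂ ⊆ Icc (-1 : ℝ) 1 := Icc_subset_Icc h1.1 h2.2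
  have hμ : ∀ᵐ u ∂(volume.restrict (Icc u₁ u₂)), u ∈ Icc (-1 : ℝ) 1 := by
    filter_upwards [ae_restrict_mem measurableSet_Icc] with u hu using hsub hu
  have hμ2 : ∀ᵐ y ∂((volume.restrict (Icc u₁ u₂)).prod arcsine),
      y ∈ Icc (-1 : ℝ) 1 ×ˢ Icc (-1 : ℝ) 1 := by
    rw [Measure.ae_prod_mem_iff_ae_ae_mem measurableSet_square]
    filter_upwards [hμ] with u hu
    filter_upwards [ae_arcsine_mem] with u' hu' using ⟨hu, hu'⟩
  have hint : Integrable (fun y : ℝ × ℝ => cutSpeed p α y.1 * (logDist y.1 y.2 : ℂ))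
      ((volume.restrict (Icc u₁ u₂)).prod arcsine) := by
    have := integrable_smul_of_continuousOn isCompact_square measurableSet_square hμ2
      (integrable_log_prod_arcsine _ hμ) (f := fun y : ℝ × ℝ => cutSpeed p α y.1)
      ((continuousOn_cutSpeed hr hp α).comp continuousOn_fst fun y hy => hy.1)
    refine this.congr (Eventually.of_forall fun y => ?_)
    simp only [Complex.real_smul]
    rw [mul_comm]
    rfl
  have hI : ∀ {u : ℝ}, u ∈ Icc (-1 : ℝ) 1 →
      Integrable (fun u' => ∑ β, cutKernel p α β u u') arcsine := fun hu =>
    integrable_finsetSum _ fun β _ => integrable_cutKernel hr hp α β hu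
  -- the fundamental theorem of calculus in `u`; the kernel is continuous, and differentiable
  -- except at `u = u'`
  have hftc : ∀ᵐ u' ∂arcsine, ∑ β, cutKernel p α β u₂ u' - ∑ β, cutKernel p α β u₁ u' =
      ∫ u in Icc u₁ u₂, cutSpeed p α u * (logDist u u' : ℂ) := by
    filter_upwards [ae_arcsine_mem, hint.prod_left_ae] with u' hu' hiu
    have h := MeasureTheory.integral_eq_of_hasDerivAt_off_countable_of_le
      (fun u => ∑ β, cutKernel p α β u u') (fun u => cutSpeed p α u * (logDist u u' : ℂ)) h12
      (countable_singleton u') ((continuousOn_sum_cutKernel hr hp α hu').mono hsub)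
      (fun u hu => hasDerivAt_sum_cutKernel hr hp hτ α
        ⟨h1.1.trans_lt hu.1.1, hu.1.2.trans_le h2.2⟩ hu' (fun h => hu.2 h))
      ((intervalIntegrable_iff_integrableOn_Icc_of_le h12).2 hiu)
    rw [← h, intervalIntegral.integral_of_le h12, integral_Icc_eq_integral_Ioc]
  -- after exchanging the integrals, the inner one is the logarithmic potential on the support
  rw [← sub_eq_zero, potential, potential, ← integral_sub (hI h2) (hI h1), integral_congr_ae hftc,
    ← integral_integral_swap hint]
  refine (setIntegral_congr_fun measurableSet_Icc (g := fun _ => (0 : ℂ)) fun u hu => ?_).trans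
    (by simp)
  have hu' := hsub hu
  have h3 : ∫ u', (logDist u u' : ℂ) ∂arcsine = 0 := by
    rw [integral_complex_ofReal]
    have := integral_log_arcsine_of_abs_le (v := 2 * u)
      (abs_le.2 ⟨by linarith [hu'.1], by linarith [hu'.2]⟩)
    simp only [logDist]
    rw [this, Complex.ofReal_zero]
  simp only
  rw [integral_const_mul, h3, mul_zero]

/-- The constant value of the potential on the cut `α`. -/
def slope {r : ℕ} (p : (Fin r → ℂ) × ℂ) (α : Fin r) : ℂ := potential p α 1

theorem potential_eq_slope {r : ℕ} (hr : 2 ≤ r) {p : (Fin r → ℂ) × ℂ} (hp : p ∈ periodDomain r)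
    (hτ : p.2 ≠ 0) (α : Fin r) {u : ℝ} (hu : u ∈ Icc (-1 : ℝ) 1) : potential p α u = slope p α :=
  (potential_eq hr hp hτ α hu ⟨by norm_num, le_rfl⟩ hu.2).symm

/-- Integrating the constant potential of the cut `α` against a density `g`. -/
theorem sum_integral_mul_cutKernel {r : ℕ} (hr : 2 ≤ r) {p : (Fin r → ℂ) × ℂ}
    (hp : p ∈ periodDomain r) (hτ : p.2 ≠ 0) (α : Fin r) {g : ℝ → ℂ}
    (hg : ContinuousOn g (Icc (-1) 1)) :
    ∑ β, ∫ y, g y.1 * cutKernel p α β y.1 y.2 ∂arcsine₂ = slope p α * ∫ u, g u ∂arcsine := by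
  have hg2 : ContinuousOn (fun y : ℝ × ℝ => g y.1) (Icc (-1 : ℝ) 1 ×ˢ Icc (-1 : ℝ) 1) :=
    hg.comp continuousOn_fst fun y hy => hy.1
  have hi := fun β => integrable_mul_cutKernel₂ hr hp α β hg2
  rw [← integral_finsetSum _ fun β _ => hi β]
  have hi2 := integrable_finsetSum Finset.univ fun β _ => hi β
  rw [arcsine₂] at hi2 ⊢
  rw [integral_prod _ hi2, ← integral_const_mul]
  refine integral_congr_ae ?_
  filter_upwards [ae_arcsine_mem] with u hu
  rw [← potential_eq_slope hr hp hτ α hu, potential, mul_comm _ (g u), ← integral_const_mul]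
  congr 1
  funext u'
  rw [Finset.mul_sum]

/-- Pairing of the antisymmetric kernel with a function on the cuts. -/
theorem sum_integral_cutKernel_mul_sub {r : ℕ} (hr : 2 ≤ r) {p : (Fin r → ℂ) × ℂ}
    (hp : p ∈ periodDomain r) (hτ : p.2 ≠ 0) {g : Fin r → ℝ → ℂ}
    (hg : ∀ α, ContinuousOn (g α) (Icc (-1) 1)) :
    ∑ α, ∑ β, ∫ y, (g α y.1 - g β y.2) * cutKernel p α β y.1 y.2 ∂arcsine₂ =
      2 * ∑ α, slope p α * ∫ u, g α u ∂arcsine := by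
  have hg1 : ∀ α, ContinuousOn (fun y : ℝ × ℝ => g α y.1) (Icc (-1 : ℝ) 1 ×ˢ Icc (-1 : ℝ) 1) :=
    fun α => (hg α).comp continuousOn_fst fun y hy => hy.1
  have hg2 : ∀ α, ContinuousOn (fun y : ℝ × ℝ => g α y.2) (Icc (-1 : ℝ) 1 ×ˢ Icc (-1 : ℝ) 1) :=
    fun α => (hg α).comp continuousOn_snd fun y hy => hy.2
  -- by antisymmetry the terms with `g β` give the same as the terms with `g α`
  have hswap : ∀ α β, ∫ y, g β y.2 * cutKernel p α β y.1 y.2 ∂arcsine₂ =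
      -∫ y, g β y.1 * cutKernel p β α y.1 y.2 ∂arcsine₂ := by
    intro α β
    rw [← integral_arcsine₂_swap, ← integral_neg]
    refine integral_congr_ae ?_
    filter_upwards [ae_arcsine₂_mem] with y hy
    simp only [Prod.fst_swap, Prod.snd_swap]
    rw [cutKernel_swap hr hp hτ α β hy.2 hy.1]
    ring
  have hsplit : ∀ α β, ∫ y, (g α y.1 - g β y.2) * cutKernel p α β y.1 y.2 ∂arcsine₂ =
      ∫ y, g α y.1 * cutKernel p α β y.1 y.2 ∂arcsine₂ +
        ∫ y, g β y.1 * cutKernel p β α y.1 y.2 ∂arcsine₂ := by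
    intro α β
    rw [← neg_neg (∫ y, g β y.1 * cutKernel p β α y.1 y.2 ∂arcsine₂), ← hswap, ← sub_eq_add_neg,
      ← integral_sub (integrable_mul_cutKernel₂ hr hp α β (hg1 α))
        (integrable_mul_cutKernel₂ hr hp α β (hg2 β))]
    simp only [sub_mul]
  simp only [hsplit, Finset.sum_add_distrib]
  rw [Finset.sum_comm (f := fun α β => ∫ y, g β y.1 * cutKernel p β α y.1 y.2 ∂arcsine₂)]
  simp only [sum_integral_mul_cutKernel hr hp hτ _ (hg _)]
  ring

/-! ### The energy and its derivative -/

/-- The renormalized energy of the equilibrium measures on the cuts. -/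
def energy {r : ℕ} (p : (Fin r → ℂ) × ℂ) : ℂ :=
  ∫ y, energyDensity (cutVec (p, (y.1 : ℂ))) (cutVec (p, (y.2 : ℂ))) (logDist y.1 y.2) ∂arcsine₂

/-- The sum over the cuts of the averages of `x²`. -/
def secondMoment {r : ℕ} (p : (Fin r → ℂ) × ℂ) : ℂ :=
  ∑ α, ∫ u : ℝ, cutPoint α (p, (u : ℂ)) ^ 2 ∂arcsine

theorem integral_cutPoint_sub_sq {r : ℕ} (hr : 2 ≤ r) {p : (Fin r → ℂ) × ℂ}
    (hp : p ∈ periodDomain r) (α β : Fin r) :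
    ∫ y : ℝ × ℝ, (cutPoint α (p, (y.1 : ℂ)) - cutPoint β (p, (y.2 : ℂ))) ^ 2 ∂arcsine₂ =
      ∫ u : ℝ, cutPoint α (p, (u : ℂ)) ^ 2 ∂arcsine - 2 * (p.1 α * p.1 β) +
        ∫ u : ℝ, cutPoint β (p, (u : ℂ)) ^ 2 ∂arcsine := by
  have hc := continuousOn_cutPoint hr hp
  have c1 := fun γ => (hc γ).comp (s := Icc (-1 : ℝ) 1 ×ˢ Icc (-1 : ℝ) 1) continuousOn_fst
    fun y hy => hy.1
  have c2 := fun γ => (hc γ).comp (s := Icc (-1 : ℝ) 1 ×ˢ Icc (-1 : ℝ) 1) continuousOn_snd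
    fun y hy => hy.2
  have i1 : Integrable (fun y : ℝ × ℝ => cutPoint α (p, (y.1 : ℂ)) ^ 2) arcsine₂ :=
    integrable_arcsine₂ ((c1 α).pow 2)
  have i2 : Integrable (fun y : ℝ × ℝ => cutPoint β (p, (y.2 : ℂ)) ^ 2) arcsine₂ :=
    integrable_arcsine₂ ((c2 β).pow 2)
  have i3 : Integrable (fun y : ℝ × ℝ => cutPoint α (p, (y.1 : ℂ)) * cutPoint β (p, (y.2 : ℂ)))
      arcsine₂ := integrable_arcsine₂ ((c1 α).mul (c2 β))
  have e : (fun y : ℝ × ℝ => (cutPoint α (p, (y.1 : ℂ)) - cutPoint β (p, (y.2 : ℂ))) ^ 2) =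
      fun y : ℝ × ℝ => cutPoint α (p, (y.1 : ℂ)) ^ 2 -
        2 * (cutPoint α (p, (y.1 : ℂ)) * cutPoint β (p, (y.2 : ℂ))) +
        cutPoint β (p, (y.2 : ℂ)) ^ 2 := by
    funext y
    ring
  have i4 : Integrable (fun y : ℝ × ℝ => cutPoint α (p, (y.1 : ℂ)) ^ 2 -
      2 * (cutPoint α (p, (y.1 : ℂ)) * cutPoint β (p, (y.2 : ℂ)))) arcsine₂ :=
    i1.sub (i3.const_mul 2)
  rw [e, integral_add i4 i2, integral_sub i1 (i3.const_mul 2), integral_const_mul]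
  have f1 : ∫ y : ℝ × ℝ, cutPoint α (p, (y.1 : ℂ)) ^ 2 ∂arcsine₂ =
      ∫ u : ℝ, cutPoint α (p, (u : ℂ)) ^ 2 ∂arcsine := by
    have := integral_prod_mul (μ := arcsine) (ν := arcsine)
      (fun u : ℝ => cutPoint α (p, (u : ℂ)) ^ 2) (fun _ => (1 : ℂ))
    simpa [arcsine₂] using this
  have f2 : ∫ y : ℝ × ℝ, cutPoint β (p, (y.2 : ℂ)) ^ 2 ∂arcsine₂ =
      ∫ u : ℝ, cutPoint β (p, (u : ℂ)) ^ 2 ∂arcsine := by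
    have := integral_prod_mul (μ := arcsine) (ν := arcsine) (fun _ => (1 : ℂ))
      (fun u : ℝ => cutPoint β (p, (u : ℂ)) ^ 2)
    simpa [arcsine₂] using this
  have f3 : ∫ y : ℝ × ℝ, cutPoint α (p, (y.1 : ℂ)) * cutPoint β (p, (y.2 : ℂ)) ∂arcsine₂ =
      p.1 α * p.1 β := by
    have := integral_prod_mul (μ := arcsine) (ν := arcsine) (fun u : ℝ => cutPoint α (p, (u : ℂ)))
      (fun u : ℝ => cutPoint β (p, (u : ℂ)))
    rwa [integral_cutPoint hr hp, integral_cutPoint hr hp] at this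
  rw [f1, f2, f3]

/-- Closed formula for the energy in terms of the potentials: Euler's identity for the kernel. -/
theorem energy_eq {r : ℕ} (hr : 2 ≤ r) {p : (Fin r → ℂ) × ℂ} (hp : p ∈ periodDomain r)
    (hτ : p.2 ≠ 0) : energy p = -∑ α, p.1 α * slope p α +
      1 / 2 * (r * secondMoment p - (∑ α, p.1 α) ^ 2) := by
  have hc := continuousOn_cutPoint_sub hr hp
  have i1 : ∀ α β, Integrable (fun y : ℝ × ℝ =>
      (cutPoint α (p, (y.1 : ℂ)) - cutPoint β (p, (y.2 : ℂ))) * cutKernel p α β y.1 y.2) arcsine₂ :=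
    fun α β => integrable_mul_cutKernel₂ hr hp α β (hc α β)
  have i2 : ∀ α β, Integrable (fun y : ℝ × ℝ =>
      (cutPoint α (p, (y.1 : ℂ)) - cutPoint β (p, (y.2 : ℂ))) ^ 2) arcsine₂ :=
    fun α β => integrable_arcsine₂ ((hc α β).pow 2)
  have e : energy p = ∫ y : ℝ × ℝ, ∑ α, ∑ β, (-(1 / 2) *
      ((cutPoint α (p, (y.1 : ℂ)) - cutPoint β (p, (y.2 : ℂ))) * cutKernel p α β y.1 y.2) +
      1 / 4 * (cutPoint α (p, (y.1 : ℂ)) - cutPoint β (p, (y.2 : ℂ))) ^ 2) ∂arcsine₂ := rfl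
  have i3 : ∀ α β, Integrable (fun y : ℝ × ℝ => -(1 / 2) *
      ((cutPoint α (p, (y.1 : ℂ)) - cutPoint β (p, (y.2 : ℂ))) * cutKernel p α β y.1 y.2) +
      1 / 4 * (cutPoint α (p, (y.1 : ℂ)) - cutPoint β (p, (y.2 : ℂ))) ^ 2) arcsine₂ :=
    fun α β => ((i1 α β).const_mul (-(1 / 2))).add ((i2 α β).const_mul (1 / 4))
  rw [e, integral_finsetSum _ fun α _ => integrable_finsetSum _ fun β _ => i3 α β]
  have e2 : ∀ α, ∫ y : ℝ × ℝ, ∑ β, (-(1 / 2) *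
      ((cutPoint α (p, (y.1 : ℂ)) - cutPoint β (p, (y.2 : ℂ))) * cutKernel p α β y.1 y.2) +
      1 / 4 * (cutPoint α (p, (y.1 : ℂ)) - cutPoint β (p, (y.2 : ℂ))) ^ 2) ∂arcsine₂ =
      ∑ β, (-(1 / 2) * ∫ y : ℝ × ℝ, (cutPoint α (p, (y.1 : ℂ)) - cutPoint β (p, (y.2 : ℂ))) *
        cutKernel p α β y.1 y.2 ∂arcsine₂ +
        1 / 4 * (∫ u : ℝ, cutPoint α (p, (u : ℂ)) ^ 2 ∂arcsine - 2 * (p.1 α * p.1 β) +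
        ∫ u : ℝ, cutPoint β (p, (u : ℂ)) ^ 2 ∂arcsine)) := by
    intro α
    rw [integral_finsetSum _ fun β _ => i3 α β]
    refine Finset.sum_congr rfl fun β _ => ?_
    rw [← integral_cutPoint_sub_sq hr hp, ← integral_const_mul, ← integral_const_mul]
    exact integral_add ((i1 α β).const_mul _) ((i2 α β).const_mul _)
  rw [Finset.sum_congr rfl fun α _ => e2 α]
  simp only [Finset.sum_add_distrib, ← Finset.mul_sum, Finset.sum_sub_distrib]
  -- `t * kernel` with `t = x_α - y_β` pairs the kernel with the coordinate function itself
  rw [sum_integral_cutKernel_mul_sub hr hp hτ (g := fun α u => cutPoint α (p, (u : ℂ)))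
    (fun α => continuousOn_cutPoint hr hp α)]
  simp only [integral_cutPoint hr hp, Finset.sum_const, Finset.card_univ, Fintype.card_fin,
    nsmul_eq_mul, ← Finset.mul_sum, ← Finset.sum_mul, secondMoment]
  simp only [mul_comm (slope p _)]
  ring

/-- The variation of the point `u` of the cut `α` in the direction `v`. -/
def cutVariation {r : ℕ} (p v : (Fin r → ℂ) × ℂ) (α : Fin r) (u : ℝ) : ℂ :=
  fderiv ℂ (cutPoint α) (p, (u : ℂ)) (v, 0)

theorem hasDerivAt_comp_line {E H : Type*} [NormedAddCommGroup E] [NormedSpace ℂ E]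
    [NormedAddCommGroup H] [NormedSpace ℂ H] {f : E × H → ℂ} {p : E} {h : H}
    (hf : DifferentiableAt ℂ f (p, h)) (v : E) :
    HasDerivAt (fun t : ℂ => f (p + t • v, h)) (fderiv ℂ f (p, h) (v, 0)) 0 := by
  have h2 : HasDerivAt (fun t : ℂ => (p + t • v, h)) (v, (0 : H)) 0 := by
    have h3 : HasDerivAt (fun t : ℂ => p + t • v) v 0 := by
      simpa using ((hasDerivAt_id (0 : ℂ)).smul_const v).const_add p
    exact h3.prodMk (hasDerivAt_const _ h)
  have h1 : HasFDerivAt f (fderiv ℂ f (p, h)) (p + (0 : ℂ) • v, h) := by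
    simpa using hf.hasFDerivAt
  exact h1.comp_hasDerivAt (0 : ℂ) h2

theorem hasDerivAt_cutPoint_line {r : ℕ} (hr : 2 ≤ r) {p : (Fin r → ℂ) × ℂ}
    (hp : p ∈ periodDomain r) (v : (Fin r → ℂ) × ℂ) (α : Fin r) {u : ℝ}
    (hu : u ∈ Icc (-1 : ℝ) 1) :
    HasDerivAt (fun t : ℂ => cutPoint α (p + t • v, (u : ℂ))) (cutVariation p v α u) 0 :=
  hasDerivAt_comp_line ((contDiffAt_cutPoint hr hp hu α).differentiableAt one_ne_zero) v

theorem continuousOn_cutVariation {r : ℕ} (hr : 2 ≤ r) {p : (Fin r → ℂ) × ℂ}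
    (hp : p ∈ periodDomain r) (v : (Fin r → ℂ) × ℂ) (α : Fin r) :
    ContinuousOn (cutVariation p v α) (Icc (-1) 1) := by
  intro u hu
  have h1 := (contDiffAt_cutPoint hr hp hu α).continuousAt_fderiv one_ne_zero
  have h2 : ContinuousAt (fun u : ℝ => fderiv ℂ (cutPoint α) (p, (u : ℂ))) u :=
    ContinuousAt.comp (g := fderiv ℂ (cutPoint α)) (f := fun u : ℝ => (p, (u : ℂ))) h1
      (by fun_prop)
  exact (h2.clm_apply continuousAt_const).continuousWithinAt

theorem integral_cutVariation {r : ℕ} (hr : 2 ≤ r) {p : (Fin r → ℂ) × ℂ}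
    (hp : p ∈ periodDomain r) (v : (Fin r → ℂ) × ℂ) (α : Fin r) :
    ∫ u, cutVariation p v α u ∂arcsine = v.1 α := by
  obtain ⟨-, h1, h2⟩ := contDiffAt_integral_arcsine (isOpen_periodDomain hr) (ξ := cutPoint α)
    (fun q hq u hu => contDiffAt_cutPoint hr hq hu α) hp
  have h3 : (fun p => ∫ u : ℝ, cutPoint α (p, (u : ℂ)) ∂arcsine) =ᶠ[𝓝 p]
      fun p => (ContinuousLinearMap.proj (R := ℂ) (φ := fun _ : Fin r => ℂ) α ∘L
        ContinuousLinearMap.fst ℂ (Fin r → ℂ) ℂ) p := by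
    filter_upwards [(isOpen_periodDomain hr).mem_nhds hp] with q hq
    exact integral_cutPoint hr hq α
  have h4 := (h2.congr_of_eventuallyEq h3.symm).unique (ContinuousLinearMap.hasFDerivAt _)
  have h5 := congrArg (fun L => L v) h4
  rw [ContinuousLinearMap.integral_apply h1] at h5
  exact h5

/-- The logarithmic derivative of `∏_γ (x_α - y_γ) = 2τ(u - u')` in the direction `v`. -/
theorem sub_mul_sum_cutVariation {r : ℕ} (hr : 2 ≤ r) {p : (Fin r → ℂ) × ℂ}
    (hp : p ∈ periodDomain r) (hτ : p.2 ≠ 0) (v : (Fin r → ℂ) × ℂ) (α : Fin r) {u u' : ℝ}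
    (hu : u ∈ Icc (-1 : ℝ) 1) (hu' : u' ∈ Icc (-1 : ℝ) 1) :
    (cutPoint α (p, (u : ℂ)) - cutPoint α (p, (u' : ℂ))) * ∑ γ ∈ Finset.univ.erase α,
      (cutVariation p v α u - cutVariation p v γ u') /
        (cutPoint α (p, (u : ℂ)) - cutPoint γ (p, (u' : ℂ))) =
      (cutPoint α (p, (u : ℂ)) - cutPoint α (p, (u' : ℂ))) * (v.2 / p.2) -
        (cutVariation p v α u - cutVariation p v α u') := by
  rcases eq_or_ne u u' with rfl | hne
  · simp
  have hne' : (u : ℂ) - u' ≠ 0 := sub_ne_zero.2 (by exact_mod_cast hne)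
  have hf : ∀ γ, HasDerivAt
      (fun t : ℂ => cutPoint α (p + t • v, (u : ℂ)) - cutPoint γ (p + t • v, (u' : ℂ)))
      (cutVariation p v α u - cutVariation p v γ u') 0 := fun γ =>
    (hasDerivAt_cutPoint_line hr hp v α hu).sub (hasDerivAt_cutPoint_line hr hp v γ hu')
  have hg : HasDerivAt (fun t : ℂ => 2 * (p.2 + t * v.2) * ((u : ℂ) - u'))
      (2 * v.2 * ((u : ℂ) - u')) 0 := by
    have := ((((hasDerivAt_id (0 : ℂ)).mul_const v.2).const_add p.2).const_mul 2).mul_const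
      ((u : ℂ) - u')
    simpa using this
  have hcont : ContinuousAt (fun t : ℂ => p + t • v) 0 := by fun_prop
  have hmem : ∀ᶠ t : ℂ in 𝓝 0, p + t • v ∈ periodDomain r := by
    refine hcont.eventually_mem ((isOpen_periodDomain hr).mem_nhds ?_)
    simpa using hp
  have hev : (fun t : ℂ => ∏ γ, (cutPoint α (p + t • v, (u : ℂ)) -
      cutPoint γ (p + t • v, (u' : ℂ)))) =ᶠ[𝓝 0]
      fun t : ℂ => 2 * (p.2 + t * v.2) * ((u : ℂ) - u') := by
    filter_upwards [hmem] with t ht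
    rw [prod_sub_cutPoint hr ht hu hu' α]
    rfl
  have hkey := sum_div_eq_of_hasDerivAt_prod hf hg hev (by
    simpa using mul_ne_zero hτ hne')
  have hx0 := cutPoint_ne_of_ne hr hp hτ α hu hu' hne
  simp only [zero_smul, zero_mul, add_zero] at hkey
  rw [← Finset.add_sum_erase _ _ (Finset.mem_univ α)] at hkey
  have h3 : 2 * v.2 * ((u : ℂ) - u') / (2 * p.2 * ((u : ℂ) - u')) = v.2 / p.2 := by
    field_simp
  rw [h3] at hkey
  rw [← hkey]
  field_simp
  ring

/-- The part of the energy density without `log |2u - 2u'|`. -/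
def regularDensity {r : ℕ} (q : ((Fin r → ℂ) × ℂ) × (ℂ × ℂ)) : ℂ :=
  energyDensity (cutVec (q.1, q.2.1)) (cutVec (q.1, q.2.2)) 0

/-- The coefficient of `log |2u - 2u'|` in the energy density. -/
def logCoeff {r : ℕ} (q : ((Fin r → ℂ) × ℂ) × (ℂ × ℂ)) : ℂ :=
  -(1 / 2) * ∑ α, (cutVec (q.1, q.2.1) α - cutVec (q.1, q.2.2) α) ^ 2

theorem contDiffAt_regularDensity {r : ℕ} (hr : 2 ≤ r) {p : (Fin r → ℂ) × ℂ}
    (hp : p ∈ periodDomain r) {y : ℝ × ℝ} (hy : y ∈ Icc (-1 : ℝ) 1 ×ˢ Icc (-1 : ℝ) 1) :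
    ContDiffAt ℂ 1 (regularDensity (r := r)) (p, ofRealPair y) :=
  contDiffAt_comp_cutVec₂ hr hp
    (Ψ := fun q : (Fin r → ℂ) × (Fin r → ℂ) => energyDensity q.1 q.2 0)
    (fun _ _ h => h.contDiffAt_energyDensity 0) hy

theorem contDiffAt_logCoeff {r : ℕ} (hr : 2 ≤ r) {p : (Fin r → ℂ) × ℂ}
    (hp : p ∈ periodDomain r) {y : ℝ × ℝ} (hy : y ∈ Icc (-1 : ℝ) 1 ×ˢ Icc (-1 : ℝ) 1) :
    ContDiffAt ℂ 1 (logCoeff (r := r)) (p, ofRealPair y) :=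
  contDiffAt_comp_cutVec₂ hr hp
    (Ψ := fun q : (Fin r → ℂ) × (Fin r → ℂ) => -(1 / 2) * ∑ α, (q.1 α - q.2 α) ^ 2)
    (fun _ _ _ => by fun_prop) hy

theorem energyDensity_cutVec {r : ℕ} (p : (Fin r → ℂ) × ℂ) (y : ℝ × ℝ) (ℓ : ℂ) :
    energyDensity (cutVec (p, (y.1 : ℂ))) (cutVec (p, (y.2 : ℂ))) ℓ =
      regularDensity (p, ofRealPair y) + ℓ * logCoeff (p, ofRealPair y) :=
  energyDensity_eq_add _ _ _

/-- The derivative of the energy: by the constancy of the potentials on the cuts, the variation of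
the cuts enters only through its averages. -/
theorem hasFDerivAt_energy {r : ℕ} (hr : 2 ≤ r) {p : (Fin r → ℂ) × ℂ} (hp : p ∈ periodDomain r) :
    ∃ L : (Fin r → ℂ) × ℂ →L[ℂ] ℂ, HasFDerivAt energy L p ∧ (p.2 ≠ 0 → ∀ v,
      L v = -2 * ∑ α, slope p α * v.1 α + v.2 / p.2 * (secondMoment p - ∑ α, p.1 α ^ 2)) := by
  -- the regular part and the coefficient of the integrable weight `log |2u - 2u'|` are
  -- differentiated separately under the integral
  have A0 := (hasFDerivAt_integral_smul isCompact_square measurableSet_square ae_arcsine₂_mem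
    (integrable_const (1 : ℝ)) continuous_ofRealPair (isOpen_periodDomain hr)
    (ξ := regularDensity (r := r)) fun q hq y hy => contDiffAt_regularDensity hr hq hy).2
  have A1 := (hasFDerivAt_integral_smul isCompact_square measurableSet_square ae_arcsine₂_mem
    integrable_logDist₂ continuous_ofRealPair (isOpen_periodDomain hr)
    (ξ := logCoeff (r := r)) fun q hq y hy => contDiffAt_logCoeff hr hq hy).2
  have hsum : energy =ᶠ[𝓝 p] fun p =>
      (∫ y, (1 : ℝ) • regularDensity (p, ofRealPair y) ∂arcsine₂) +
        ∫ y, logDist y.1 y.2 • logCoeff (p, ofRealPair y) ∂arcsine₂ := by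
    filter_upwards [(isOpen_periodDomain hr).mem_nhds hp] with q hq
    have i0 : Integrable (fun y : ℝ × ℝ => (1 : ℝ) • regularDensity (q, ofRealPair y)) arcsine₂ := by
      refine integrable_smul_of_continuousOn isCompact_square measurableSet_square ae_arcsine₂_mem
        (integrable_const (1 : ℝ)) ?_
      exact continuousOn_comp_cutVec₂ hr hq
        (Ψ := fun q : (Fin r → ℂ) × (Fin r → ℂ) => energyDensity q.1 q.2 0)
        (fun _ _ h => h.contDiffAt_energyDensity 0)
    have i1 : Integrable (fun y : ℝ × ℝ => logDist y.1 y.2 • logCoeff (q, ofRealPair y))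
        arcsine₂ := by
      refine integrable_smul_of_continuousOn isCompact_square measurableSet_square ae_arcsine₂_mem
        integrable_logDist₂ ?_
      exact continuousOn_comp_cutVec₂ hr hq
        (Ψ := fun q : (Fin r → ℂ) × (Fin r → ℂ) => -(1 / 2) * ∑ α, (q.1 α - q.2 α) ^ 2)
        (fun _ _ _ => by fun_prop)
    rw [← integral_add i0 i1, energy]
    congr 1
    funext y
    rw [energyDensity_cutVec, one_smul, Complex.real_smul]
  obtain ⟨I0, D0⟩ := A0 p hp
  obtain ⟨I1, D1⟩ := A1 p hp
  refine ⟨_, (D0.add D1).congr_of_eventuallyEq hsum, fun hτ v => ?_⟩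
  have J0 := I0.apply_continuousLinearMap v
  have J1 := I1.apply_continuousLinearMap v
  rw [add_apply, ContinuousLinearMap.integral_apply I0,
    ContinuousLinearMap.integral_apply I1, ← integral_add J0 J1]
  have hk : ∀ α β, Integrable (fun y : ℝ × ℝ => (cutVariation p v α y.1 - cutVariation p v β y.2) *
      cutKernel p α β y.1 y.2) arcsine₂ := fun α β => integrable_mul_cutKernel₂ hr hp α β
    (((continuousOn_cutVariation hr hp v α).comp continuousOn_fst fun y hy => hy.1).sub
      ((continuousOn_cutVariation hr hp v β).comp continuousOn_snd fun y hy => hy.2))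
  have hq : ∀ α, Integrable (fun y : ℝ × ℝ =>
      (cutPoint α (p, (y.1 : ℂ)) - cutPoint α (p, (y.2 : ℂ))) ^ 2) arcsine₂ := fun α =>
    integrable_arcsine₂ ((continuousOn_cutPoint_sub hr hp α α).pow 2)
  -- pointwise, the two derivatives combine to the derivative of the energy density
  have hpt : ∀ᵐ y ∂arcsine₂,
      ((1 : ℝ) • (fderiv ℂ regularDensity (p, ofRealPair y) ∘L .inl ℂ _ _)) v +
        (logDist y.1 y.2 • (fderiv ℂ logCoeff (p, ofRealPair y) ∘L .inl ℂ _ _)) v =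
      -(∑ α, ∑ β, (cutVariation p v α y.1 - cutVariation p v β y.2) * cutKernel p α β y.1 y.2) +
        1 / 2 * (v.2 / p.2) *
          ∑ α, (cutPoint α (p, (y.1 : ℂ)) - cutPoint α (p, (y.2 : ℂ))) ^ 2 := by
    filter_upwards [ae_arcsine₂_mem] with y hy
    have h0 := hasDerivAt_comp_line
      ((contDiffAt_regularDensity hr hp hy).differentiableAt one_ne_zero) v
    have h1 := hasDerivAt_comp_line
      ((contDiffAt_logCoeff hr hp hy).differentiableAt one_ne_zero) v
    have h2 := h0.fun_add (h1.const_mul (logDist y.1 y.2 : ℂ))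
    have hp0 : p + (0 : ℂ) • v = p := by simp
    have h3 := hasDerivAt_energyDensity (x := fun t : ℂ => cutVec (p + t • v, (y.1 : ℂ)))
      (y := fun t : ℂ => cutVec (p + t • v, (y.2 : ℂ))) (t := 0) (c := v.2 / p.2)
      (logDist y.1 y.2 : ℂ)
      (by simpa only [hp0] using separated_cutVec hr hp hy.1 hy.2)
      (fun α => hasDerivAt_cutPoint_line hr hp v α hy.1)
      (fun α => hasDerivAt_cutPoint_line hr hp v α hy.2)
      (fun α => by
        simpa only [hp0, cutVec] using sub_mul_sum_cutVariation hr hp hτ v α hy.1 hy.2)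
    simp only [energyDensity_cutVec] at h3
    have h4 := h2.unique h3
    simp only [hp0, Finset.sum_neg_distrib] at h4
    refine Eq.trans ?_ (h4.trans ?_)
    · simp [Complex.real_smul]
    · congr 2
      refine Finset.sum_congr rfl fun α _ => Finset.sum_congr rfl fun β _ => ?_
      rw [mul_comm]
      rfl
  rw [integral_congr_ae hpt]
  have hk2 : Integrable (fun y : ℝ × ℝ => ∑ α, ∑ β,
      (cutVariation p v α y.1 - cutVariation p v β y.2) * cutKernel p α β y.1 y.2) arcsine₂ :=
    integrable_finsetSum _ fun α _ => integrable_finsetSum _ fun β _ => hk α β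
  have hq2 : Integrable (fun y : ℝ × ℝ => ∑ α,
      (cutPoint α (p, (y.1 : ℂ)) - cutPoint α (p, (y.2 : ℂ))) ^ 2) arcsine₂ :=
    integrable_finsetSum _ fun α _ => hq α
  have hk3 : Integrable (fun y : ℝ × ℝ => -∑ α, ∑ β,
      (cutVariation p v α y.1 - cutVariation p v β y.2) * cutKernel p α β y.1 y.2) arcsine₂ := hk2.neg
  rw [integral_add hk3 (hq2.const_mul _), integral_neg, integral_const_mul,
    integral_finsetSum _ fun α _ => integrable_finsetSum _ fun β _ => hk α β,
    integral_finsetSum _ fun α _ => hq α]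
  -- the antisymmetric pairing leaves only the averages of the variation, which are `v.1 α`
  rw [Finset.sum_congr rfl fun α _ => integral_finsetSum Finset.univ fun β _ => hk α β,
    sum_integral_cutKernel_mul_sub hr hp hτ fun α => continuousOn_cutVariation hr hp v α]
  simp only [integral_cutVariation hr hp, integral_cutPoint_sub_sq hr hp]
  have h5 : ∑ α, (∫ u : ℝ, cutPoint α (p, (u : ℂ)) ^ 2 ∂arcsine - 2 * (p.1 α * p.1 α) +
      ∫ u : ℝ, cutPoint α (p, (u : ℂ)) ^ 2 ∂arcsine) =
      2 * (secondMoment p - ∑ α, p.1 α ^ 2) := by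
    rw [secondMoment, ← Finset.sum_sub_distrib, Finset.mul_sum]
    refine Finset.sum_congr rfl fun α _ => ?_
    ring
  rw [h5]
  ring

theorem integral_arcsine₂_neg (f : ℝ × ℝ → ℂ) :
    ∫ y, f (-y) ∂arcsine₂ = ∫ y, f y ∂arcsine₂ := by
  exact (measurePreserving_neg_arcsine.prod measurePreserving_neg_arcsine).integral_comp
    (Homeomorph.neg (ℝ × ℝ)).measurableEmbedding f

/-- The energy is an even function of `τ`. -/
theorem energy_neg {r : ℕ} (hr : 2 ≤ r) {b : Fin r → ℂ} {τ : ℂ} (hp : (b, τ) ∈ periodDomain r) :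
    energy (b, -τ) = energy (b, τ) := by
  rw [energy, energy, ← integral_arcsine₂_neg]
  congr 1
  funext y
  -- the substitution `u ↦ -u` compensates `τ ↦ -τ` and preserves the arcsine law
  have h : ∀ u : ℝ, cutVec ((b, -τ), ((-u : ℝ) : ℂ)) = cutVec ((b, τ), (u : ℂ)) := by
    intro u
    funext α
    rw [cutVec, cutVec, cutPoint_neg hr hp, Complex.ofReal_neg, neg_neg]
  have h2 : logDist (-y.1) (-y.2) = logDist y.1 y.2 := by
    rw [logDist, logDist, ← abs_neg]
    congr 2
    ring
  simp only [Prod.fst_neg, Prod.snd_neg, h, h2]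

/-- The energy for collapsed cuts. -/
theorem energy_zero {r : ℕ} (hr : 2 ≤ r) {b : Fin r → ℂ} (hb : 0 < orderGap b) :
    energy (b, 0) = ∑ α, ∑ β ∈ Finset.univ.erase α,
      (-(1 / 2) * ((b α - b β) ^ 2 * orderedLog α β (b α - b β)) + 3 / 4 * (b α - b β) ^ 2) := by
  have h : ∀ u : ℝ, cutVec ((b, 0), (u : ℂ)) = b := fun u =>
    funext fun α => cutPoint_zero hr hb α u
  -- the diagonal terms vanish, whatever the value of the logarithm
  have h2 : ∀ ℓ : ℂ, energyDensity b b ℓ = ∑ α, ∑ β ∈ Finset.univ.erase α,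
      (-(1 / 2) * ((b α - b β) ^ 2 * orderedLog α β (b α - b β)) + 3 / 4 * (b α - b β) ^ 2) := by
    intro ℓ
    rw [energyDensity]
    refine Finset.sum_congr rfl fun α _ => ?_
    rw [← Finset.add_sum_erase _ _ (Finset.mem_univ α)]
    simp only [sub_self, zero_mul, mul_zero, add_zero, ne_eq, OfNat.ofNat_ne_zero,
      not_false_eq_true, zero_pow, zero_add]
    refine Finset.sum_congr rfl fun β hβ => ?_
    rw [kernel, kernelLog, if_neg (Finset.ne_of_mem_erase hβ).symm]
    ring
  rw [energy]
  simp only [h, h2]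
  rw [integral_const, probReal_univ, one_smul]

/-! ### A prepotential from the energy -/

/-- The renormalized energy of the cuts as a function of `a` and `l = log Λ`. -/
def energyPrepotential {r : ℕ} (p : (Fin r → ℂ) × ℂ) : ℂ :=
  energy (Complex.I • p.1, Complex.exp (r * p.2)) - r * p.2 * ∑ α, p.1 α ^ 2

/-- The bound for `|Λ|` under which the cuts are defined. -/
def cutBound {r : ℕ} (a : Fin r → ℂ) : ℝ := orderGap (Complex.I • a) / 16

theorem orderGap_pos_of_mem_chamber {r : ℕ} (hr : 2 ≤ r) {a : Fin r → ℂ} (ha : a ∈ chamber r) :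
    0 < orderGap (Complex.I • a) := by
  refine lt_orderGap hr fun α β h => ?_
  have := ha.2 α β h
  simp only [Pi.smul_apply, smul_eq_mul, Complex.sub_re]
  linarith

theorem isBound_cutBound {r : ℕ} (hr : 2 ≤ r) : IsBound r (cutBound (r := r)) := by
  refine ⟨?_, fun a ha => by
    have := orderGap_pos_of_mem_chamber hr ha
    rw [cutBound]
    positivity⟩
  unfold cutBound
  exact (((continuous_orderGap hr).comp (continuous_const_smul Complex.I)).div_const
    16).continuousOn

theorem norm_exp_nat_mul (r : ℕ) (l : ℂ) : ‖Complex.exp (r * l)‖ = Real.exp l.re ^ r := by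
  rw [Complex.norm_exp, ← Real.exp_nat_mul]
  simp

theorem mem_periodDomain_of_lt {r : ℕ} (hr : 2 ≤ r) {a : Fin r → ℂ} (ha : a ∈ chamber r) {l : ℂ}
    (hl : Real.exp l.re < cutBound a) :
    (Complex.I • a, Complex.exp (r * l)) ∈ periodDomain r := by
  refine ⟨orderGap_pos_of_mem_chamber hr ha, ?_⟩
  rw [norm_exp_nat_mul]
  exact pow_lt_pow_left₀ hl (Real.exp_pos _).le (by omega)

theorem hasFDerivAt_energyPrepotential {r : ℕ} (hr : 2 ≤ r) {a : Fin r → ℂ} (ha : a ∈ chamber r)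
    {l : ℂ} (hl : Real.exp l.re < cutBound a) :
    ∃ L : (Fin r → ℂ) × ℂ →L[ℂ] ℂ, HasFDerivAt energyPrepotential L (a, l) ∧ ∀ v,
      L v = -2 * ∑ α, slope (Complex.I • a, Complex.exp (r * l)) α * (Complex.I * v.1 α) -
        2 * r * l * ∑ α, a α * v.1 α +
        r * v.2 * secondMoment (Complex.I • a, Complex.exp (r * l)) := by
  obtain ⟨L, hL, hLv⟩ := hasFDerivAt_energy hr (mem_periodDomain_of_lt hr ha hl)
  have hdom := mem_periodDomain_of_lt hr ha hl
  have hin : HasFDerivAt (fun p : (Fin r → ℂ) × ℂ => (Complex.I • p.1, Complex.exp (r * p.2)))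
      ((Complex.I • ContinuousLinearMap.fst ℂ (Fin r → ℂ) ℂ).prod
        (Complex.exp (r * l) • ((r : ℂ) • ContinuousLinearMap.snd ℂ (Fin r → ℂ) ℂ))) (a, l) := by
    refine HasFDerivAt.prodMk (hasFDerivAt_fst.const_smul Complex.I) ?_
    exact HasFDerivAt.cexp (f := fun p : (Fin r → ℂ) × ℂ => (r : ℂ) * p.2) (x := (a, l))
      (hasFDerivAt_snd.const_mul (r : ℂ))
  have h1 := HasFDerivAt.comp (a, l) (g := energy)
    (f := fun p : (Fin r → ℂ) × ℂ => (Complex.I • p.1, Complex.exp (r * p.2))) hL hin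
  have hq : HasFDerivAt (fun p : (Fin r → ℂ) × ℂ => (r : ℂ) * p.2)
      ((r : ℂ) • ContinuousLinearMap.snd ℂ (Fin r → ℂ) ℂ) (a, l) :=
    hasFDerivAt_snd.const_mul (r : ℂ)
  have hs : ∀ α : Fin r, HasFDerivAt (fun p : (Fin r → ℂ) × ℂ => p.1 α ^ 2)
      ((2 * a α) • (ContinuousLinearMap.proj (R := ℂ) (φ := fun _ : Fin r => ℂ) α ∘L
        ContinuousLinearMap.fst ℂ (Fin r → ℂ) ℂ)) (a, l) := by
    intro α
    have h0 := (ContinuousLinearMap.proj (R := ℂ) (φ := fun _ : Fin r => ℂ) α ∘L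
        ContinuousLinearMap.fst ℂ (Fin r → ℂ) ℂ).hasFDerivAt (x := (a, l))
    have := h0.pow 2
    simpa using this
  have h2 := hq.fun_mul (HasFDerivAt.fun_sum (u := Finset.univ) fun α _ => hs α)
  refine ⟨_, h1.fun_sub h2, fun v => ?_⟩
  have he : Complex.exp (r * l) ≠ 0 := Complex.exp_ne_zero _
  have h3 : L (Complex.I • v.1, Complex.exp (r * l) * (r * v.2)) =
      -2 * ∑ α, slope (Complex.I • a, Complex.exp (r * l)) α * (Complex.I * v.1 α) +
        r * v.2 * (secondMoment (Complex.I • a, Complex.exp (r * l)) + ∑ α, a α ^ 2) := by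
    rw [hLv he]
    simp only [Pi.smul_apply, smul_eq_mul, mul_pow, Complex.I_sq, neg_one_mul,
      Finset.sum_neg_distrib, sub_neg_eq_add]
    rw [mul_div_cancel_left₀ _ he]
  have h4 : ∑ α, 2 * a α * v.1 α = 2 * ∑ α, a α * v.1 α := by
    simp only [Finset.mul_sum, mul_assoc]
  simp only [sub_apply, ContinuousLinearMap.comp_apply,
    ContinuousLinearMap.prod_apply, smul_apply, ContinuousLinearMap.coe_fst',
    ContinuousLinearMap.coe_snd', add_apply, sum_apply,
    ContinuousLinearMap.proj_apply, smul_eq_mul, h3, h4]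
  ring

theorem partialA_eq_of_hasFDerivAt {r : ℕ} [NeZero r] {F : (Fin r → ℂ) × ℂ → ℂ}
    {p : (Fin r → ℂ) × ℂ} {L : (Fin r → ℂ) × ℂ →L[ℂ] ℂ} (h : HasFDerivAt F L p) (α : Fin r) :
    partialA F α p = L (Pi.single α 1 - Pi.single 0 1, 0) := by
  have h2 : HasDerivAt (fun t : ℂ => (p.1 + t • (Pi.single α 1 - Pi.single 0 1 : Fin r → ℂ), p.2))
      ((Pi.single α 1 - Pi.single 0 1 : Fin r → ℂ), (0 : ℂ)) 0 := by
    have h3 : HasDerivAt (fun t : ℂ => p.1 + t • (Pi.single α 1 - Pi.single 0 1 : Fin r → ℂ))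
        (Pi.single α 1 - Pi.single 0 1) 0 := by
      simpa using ((hasDerivAt_id (0 : ℂ)).smul_const
        (Pi.single α 1 - Pi.single 0 1 : Fin r → ℂ)).const_add p.1
    exact h3.prodMk (hasDerivAt_const _ p.2)
  have h1 : HasFDerivAt F L (p.1 + (0 : ℂ) • (Pi.single α 1 - Pi.single 0 1 : Fin r → ℂ), p.2) := by
    simpa using h
  exact (h1.comp_hasDerivAt (0 : ℂ) h2).deriv

theorem partialLog_eq_of_hasFDerivAt {r : ℕ} {F : (Fin r → ℂ) × ℂ → ℂ}
    {p : (Fin r → ℂ) × ℂ} {L : (Fin r → ℂ) × ℂ →L[ℂ] ℂ} (h : HasFDerivAt F L p) :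
    partialLog F p = L (0, 1) := by
  have h2 : HasDerivAt (fun l : ℂ => (p.1, l)) ((0 : Fin r → ℂ), (1 : ℂ)) p.2 :=
    (hasDerivAt_const _ p.1).prodMk (hasDerivAt_id _)
  exact (h.comp_hasDerivAt p.2 h2).deriv

theorem sum_mul_single_sub_single {r : ℕ} [NeZero r] (f : Fin r → ℂ) (α : Fin r) :
    ∑ β, f β * (Pi.single α 1 - Pi.single 0 1 : Fin r → ℂ) β = f α - f 0 := by
  simp [mul_sub, Finset.sum_sub_distrib, Pi.single_apply]

/-- The derivatives in `a` are the differences of the constant potentials; these are the dual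
periods, see `aDual_eq`. -/
theorem partialA_energyPrepotential {r : ℕ} [NeZero r] (hr : 2 ≤ r) {a : Fin r → ℂ}
    (ha : a ∈ chamber r) {l : ℂ} (hl : Real.exp l.re < cutBound a) (α : Fin r) :
    partialA energyPrepotential α (a, l) =
      -2 * Complex.I * (slope (Complex.I • a, Complex.exp (r * l)) α -
        slope (Complex.I • a, Complex.exp (r * l)) 0) - 2 * r * l * (a α - a 0) := by
  obtain ⟨L, hL, hLv⟩ := hasFDerivAt_energyPrepotential hr ha hl
  rw [partialA_eq_of_hasFDerivAt hL, hLv]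
  have h1 := sum_mul_single_sub_single
    (fun β => slope (Complex.I • a, Complex.exp (r * l)) β * Complex.I) α
  simp only [mul_assoc] at h1
  simp only [h1, sum_mul_single_sub_single]
  ring

theorem partialLog_energyPrepotential {r : ℕ} (hr : 2 ≤ r) {a : Fin r → ℂ}
    (ha : a ∈ chamber r) {l : ℂ} (hl : Real.exp l.re < cutBound a) :
    partialLog energyPrepotential (a, l) =
      r * secondMoment (Complex.I • a, Complex.exp (r * l)) := by
  obtain ⟨L, hL, hLv⟩ := hasFDerivAt_energyPrepotential hr ha hl
  rw [partialLog_eq_of_hasFDerivAt hL, hLv]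
  simp

theorem sum_erase_zero_mul_sub {r : ℕ} [NeZero r] {a : Fin r → ℂ} (ha : ∑ α, a α = 0)
    (f : Fin r → ℂ) : ∑ α ∈ Finset.univ.erase 0, a α * (f α - f 0) = ∑ α, a α * f α := by
  have h : ∑ α, a α * (f α - f 0) = ∑ α, a α * f α := by
    simp only [mul_sub, Finset.sum_sub_distrib, ← Finset.sum_mul, ha, zero_mul, sub_zero]
  rw [← h, ← Finset.add_sum_erase _ _ (Finset.mem_univ (0 : Fin r)), sub_self, mul_zero, zero_add]

/-- Homogeneity: Euler's identity for the energy (`energy_eq`), whose remaining term `secondMoment`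
is the derivative in `log Λ`. -/
theorem euler_energyPrepotential {r : ℕ} [NeZero r] (hr : 2 ≤ r) {p : (Fin r → ℂ) × ℂ}
    (hp : p ∈ domain r cutBound) :
    (∑ α ∈ Finset.univ.erase 0, p.1 α * partialA energyPrepotential α p) +
      partialLog energyPrepotential p = 2 * energyPrepotential p := by
  obtain ⟨a, l⟩ := p
  have ha : a ∈ chamber r := hp.1
  have hl : Real.exp l.re < cutBound a := hp.2
  have h1 := sum_erase_zero_mul_sub ha.1 (slope (Complex.I • a, Complex.exp (r * l)))
  have h2 := sum_erase_zero_mul_sub ha.1 a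
  have h3 : ∑ α ∈ Finset.univ.erase 0, a α * partialA energyPrepotential α (a, l) =
      -2 * Complex.I * ∑ α, a α * slope (Complex.I • a, Complex.exp (r * l)) α -
        2 * r * l * ∑ α, a α * a α := by
    rw [← h1, ← h2, Finset.mul_sum, Finset.mul_sum, ← Finset.sum_sub_distrib]
    refine Finset.sum_congr rfl fun α _ => ?_
    rw [partialA_energyPrepotential hr ha hl]
    ring
  have h4 : ∑ α, Complex.I * a α * slope (Complex.I • a, Complex.exp (r * l)) α =
      Complex.I * ∑ α, a α * slope (Complex.I • a, Complex.exp (r * l)) α := by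
    simp only [Finset.mul_sum, mul_assoc]
  simp only [h3, partialLog_energyPrepotential hr ha hl, energyPrepotential,
    energy_eq hr (mem_periodDomain_of_lt hr ha hl) (Complex.exp_ne_zero _), Pi.smul_apply,
    smul_eq_mul, h4, ← Finset.mul_sum, ha.1, sq]
  ring

/-- The shift of `log Λ` changes the sign of `τ = Λ^r`, which the energy does not see. -/
theorem monodromy_energyPrepotential {r : ℕ} (hr : 2 ≤ r) {a : Fin r → ℂ} (ha : a ∈ chamber r)
    {l : ℂ} (hl : Real.exp l.re < cutBound a) :
    energyPrepotential (a, l + Real.pi * Complex.I / r) - energyPrepotential (a, l) =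
      -(Real.pi * Complex.I * ∑ α, a α ^ 2) := by
  have hr0 : (r : ℂ) ≠ 0 := by exact_mod_cast (by omega : r ≠ 0)
  have h1 : Complex.exp (r * (l + Real.pi * Complex.I / r)) = -Complex.exp (r * l) := by
    rw [mul_add, mul_div_cancel₀ _ hr0, Complex.exp_add, Complex.exp_pi_mul_I]
    ring
  simp only [energyPrepotential, h1, energy_neg hr (mem_periodDomain_of_lt hr ha hl)]
  field_simp
  ring

theorem sum_erase_add_swap {r : ℕ} (f : Fin r → Fin r → ℂ) :
    ∑ α, ∑ β ∈ Finset.univ.erase α, f β α = ∑ α, ∑ β ∈ Finset.univ.erase α, f α β := by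
  refine Finset.sum_comm' fun x y => ?_
  simp [ne_comm]

/-- The perturbative part is the energy of collapsed cuts. -/
theorem pertPart_eq {r : ℕ} (hr : 2 ≤ r) {a : Fin r → ℂ} (ha : a ∈ chamber r) (l : ℂ) :
    pertPart a l = energy (Complex.I • a, 0) - r * l * ∑ α, a α ^ 2 := by
  rw [energy_zero hr (orderGap_pos_of_mem_chamber hr ha)]
  set f : Fin r → Fin r → ℂ := fun α β => gammaZero (a α - a β) l
  set g : Fin r → Fin r → ℂ := fun α β => -(1 / 2) * (((Complex.I • a) α - (Complex.I • a) β) ^ 2 *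
    orderedLog α β ((Complex.I • a) α - (Complex.I • a) β)) +
    3 / 4 * ((Complex.I • a) α - (Complex.I • a) β) ^ 2 - 1 / 2 * l * (a α - a β) ^ 2
  -- the branches agree only after the terms `(α, β)` and `(β, α)` are added
  have hlt : ∀ α β, α < β → f α β + f β α = g α β + g β α := by
    intro α β h
    have h1 : 0 < (Complex.I * (a α - a β)).re := by
      have := ha.2 α β h
      rw [mul_sub, Complex.sub_re]
      linarith
    have h2 := logRatio_branch (a α - a β) 0 h1
    simp only [logRatio, sub_zero, neg_sub] at h2
    simp only [f, g, gammaZero, logRatio, orderedLog, if_pos h, if_neg h.not_gt, Pi.smul_apply,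
      smul_eq_mul, ← mul_sub, ← mul_neg, neg_sub, mul_pow, Complex.I_sq, ← h2]
    ring
  have hne : ∀ α, ∀ β ∈ Finset.univ.erase α, f α β + f β α = g α β + g β α := by
    intro α β hβ
    rcases lt_or_gt_of_ne (Finset.ne_of_mem_erase hβ) with h | h
    · rw [add_comm, hlt β α h, add_comm]
    · exact hlt α β h
  have hfg : ∑ α, ∑ β ∈ Finset.univ.erase α, f α β = ∑ α, ∑ β ∈ Finset.univ.erase α, g α β := by
    have h1 := Finset.sum_congr rfl fun α (_ : α ∈ Finset.univ) => Finset.sum_congr rfl (hne α)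
    simp only [Finset.sum_add_distrib] at h1
    rw [sum_erase_add_swap f, sum_erase_add_swap g] at h1
    linear_combination (1 / 2 : ℂ) * h1
  -- as `∑ a_α = 0`, the sum of `(a_α - a_β)²` over all ordered pairs is `2r ∑ a_α²`
  have hsq : ∑ α, ∑ β ∈ Finset.univ.erase α, (1 / 2 * l * (a α - a β) ^ 2) =
      r * l * ∑ α, a α ^ 2 := by
    have h1 : ∀ α, ∑ β ∈ Finset.univ.erase α, (1 / 2 * l * (a α - a β) ^ 2) =
        ∑ β, (1 / 2 * l * (a α - a β) ^ 2) := by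
      intro α
      rw [← Finset.add_sum_erase _ _ (Finset.mem_univ α)]
      simp
    have h2 : ∀ α β, 1 / 2 * l * (a α - a β) ^ 2 =
        1 / 2 * l * a α ^ 2 - l * (a α * a β) + 1 / 2 * l * a β ^ 2 := by
      intro α β
      ring
    rw [Finset.sum_congr rfl fun α _ => h1 α]
    simp only [h2, Finset.sum_add_distrib, Finset.sum_sub_distrib, ← Finset.mul_sum, ha.1,
      Finset.sum_const, Finset.card_univ, Fintype.card_fin, nsmul_eq_mul, mul_zero]
    ring
  rw [← hsq, pertPart, hfg]
  simp only [g, Finset.sum_sub_distrib]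

/-! ### The periods around the cuts -/

theorem circleIntegral_integral_arcsine {c : ℂ} {R : ℝ} (hR : 0 ≤ R) {f : ℂ × ℝ → ℂ}
    (hf : ContinuousOn f (Metric.sphere c R ×ˢ Icc (-1 : ℝ) 1)) :
    (∮ x in C(c, R), ∫ u, f (x, u) ∂arcsine) = ∫ u, (∮ x in C(c, R), f (x, u)) ∂arcsine := by
  have hpi : (0 : ℝ) ≤ 2 * Real.pi := Real.two_pi_pos.le
  have hμ2 : ∀ᵐ y ∂((volume.restrict (Icc 0 (2 * Real.pi))).prod arcsine),
      y ∈ Icc (0 : ℝ) (2 * Real.pi) ×ˢ Icc (-1 : ℝ) 1 := by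
    rw [Measure.ae_prod_mem_iff_ae_ae_mem (measurableSet_Icc.prod measurableSet_Icc)]
    filter_upwards [ae_restrict_mem measurableSet_Icc] with θ hθ
    filter_upwards [ae_arcsine_mem] with u hu using ⟨hθ, hu⟩
  have hcont : ContinuousOn (fun y : ℝ × ℝ => deriv (circleMap c R) y.1 • f (circleMap c R y.1, y.2))
      (Icc (0 : ℝ) (2 * Real.pi) ×ˢ Icc (-1 : ℝ) 1) := by
    simp only [deriv_circleMap, smul_eq_mul]
    refine ContinuousOn.mul (by fun_prop) (hf.comp (f := fun y : ℝ × ℝ => (circleMap c R y.1, y.2)) ?_ ?_)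
    · fun_prop
    · exact fun y hy => ⟨circleMap_mem_sphere c hR y.1, hy.2⟩
  have hint : Integrable (fun y : ℝ × ℝ =>
      deriv (circleMap c R) y.1 • f (circleMap c R y.1, y.2))
      ((volume.restrict (Icc 0 (2 * Real.pi))).prod arcsine) := by
    simpa using integrable_smul_of_continuousOn (isCompact_Icc.prod isCompact_Icc)
      (measurableSet_Icc.prod measurableSet_Icc) hμ2 (integrable_const (1 : ℝ)) hcont
  simp only [circleIntegral, intervalIntegral.integral_of_le hpi, ← integral_Icc_eq_integral_Ioc,
    ← integral_smul]
  exact integral_integral_swap hint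

/-- The logarithmic derivative of `P - s = ∏_γ (x - x_γ)`. -/
theorem sum_inv_sub_root {r : ℕ} (hr : 2 ≤ r) {z : Fin r → ℂ} {s : ℂ} (h : (z, s) ∈ rootDomain r)
    {x : ℂ} (hx : ∀ γ, x - root z s γ ≠ 0) :
    ∑ γ, 1 / (x - root z s γ) =
      (curvePoly z).derivative.eval x / ((curvePoly z).eval x - s) := by
  have hf : ∀ γ, HasDerivAt (fun x : ℂ => x - root z s γ) 1 x := fun γ =>
    (hasDerivAt_id x).sub_const _
  have hg : HasDerivAt (fun x : ℂ => (curvePoly z).eval x - s) ((curvePoly z).derivative.eval x) x :=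
    ((curvePoly z).hasDerivAt x).sub_const _
  have heq : (fun y => ∏ γ, (y - root z s γ)) =ᶠ[𝓝 x] fun y => (curvePoly z).eval y - s :=
    Eventually.of_forall fun y => prod_sub_root hr h y
  have hne : (curvePoly z).eval x - s ≠ 0 := by
    rw [← prod_sub_root hr h]
    exact Finset.prod_ne_zero_iff.2 fun γ _ => hx γ
  have hkey := sum_div_eq_of_hasDerivAt_prod (𝕜 := ℂ) (f := fun γ (y : ℂ) => y - root z s γ)
    (df := fun _ => 1) hf hg heq hne
  exact hkey

theorem pow_le_norm_eval_of_mem_sphere {r : ℕ} {z : Fin r → ℂ} {α : Fin r} {x : ℂ}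
    (hz : 0 < orderGap z) (hx : x ∈ Metric.sphere (z α) (orderGap z / 2)) :
    (orderGap z / 2) ^ r ≤ ‖(curvePoly z).eval x‖ := by
  have hx' : ‖x - z α‖ = orderGap z / 2 := mem_sphere_iff_norm.1 hx
  have hle : ∀ β, orderGap z / 2 ≤ ‖x - z β‖ := by
    intro β
    rcases eq_or_ne α β with rfl | hne
    · exact hx'.ge
    · have h1 := orderGap_le_norm z hne
      have h2 : ‖z α - z β‖ ≤ ‖x - z β‖ + ‖x - z α‖ := by
        have := norm_sub_le (x - z β) (x - z α)
        rwa [sub_sub_sub_cancel_left] at this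
      linarith
  rw [eval_curvePoly, norm_prod]
  have := Finset.prod_le_prod (s := Finset.univ) (f := fun _ : Fin r => orderGap z / 2)
    (g := fun β => ‖x - z β‖) (fun _ _ => by positivity) fun β _ => hle β
  simpa only [Finset.prod_const, Finset.card_univ, Fintype.card_fin] using this

theorem sub_root_ne_zero_of_mem_sphere {r : ℕ} (hr : 2 ≤ r) {z : Fin r → ℂ} {s : ℂ}
    (h : (z, s) ∈ rootDomain r) {α : Fin r} {x : ℂ}
    (hx : x ∈ Metric.sphere (z α) (orderGap z / 2)) (γ : Fin r) : x - root z s γ ≠ 0 := by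
  have hz : 0 < orderGap z := h.1
  have h1 := pow_le_norm_eval_of_mem_sphere hz hx
  have h3 : 2 * (orderGap z / 8) ^ r < (orderGap z / 2) ^ r := by
    have h4 : (orderGap z / 2) ^ r = 4 ^ r * (orderGap z / 8) ^ r := by
      rw [← mul_pow]
      congr 1
      ring
    have h5 : (4 : ℝ) ^ 2 ≤ 4 ^ r := pow_le_pow_right₀ (by norm_num) hr
    rw [h4]
    have : 0 < (orderGap z / 8) ^ r := by positivity
    nlinarith
  have h2 : ‖s‖ < 2 * (orderGap z / 8) ^ r := h.2
  have h6 : (curvePoly z).eval x - s ≠ 0 := by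
    intro h0
    rw [sub_eq_zero.1 h0] at h1
    linarith
  rw [← prod_sub_root hr h] at h6
  exact Finset.prod_ne_zero_iff.1 h6 γ (Finset.mem_univ γ)

/-- The Stieltjes transform of the arcsine law turns `P' / √(P² - 4Λ^(2r))` into the average of the
logarithmic derivatives of `P - 2τu`. -/
theorem swDiff_eq_integral {r : ℕ} (hr : 2 ≤ r) {z : Fin r → ℂ} {Λ : ℂ} (hΛ : Λ ≠ 0)
    (h : (z, Λ ^ r) ∈ cutDomain r) {α : Fin r} {x : ℂ}
    (hx : x ∈ Metric.sphere (z α) (orderGap z / 2)) :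
    swDiff z Λ x = -(1 / (2 * (Real.pi : ℂ))) *
      ∫ u, ∑ γ, x / (x - root z (2 * Λ ^ r * ((u : ℝ) : ℂ)) γ) ∂arcsine := by
  have hτ : Λ ^ r ≠ 0 := pow_ne_zero _ hΛ
  have hz : 0 < orderGap z := h.1
  have h1 := pow_le_norm_eval_of_mem_sphere hz hx
  set P := (curvePoly z).eval x with hP
  -- on the circle `|P / τ| > 2`, the region where the Stieltjes transform is known
  have hPτ : 2 < ‖P / Λ ^ r‖ := by
    have h2 : ‖Λ ^ r‖ < (orderGap z / 8) ^ r := h.2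
    have h4 : (orderGap z / 2) ^ r = 4 ^ r * (orderGap z / 8) ^ r := by
      rw [← mul_pow]
      congr 1
      ring
    have h5 : (4 : ℝ) ^ 2 ≤ 4 ^ r := pow_le_pow_right₀ (by norm_num) hr
    have : 0 < ‖Λ ^ r‖ := norm_pos_iff.2 hτ
    rw [norm_div, lt_div_iff₀ this]
    nlinarith
  have hP0 : P ≠ 0 := by
    intro h0
    rw [h0] at hPτ
    simp at hPτ
    linarith
  have hsum : ∀ᵐ u ∂arcsine, ∑ γ, x / (x - root z (2 * Λ ^ r * ((u : ℝ) : ℂ)) γ) =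
      x * (curvePoly z).derivative.eval x / Λ ^ r * (P / Λ ^ r - 2 * (u : ℂ))⁻¹ := by
    filter_upwards [ae_arcsine_mem] with u hu
    have hmem := mem_rootDomain_of_cutDomain h hu
    have h2 := sum_inv_sub_root hr hmem (sub_root_ne_zero_of_mem_sphere hr hmem hx)
    have h3 : P / Λ ^ r - 2 * (u : ℂ) = (P - 2 * Λ ^ r * u) / Λ ^ r := by
      field_simp
    have h4 : ∀ γ, x / (x - root z (2 * Λ ^ r * ((u : ℝ) : ℂ)) γ) =
        x * (1 / (x - root z (2 * Λ ^ r * ((u : ℝ) : ℂ)) γ)) := fun γ => by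
      rw [mul_one_div]
    simp only [h4]
    rw [← Finset.mul_sum]
    simp only at h2
    rw [h2, h3, inv_div]
    field_simp
    rfl
  rw [integral_congr_ae hsum, integral_const_mul, integral_inv_arcsine hPτ, swDiff]
  have h5 : 4 / (P / Λ ^ r) ^ 2 = 4 * Λ ^ (2 * r) / P ^ 2 := by
    rw [pow_mul' Λ 2 r]
    field_simp
  rw [h5, ← hP, mul_inv, inv_div]
  generalize (1 - 4 * Λ ^ (2 * r) / P ^ 2) ^ (1 / 2 : ℂ) = R
  rw [div_eq_mul_inv, mul_inv]
  field_simp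

/-- Cauchy's formula: the circle around `z_α` encloses the root near `z_α` and no other. -/
theorem circleIntegral_div_sub_root {r : ℕ} (hr : 2 ≤ r) {z : Fin r → ℂ} {s : ℂ}
    (h : (z, s) ∈ rootDomain r) (α γ : Fin r) :
    (∮ x in C(z α, orderGap z / 2), x / (x - root z s γ)) =
      if γ = α then 2 * Real.pi * Complex.I * root z s γ else 0 := by
  have hz : 0 < orderGap z := h.1
  have h1 : ‖root z s γ - z γ‖ ≤ orderGap z / 16 := by
    rw [root, add_sub_cancel_left]
    exact norm_rootShift_le hr h γ
  split_ifs with hγ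
  · subst hγ
    refine Complex.circleIntegral_div_sub_of_differentiable_on_off_countable (f := fun x => x)
      countable_empty ?_ continuousOn_id fun x _ => differentiableAt_id
    rw [mem_ball_iff_norm]
    linarith
  · have hne : ∀ x ∈ Metric.closedBall (z α) (orderGap z / 2), x - root z s γ ≠ 0 := by
      intro x hx h0
      rw [mem_closedBall_iff_norm] at hx
      have h2 := orderGap_le_norm z hγ
      have h3 : ‖z γ - z α‖ ≤ ‖root z s γ - z α‖ + ‖root z s γ - z γ‖ := by
        have := norm_sub_le (root z s γ - z α) (root z s γ - z γ)
        rwa [sub_sub_sub_cancel_left] at this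
      rw [← sub_eq_zero.1 h0] at h3 h1
      linarith
    refine Complex.circleIntegral_eq_zero_of_differentiable_on_off_countable (by positivity)
      countable_empty ?_ fun x hx => ?_
    · exact continuousOn_id.div (continuousOn_id.sub continuousOn_const) hne
    · exact differentiableAt_id.div (differentiableAt_id.sub_const _)
        (hne x (Metric.ball_subset_closedBall hx.1))

/-- The period around a cut is the average of `-i x` over the cut. -/
theorem aPeriod_eq {r : ℕ} (hr : 2 ≤ r) {z : Fin r → ℂ} {Λ : ℂ} (hΛ : Λ ≠ 0)
    (hgap : rootGap z = orderGap z) (h : (z, Λ ^ r) ∈ cutDomain r) :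
    aPeriod z Λ = -Complex.I • (z + meanShift z (Λ ^ r)) := by
  funext α
  have hz : 0 < orderGap z := h.1
  have hR : 0 ≤ orderGap z / 2 := by positivity
  have hf : ∀ γ, ContinuousOn
      (fun y : ℂ × ℝ => y.1 / (y.1 - root z (2 * Λ ^ r * ((y.2 : ℝ) : ℂ)) γ))
      (Metric.sphere (z α) (orderGap z / 2) ×ˢ Icc (-1 : ℝ) 1) := by
    intro γ
    refine continuousOn_fst.div (continuousOn_fst.sub ?_) fun y hy =>
      sub_root_ne_zero_of_mem_sphere hr (mem_rootDomain_of_cutDomain h hy.2) hy.1 γ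
    intro y hy
    have h1 := (contDiffAt_root hr (mem_rootDomain_of_cutDomain h hy.2) γ).continuousAt
    exact (ContinuousAt.comp (g := fun q : (Fin r → ℂ) × ℂ => root q.1 q.2 γ)
      (f := fun y : ℂ × ℝ => (z, 2 * Λ ^ r * (y.2 : ℂ))) h1 (by fun_prop)).continuousWithinAt
  rw [aPeriod, hgap, circleIntegral.integral_congr hR fun x hx => swDiff_eq_integral hr hΛ h hx,
    circleIntegral.integral_const_mul, circleIntegral_integral_arcsine hR
      (f := fun y : ℂ × ℝ => ∑ γ, y.1 / (y.1 - root z (2 * Λ ^ r * ((y.2 : ℝ) : ℂ)) γ))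
      (continuousOn_finsetSum _ fun γ _ => hf γ)]
  have hinner : ∀ᵐ u ∂arcsine, (∮ x in C(z α, orderGap z / 2),
      ∑ γ, x / (x - root z (2 * Λ ^ r * ((u : ℝ) : ℂ)) γ)) =
      2 * Real.pi * Complex.I * (z α + rootShift z (2 * Λ ^ r * ((u : ℝ) : ℂ)) α) := by
    filter_upwards [ae_arcsine_mem] with u hu
    rw [circleIntegral.integral_fun_sum fun γ _ => ?_]
    · rw [Finset.sum_congr rfl fun γ _ =>
        circleIntegral_div_sub_root hr (mem_rootDomain_of_cutDomain h hu) α γ]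
      simp [root]
    · refine ContinuousOn.circleIntegrable hR ?_
      exact (hf γ).comp (f := fun x : ℂ => (x, u)) (by fun_prop) fun x hx => ⟨hx, hu⟩
  rw [integral_congr_ae hinner, integral_const_mul,
    integral_add (integrable_const _) (integrable_rootShift hr h α)]
  have hpi : (Real.pi : ℂ) ≠ 0 := by exact_mod_cast Real.pi_ne_zero
  simp only [integral_const, probReal_univ, one_smul, Pi.smul_apply, Pi.add_apply, meanShift,
    smul_eq_mul]
  field_simp

theorem rootGap_ofRealVec {r : ℕ} (hr : 2 ≤ r) {z : Fin r → ℝ} (hz : StrictAnti z) :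
    rootGap (ofRealVec z) = orderGap (ofRealVec z) := by
  have h0 : 0 < orderGap (ofRealVec z) := lt_orderGap hr fun α β h => by
    simpa [ofRealVec] using hz h
  refine le_antisymm (le_orderGap hr fun α β h => ?_) ?_
  · have h1 : rootGap (ofRealVec z) ≤ ‖ofRealVec z α - ofRealVec z β‖ :=
      ciInf_le (Finite.bddBelow_range _) (⟨(α, β), h.ne⟩ : {p : Fin r × Fin r // p.1 ≠ p.2})
    have h2 : ofRealVec z α - ofRealVec z β = ((z α - z β : ℝ) : ℂ) := by simp [ofRealVec]
    rw [h2, Complex.norm_real, Real.norm_of_nonneg (sub_nonneg.2 (hz h).le)] at h1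
    rwa [h2, Complex.ofReal_re]
  · have : Nonempty {p : Fin r × Fin r // p.1 ≠ p.2} :=
      ⟨⟨(⟨0, by omega⟩, ⟨1, by omega⟩), by simp⟩⟩
    exact le_ciInf fun p => orderGap_le_norm _ p.2

/-- For real data the centres of the cuts are recovered from the periods. -/
theorem centers_of_periods {r : ℕ} (hr : 2 ≤ r) {z : Fin r → ℂ} {τ : ℂ}
    (h : (z, τ) ∈ cutDomain r) (hb : (z + meanShift z τ, τ) ∈ periodDomain r) :
    centers (z + meanShift z τ, τ) = z := by
  refine (eq_centers hr hb ?_ ?_).symm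
  · have h1 := norm_meanShift_le hr h
    have h2 := orderGap_sub_le hr z (z + meanShift z τ)
    have h0 : 0 < orderGap z := h.1
    rw [mem_closedBall_iff_norm]
    simp only [sub_add_cancel_left, norm_neg] at h1 h2 ⊢
    linarith
  · simp

/-! ### Real curves: the gaps between the cuts -/

/-- The real point of the cut `α` on which `P = 2τu`. -/
def cutRoot {r : ℕ} (z : Fin r → ℝ) (τ u : ℝ) (α : Fin r) : ℝ := realRoot z (2 * τ * u) α

theorem mem_rootDomain_ofReal {r : ℕ} {z : Fin r → ℝ} {τ : ℝ}
    (h : (ofRealVec z, (τ : ℂ)) ∈ cutDomain r) {u : ℝ} (hu : u ∈ Icc (-1 : ℝ) 1) :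
    (ofRealVec z, ((2 * τ * u : ℝ) : ℂ)) ∈ rootDomain r := by
  have := mem_rootDomain_of_cutDomain h hu
  push_cast
  exact this

theorem ofReal_cutRoot {r : ℕ} (hr : 2 ≤ r) {z : Fin r → ℝ} {τ : ℝ}
    (h : (ofRealVec z, (τ : ℂ)) ∈ cutDomain r) {u : ℝ} (hu : u ∈ Icc (-1 : ℝ) 1) (α : Fin r) :
    (cutRoot z τ u α : ℂ) = root (ofRealVec z) (2 * τ * u) α := by
  rw [cutRoot, ofReal_realRoot hr (mem_rootDomain_ofReal h hu)]
  push_cast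
  rfl

theorem abs_cutRoot_sub_le {r : ℕ} (hr : 2 ≤ r) {z : Fin r → ℝ} {τ : ℝ}
    (h : (ofRealVec z, (τ : ℂ)) ∈ cutDomain r) {u : ℝ} (hu : u ∈ Icc (-1 : ℝ) 1) (α : Fin r) :
    |cutRoot z τ u α - z α| ≤ orderGap (ofRealVec z) / 16 := by
  have h1 := norm_rootShift_le hr (mem_rootDomain_of_cutDomain h hu) α
  have h2 : ((cutRoot z τ u α - z α : ℝ) : ℂ) = rootShift (ofRealVec z) (2 * τ * u) α := by
    rw [Complex.ofReal_sub, ofReal_cutRoot hr h hu, root]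
    simp [ofRealVec]
  rw [← Real.norm_eq_abs, ← Complex.norm_real, h2]
  exact h1

theorem prod_sub_cutRoot {r : ℕ} (hr : 2 ≤ r) {z : Fin r → ℝ} {τ : ℝ}
    (h : (ofRealVec z, (τ : ℂ)) ∈ cutDomain r) {u : ℝ} (hu : u ∈ Icc (-1 : ℝ) 1) (x : ℝ) :
    ∏ γ, (x - cutRoot z τ u γ) = (curvePoly z).eval x - 2 * τ * u := by
  have h1 := prod_sub_root hr (mem_rootDomain_of_cutDomain h hu) (x : ℂ)
  simp only [← ofReal_cutRoot hr h hu, eval_curvePoly, ofRealVec] at h1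
  rw [eval_curvePoly]
  exact_mod_cast h1

theorem continuousOn_cutRoot {r : ℕ} (hr : 2 ≤ r) {z : Fin r → ℝ} {τ : ℝ}
    (h : (ofRealVec z, (τ : ℂ)) ∈ cutDomain r) (α : Fin r) :
    ContinuousOn (fun u => cutRoot z τ u α) (Icc (-1) 1) := by
  intro u hu
  have h1 := (contDiffAt_root hr (mem_rootDomain_ofReal h hu) α).continuousAt
  have h2 : ContinuousAt (fun u : ℝ => root (ofRealVec z) ((2 * τ * u : ℝ) : ℂ) α) u :=
    ContinuousAt.comp (g := fun q : (Fin r → ℂ) × ℂ => root q.1 q.2 α)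
      (f := fun u : ℝ => (ofRealVec z, ((2 * τ * u : ℝ) : ℂ))) h1 (by fun_prop)
  exact (Complex.continuous_re.continuousAt.comp h2).continuousWithinAt

theorem orderGap_le_sub {r : ℕ} (z : Fin r → ℝ) {α β : Fin r} (h : α < β) :
    orderGap (ofRealVec z) ≤ z α - z β := by
  simpa [ofRealVec] using orderGap_le (ofRealVec z) h

/-- The sign of `x - z_α` for `x` to the right of `z_β` and to the left of the preceding point. -/
def orderSign {r : ℕ} (β α : Fin r) : ℝ := if α < β then -1 else 1

/-- The sign of `P` on the gap to the right of `z_β`. -/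
def gapSign {r : ℕ} (β : Fin r) : ℝ := ∏ α, orderSign β α

theorem gapSign_eq_or {r : ℕ} (β : Fin r) : gapSign β = 1 ∨ gapSign β = -1 := by
  rw [gapSign]
  refine Finset.prod_induction _ (fun x : ℝ => x = 1 ∨ x = -1) ?_ (Or.inl rfl) fun α _ => ?_
  · rintro x y (rfl | rfl) (rfl | rfl) <;> norm_num
  · rw [orderSign]
    split_ifs <;> simp

theorem gapSign_mul_self {r : ℕ} (β : Fin r) : gapSign β * gapSign β = 1 := by
  rcases gapSign_eq_or β with h | h <;> rw [h] <;> norm_num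

theorem gapSign_mem {r : ℕ} (β : Fin r) : gapSign β ∈ Icc (-1 : ℝ) 1 := by
  rcases gapSign_eq_or β with h | h <;> rw [h] <;> norm_num

theorem sub_one_lt_of_ne_zero {r : ℕ} [NeZero r] {β : Fin r} (hβ : β ≠ 0) : β - 1 < β := by
  have h1 : (β : ℕ) ≠ 0 := fun h => hβ (Fin.ext (by simpa using h))
  rw [Fin.lt_def, Fin.val_sub_one_of_ne_zero hβ]
  omega

theorem lt_sub_one_of_lt {r : ℕ} [NeZero r] {α β : Fin r} (hβ : β ≠ 0) (h : α < β)
    (hne : α ≠ β - 1) : α < β - 1 := by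
  have h1 : (α : ℕ) ≠ (β - 1 : Fin r) := fun h => hne (Fin.ext h)
  rw [Fin.lt_def] at h ⊢
  rw [Fin.val_sub_one_of_ne_zero hβ] at h1 ⊢
  omega

/-- The product of the factors of `P` other than those of the two ends of a gap, up to sign. -/
def gapCofactor {r : ℕ} [NeZero r] (w : Fin r → ℝ) (β : Fin r) (x : ℝ) : ℝ :=
  ∏ α ∈ (Finset.univ.erase β).erase (β - 1), (orderSign β α * (x - w α))

/-- The sign makes the two factors at the ends of the gap and the cofactor positive on the gap. -/
theorem gapSign_mul_prod {r : ℕ} [NeZero r] (w : Fin r → ℝ) {β : Fin r} (hβ : β ≠ 0) (x : ℝ) :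
    gapSign β * ∏ α, (x - w α) = (x - w β) * (w (β - 1) - x) * gapCofactor w β x := by
  have hlt := sub_one_lt_of_ne_zero hβ
  rw [gapSign, ← Finset.prod_mul_distrib, gapCofactor,
    ← Finset.mul_prod_erase _ _ (Finset.mem_univ β), ← Finset.mul_prod_erase _ _
      (Finset.mem_erase.2 ⟨hlt.ne, Finset.mem_univ (β - 1)⟩)]
  have h1 : orderSign β β = 1 := if_neg (lt_irrefl β)
  have h2 : orderSign β (β - 1) = -1 := if_pos hlt
  rw [h1, h2]
  ring

theorem continuous_gapCofactor {r : ℕ} [NeZero r] (w : Fin r → ℝ) (β : Fin r) :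
    Continuous (gapCofactor w β) := by
  unfold gapCofactor
  fun_prop

theorem gapCofactor_pos {r : ℕ} [NeZero r] {z w : Fin r → ℝ} (hz : 0 < orderGap (ofRealVec z))
    (hw : ∀ α, |w α - z α| ≤ orderGap (ofRealVec z) / 16) {β : Fin r} (hβ : β ≠ 0) {x : ℝ}
    (hx : x ∈ Icc (z β - orderGap (ofRealVec z) / 16) (z (β - 1) + orderGap (ofRealVec z) / 16)) :
    0 < gapCofactor w β x := by
  refine Finset.prod_pos fun α hα => ?_
  have hα1 : α ≠ β - 1 := Finset.ne_of_mem_erase hα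
  have hα2 : α ≠ β := Finset.ne_of_mem_erase (Finset.mem_of_mem_erase hα)
  have h1 := abs_le.1 (hw α)
  rw [orderSign]
  split_ifs with h
  · have h2 := orderGap_le_sub z (lt_sub_one_of_lt hβ h hα1)
    linarith [hx.2]
  · have h2 := orderGap_le_sub z (lt_of_le_of_ne (not_lt.1 h) hα2.symm)
    linarith [hx.1]

theorem cutRoot_sub_one_sub_pos {r : ℕ} [NeZero r] (hr : 2 ≤ r) {z : Fin r → ℝ} {τ : ℝ}
    (h : (ofRealVec z, (τ : ℂ)) ∈ cutDomain r) {β : Fin r} (hβ : β ≠ 0) {u u' : ℝ}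
    (hu : u ∈ Icc (-1 : ℝ) 1) (hu' : u' ∈ Icc (-1 : ℝ) 1) :
    cutRoot z τ u β < cutRoot z τ u' (β - 1) := by
  have h0 : 0 < orderGap (ofRealVec z) := h.1
  have h1 := (abs_le.1 (abs_cutRoot_sub_le hr h hu β)).2
  have h2 := (abs_le.1 (abs_cutRoot_sub_le hr h hu' (β - 1))).1
  have h3 := orderGap_le_sub z (sub_one_lt_of_ne_zero hβ)
  linarith

/-- The left end of the gap to the right of `z_β`. -/
def gapLeft {r : ℕ} (z : Fin r → ℝ) (τ : ℝ) (β : Fin r) : ℝ := cutRoot z τ (gapSign β) β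

/-- The right end of the gap to the right of `z_β`. -/
def gapRight {r : ℕ} [NeZero r] (z : Fin r → ℝ) (τ : ℝ) (β : Fin r) : ℝ :=
  cutRoot z τ (gapSign β) (β - 1)

theorem mem_Icc_of_mem_gap {r : ℕ} [NeZero r] (hr : 2 ≤ r) {z : Fin r → ℝ} {τ : ℝ}
    (h : (ofRealVec z, (τ : ℂ)) ∈ cutDomain r) {β : Fin r} {x : ℝ}
    (hx : x ∈ Icc (gapLeft z τ β) (gapRight z τ β)) :
    x ∈ Icc (z β - orderGap (ofRealVec z) / 16) (z (β - 1) + orderGap (ofRealVec z) / 16) := by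
  have h1 := (abs_le.1 (abs_cutRoot_sub_le hr h (gapSign_mem β) β)).1
  have h2 := (abs_le.1 (abs_cutRoot_sub_le hr h (gapSign_mem β) (β - 1))).2
  have h3 := hx.1
  have h4 := hx.2
  rw [gapLeft] at h3
  rw [gapRight] at h4
  constructor <;> linarith

theorem gapSign_mul_eval_sub {r : ℕ} [NeZero r] (hr : 2 ≤ r) {z : Fin r → ℝ} {τ : ℝ}
    (h : (ofRealVec z, (τ : ℂ)) ∈ cutDomain r) {β : Fin r} (hβ : β ≠ 0) (x : ℝ) {u : ℝ}
    (hu : u ∈ Icc (-1 : ℝ) 1) :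
    gapSign β * ((curvePoly z).eval x - 2 * τ * u) =
      (x - cutRoot z τ u β) * (cutRoot z τ u (β - 1) - x) * gapCofactor (cutRoot z τ u) β x := by
  rw [← prod_sub_cutRoot hr h hu, gapSign_mul_prod _ hβ]

theorem gapSign_mul_eval {r : ℕ} [NeZero r] (hr : 2 ≤ r) {z : Fin r → ℝ} {τ : ℝ}
    (h : (ofRealVec z, (τ : ℂ)) ∈ cutDomain r) {β : Fin r} (hβ : β ≠ 0) (x : ℝ) :
    gapSign β * (curvePoly z).eval x - 2 * τ =
      (x - gapLeft z τ β) * (gapRight z τ β - x) *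
        gapCofactor (cutRoot z τ (gapSign β)) β x := by
  rw [gapLeft, gapRight, ← gapSign_mul_eval_sub hr h hβ x (gapSign_mem β), mul_sub]
  linear_combination (2 * τ) * gapSign_mul_self β

theorem gapCofactor_cutRoot_pos {r : ℕ} [NeZero r] (hr : 2 ≤ r) {z : Fin r → ℝ} {τ : ℝ}
    (h : (ofRealVec z, (τ : ℂ)) ∈ cutDomain r) {β : Fin r} (hβ : β ≠ 0) {x : ℝ}
    (hx : x ∈ Icc (z β - orderGap (ofRealVec z) / 16) (z (β - 1) + orderGap (ofRealVec z) / 16))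
    {u : ℝ} (hu : u ∈ Icc (-1 : ℝ) 1) : 0 < gapCofactor (cutRoot z τ u) β x :=
  gapCofactor_pos h.1 (abs_cutRoot_sub_le hr h hu) hβ hx

theorem two_mul_lt_gapSign_mul_eval {r : ℕ} [NeZero r] (hr : 2 ≤ r) {z : Fin r → ℝ} {τ : ℝ}
    (h : (ofRealVec z, (τ : ℂ)) ∈ cutDomain r) {β : Fin r} (hβ : β ≠ 0) {x : ℝ}
    (hx : x ∈ Ioo (gapLeft z τ β) (gapRight z τ β)) :
    2 * τ < gapSign β * (curvePoly z).eval x := by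
  have hC' := gapCofactor_cutRoot_pos hr h hβ (mem_Icc_of_mem_gap hr h (Ioo_subset_Icc_self hx))
    (gapSign_mem β)
  have h3 := mul_pos (mul_pos (sub_pos.2 hx.1) (sub_pos.2 hx.2)) hC'
  rw [← gapSign_mul_eval hr h hβ x] at h3
  linarith

theorem abs_eval_eq {r : ℕ} {β : Fin r} {P : ℝ} (h : 0 ≤ gapSign β * P) : |P| = gapSign β * P := by
  rcases gapSign_eq_or β with h1 | h1 <;> rw [h1] at h ⊢
  · rw [abs_of_nonneg (by linarith), one_mul]
  · rw [abs_of_nonpos (by linarith), neg_one_mul]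

/-- The part of the segment between `z_β` and `z_(β-1)` where `|P| > 2Λ^r` is the interval between
the branch points that lie there. -/
theorem gapSegment_eq {r : ℕ} [NeZero r] (hr : 2 ≤ r) {z : Fin r → ℝ} {Λ : ℝ} (hΛ : 0 < Λ)
    (h : (ofRealVec z, ((Λ ^ r : ℝ) : ℂ)) ∈ cutDomain r) {β : Fin r} (hβ : β ≠ 0) :
    gapSegment z Λ β = Ioo (gapLeft z (Λ ^ r) β) (gapRight z (Λ ^ r) β) := by
  have hτ : 0 < Λ ^ r := pow_pos hΛ r
  have hg : 0 < orderGap (ofRealVec z) := h.1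
  have h00 : ∀ α, |z α - z α| ≤ orderGap (ofRealVec z) / 16 := fun α => by
    rw [sub_self, abs_zero]
    positivity
  have hP : ∀ x, gapSign β * (curvePoly z).eval x =
      (x - z β) * (z (β - 1) - x) * gapCofactor z β x := fun x => by
    rw [eval_curvePoly, gapSign_mul_prod _ hβ]
  have hz := orderGap_le_sub z (sub_one_lt_of_ne_zero hβ)
  ext x
  constructor
  · rintro ⟨h1, h2, h3⟩
    have hI : x ∈ Icc (z β - orderGap (ofRealVec z) / 16)
        (z (β - 1) + orderGap (ofRealVec z) / 16) := ⟨by linarith, by linarith⟩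
    have h4 : 0 < gapSign β * (curvePoly z).eval x := by
      rw [hP]
      exact mul_pos (mul_pos (by linarith) (by linarith)) (gapCofactor_pos hg h00 hβ hI)
    rw [abs_eval_eq h4.le] at h3
    have h5 := gapSign_mul_eval hr h hβ x
    have h6 : 0 < (x - gapLeft z (Λ ^ r) β) * (gapRight z (Λ ^ r) β - x) := by
      refine pos_of_mul_pos_left (b := gapCofactor (cutRoot z (Λ ^ r) (gapSign β)) β x) ?_
        (gapCofactor_cutRoot_pos hr h hβ hI (gapSign_mem β)).le
      rw [← h5]
      linarith
    have h7 : gapLeft z (Λ ^ r) β < gapRight z (Λ ^ r) β :=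
      cutRoot_sub_one_sub_pos hr h hβ (gapSign_mem β) (gapSign_mem β)
    rcases pos_and_pos_or_neg_and_neg_of_mul_pos h6 with ⟨ha, hb⟩ | ⟨ha, hb⟩
    · exact ⟨sub_pos.1 ha, sub_pos.1 hb⟩
    · linarith
  · intro hx
    have hlt := two_mul_lt_gapSign_mul_eval hr h hβ hx
    have hI := mem_Icc_of_mem_gap hr h (Ioo_subset_Icc_self hx)
    have h6 : 0 < (x - z β) * (z (β - 1) - x) := by
      refine pos_of_mul_pos_left (b := gapCofactor z β x) ?_ (gapCofactor_pos hg h00 hβ hI).le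
      rw [← hP]
      linarith
    have h8 : z β < x ∧ x < z (β - 1) := by
      rcases pos_and_pos_or_neg_and_neg_of_mul_pos h6 with ⟨ha, hb⟩ | ⟨ha, hb⟩
      · exact ⟨sub_pos.1 ha, sub_pos.1 hb⟩
      · linarith
    refine ⟨h8.1, h8.2, ?_⟩
    rw [abs_eval_eq (β := β) (by linarith)]
    exact hlt

/-! ### The integrals over the gaps -/

theorem continuous_integral_arcsine {f : ℝ → ℝ → ℝ}
    (hf : ContinuousOn (fun q : ℝ × ℝ => f q.1 q.2) (univ ×ˢ Icc (-1 : ℝ) 1)) :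
    Continuous fun x => ∫ u, f x u ∂arcsine := by
  have hsec : ∀ x, ContinuousOn (f x) (Icc (-1) 1) := fun x =>
    hf.comp (f := fun u : ℝ => (x, u)) (by fun_prop) fun u hu => ⟨mem_univ _, hu⟩
  rw [continuous_iff_continuousAt]
  intro x
  obtain ⟨C, hC⟩ := ((isCompact_closedBall x 1).prod isCompact_Icc).exists_bound_of_continuousOn
    (hf.mono (prod_mono (subset_univ (Metric.closedBall x 1)) le_rfl))
  refine continuousAt_of_dominated (bound := fun _ => C)
    (Eventually.of_forall fun y => (integrable_arcsine_of_continuousOn (hsec y)).1) ?_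
    (integrable_const C) ?_
  · filter_upwards [Metric.closedBall_mem_nhds x one_pos] with y hy
    filter_upwards [ae_arcsine_mem] with u hu using hC (y, u) ⟨hy, hu⟩
  · filter_upwards [ae_arcsine_mem] with u hu
    rw [← continuousWithinAt_univ]
    exact (hf.comp (f := fun y : ℝ => (y, u)) (s := univ) (by fun_prop)
      fun y _ => ⟨mem_univ y, hu⟩) x (mem_univ x)

theorem hasDerivAt_integral_arcsine_of_continuousOn {f f' : ℝ → ℝ → ℝ} {a b x : ℝ}
    (hx : x ∈ Ioo a b) (hf : ∀ x ∈ Ioo a b, ContinuousOn (f x) (Icc (-1) 1))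
    (hd : ∀ x ∈ Ioo a b, ∀ u ∈ Icc (-1 : ℝ) 1, HasDerivAt (fun x => f x u) (f' x u) x)
    (hf' : ContinuousOn (fun q : ℝ × ℝ => f' q.1 q.2) (Ioo a b ×ˢ Icc (-1 : ℝ) 1)) :
    HasDerivAt (fun x => ∫ u, f x u ∂arcsine) (∫ u, f' x u ∂arcsine) x := by
  obtain ⟨ε, hε, hsub⟩ := Metric.nhds_basis_closedBall.mem_iff.1 (Ioo_mem_nhds hx.1 hx.2)
  obtain ⟨C, hC⟩ := ((isCompact_closedBall x ε).prod isCompact_Icc).exists_bound_of_continuousOn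
    (hf'.mono (prod_mono hsub le_rfl))
  refine (hasDerivAt_integral_of_dominated_loc_of_deriv_le (bound := fun _ => C)
    (Metric.closedBall_mem_nhds x hε) ?_ (integrable_arcsine_of_continuousOn (hf x hx)) ?_ ?_
    (integrable_const C) ?_).2
  · filter_upwards [Ioo_mem_nhds hx.1 hx.2] with y hy
    exact (integrable_arcsine_of_continuousOn (hf y hy)).1
  · exact (integrable_arcsine_of_continuousOn (hf'.comp (f := fun u : ℝ => (x, u)) (by fun_prop)
      fun u hu => ⟨hx, hu⟩)).1
  · filter_upwards [ae_arcsine_mem] with u hu y hy using hC (y, u) ⟨hy, hu⟩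
  · filter_upwards [ae_arcsine_mem] with u hu y hy using hd y (hsub hy) u hu

/-- The primitive `y (log |y| - 1)` of `log |y|`. -/
def logPrimitive (y : ℝ) : ℝ := y * (Real.log y - 1)

theorem continuous_logPrimitive : Continuous logPrimitive := by
  have h : logPrimitive = fun y => y * Real.log y - y := by
    funext y
    rw [logPrimitive]
    ring
  rw [h]
  exact Real.continuous_mul_log.sub continuous_id

theorem hasDerivAt_logPrimitive {y : ℝ} (hy : y ≠ 0) :
    HasDerivAt logPrimitive (Real.log y) y := by
  have := (hasDerivAt_id y).fun_mul ((Real.hasDerivAt_log hy).sub_const 1)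
  refine this.congr_deriv ?_
  simp only [id]
  field_simp
  ring

/-- The primitive of the logarithmic potential of the cuts. -/
def cutPrimitive {r : ℕ} (z : Fin r → ℝ) (τ x : ℝ) : ℝ :=
  ∫ u, ∑ γ, logPrimitive (x - cutRoot z τ u γ) ∂arcsine

/-- The logarithmic potential of the cuts on the gap to the right of `z_β`, minus `log τ`. -/
def gapLog {r : ℕ} (z : Fin r → ℝ) (τ : ℝ) (β : Fin r) (x : ℝ) : ℝ :=
  Real.arcosh (gapSign β * (curvePoly z).eval x / (2 * τ))

theorem continuousOn_logPrimitive_sub {r : ℕ} (hr : 2 ≤ r) {z : Fin r → ℝ} {τ : ℝ}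
    (h : (ofRealVec z, (τ : ℂ)) ∈ cutDomain r) :
    ContinuousOn (fun q : ℝ × ℝ => ∑ γ, logPrimitive (q.1 - cutRoot z τ q.2 γ))
      (univ ×ˢ Icc (-1 : ℝ) 1) := by
  refine continuousOn_finsetSum _ fun γ _ => continuous_logPrimitive.comp_continuousOn ?_
  exact continuousOn_fst.sub ((continuousOn_cutRoot hr h γ).comp continuousOn_snd fun q hq => hq.2)

theorem continuous_cutPrimitive {r : ℕ} (hr : 2 ≤ r) {z : Fin r → ℝ} {τ : ℝ}
    (h : (ofRealVec z, (τ : ℂ)) ∈ cutDomain r) : Continuous (cutPrimitive z τ) :=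
  continuous_integral_arcsine (continuousOn_logPrimitive_sub hr h)

theorem sub_cutRoot_ne_zero_of_mem_gap {r : ℕ} [NeZero r] (hr : 2 ≤ r) {z : Fin r → ℝ} {τ : ℝ}
    (hτ : 0 < τ) (h : (ofRealVec z, (τ : ℂ)) ∈ cutDomain r) {β : Fin r} (hβ : β ≠ 0) {x : ℝ}
    (hx : x ∈ Ioo (gapLeft z τ β) (gapRight z τ β)) {u : ℝ} (hu : u ∈ Icc (-1 : ℝ) 1)
    (γ : Fin r) : x - cutRoot z τ u γ ≠ 0 := by
  have h1 := two_mul_lt_gapSign_mul_eval hr h hβ hx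
  have h2 := prod_sub_cutRoot hr h hu x
  have h3 : (curvePoly z).eval x - 2 * τ * u ≠ 0 := by
    intro h0
    rw [sub_eq_zero.1 h0] at h1
    rcases gapSign_eq_or β with h4 | h4 <;> rw [h4] at h1 <;> nlinarith [hu.1, hu.2]
  rw [← h2] at h3
  exact Finset.prod_ne_zero_iff.1 h3 γ (Finset.mem_univ γ)

/-- On the gap the logarithmic potential of the cuts is `log τ` plus the potential of the arcsine
law at `P / τ`. -/
theorem hasDerivAt_cutPrimitive {r : ℕ} [NeZero r] (hr : 2 ≤ r) {z : Fin r → ℝ} {τ : ℝ}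
    (hτ : 0 < τ) (h : (ofRealVec z, (τ : ℂ)) ∈ cutDomain r) {β : Fin r} (hβ : β ≠ 0) {x : ℝ}
    (hx : x ∈ Ioo (gapLeft z τ β) (gapRight z τ β)) :
    HasDerivAt (cutPrimitive z τ) (Real.log τ + gapLog z τ β x) x := by
  have hne := fun {x : ℝ} (hx : x ∈ Ioo (gapLeft z τ β) (gapRight z τ β)) {u : ℝ}
    (hu : u ∈ Icc (-1 : ℝ) 1) => sub_cutRoot_ne_zero_of_mem_gap hr hτ h hβ hx hu
  have hd := hasDerivAt_integral_arcsine_of_continuousOn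
    (f := fun x u => ∑ γ, logPrimitive (x - cutRoot z τ u γ))
    (f' := fun x u => ∑ γ, Real.log (x - cutRoot z τ u γ)) hx
    (fun x _ => (continuousOn_logPrimitive_sub hr h).comp (f := fun u : ℝ => (x, u))
      (by fun_prop) fun u hu => ⟨mem_univ _, hu⟩)
    (fun x hx u hu => HasDerivAt.fun_sum fun γ _ =>
      (hasDerivAt_logPrimitive (hne hx hu γ)).comp_sub_const x _)
    (continuousOn_finsetSum _ fun γ _ => ContinuousOn.log (continuousOn_fst.sub
      ((continuousOn_cutRoot hr h γ).comp continuousOn_snd fun q hq => hq.2))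
      fun q hq => hne hq.1 hq.2 γ)
  refine hd.congr_deriv ?_
  have hlt := two_mul_lt_gapSign_mul_eval hr h hβ hx
  have h2τ : 0 < 2 * τ := by positivity
  have habs : |(curvePoly z).eval x / τ| = 2 * (gapSign β * (curvePoly z).eval x / (2 * τ)) := by
    rw [abs_div, abs_eval_eq (β := β) (by linarith), abs_of_pos hτ]
    field_simp
  have hv : 2 < |(curvePoly z).eval x / τ| := by
    rw [abs_div, abs_eval_eq (β := β) (by linarith), abs_of_pos hτ, lt_div_iff₀ hτ]
    exact hlt
  have hsum : ∀ᵐ u ∂arcsine, ∑ γ, Real.log (x - cutRoot z τ u γ) =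
      Real.log τ + Real.log |(curvePoly z).eval x / τ - 2 * u| := by
    filter_upwards [ae_arcsine_mem] with u hu
    rw [← Real.log_prod fun γ _ => hne hx hu γ, prod_sub_cutRoot hr h hu, Real.log_abs,
      ← Real.log_mul hτ.ne']
    · congr 1
      field_simp
    · intro h0
      rw [sub_eq_zero.1 h0, abs_mul, abs_two] at hv
      have := abs_le.2 hu
      linarith
  rw [integral_congr_ae hsum, integral_add (integrable_const _) (integrable_log_arcsine _),
    integral_log_arcsine_of_le_abs hv.le, integral_const, probReal_univ, one_smul, gapLog,
    Real.arcosh]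
  congr 2
  have h4 : ((curvePoly z).eval x / τ) ^ 2 - 4 =
      2 ^ 2 * ((gapSign β * (curvePoly z).eval x / (2 * τ)) ^ 2 - 1) := by
    rw [← sq_abs, habs]
    ring
  rw [h4, habs, Real.sqrt_mul (by norm_num), Real.sqrt_sq (by norm_num)]
  ring

/-- The derivative of `gapLog` is `P' / √(P² - 4Λ^(2r))`, in the sheet where the root has the sign
of `P`. -/
theorem hasDerivAt_gapLog {r : ℕ} [NeZero r] (hr : 2 ≤ r) {z : Fin r → ℝ} {Λ : ℝ} (hΛ : 0 < Λ)
    (h : (ofRealVec z, ((Λ ^ r : ℝ) : ℂ)) ∈ cutDomain r) {β : Fin r} (hβ : β ≠ 0) {x : ℝ}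
    (hx : x ∈ Ioo (gapLeft z (Λ ^ r) β) (gapRight z (Λ ^ r) β)) :
    HasDerivAt (gapLog z (Λ ^ r) β) ((curvePoly z).derivative.eval x /
      (SignType.sign ((curvePoly z).eval x) *
        √(((curvePoly z).eval x) ^ 2 - 4 * Λ ^ (2 * r)))) x := by
  have hτ : 0 < Λ ^ r := pow_pos hΛ r
  have hlt := two_mul_lt_gapSign_mul_eval hr h hβ hx
  set P := (curvePoly z).eval x with hP
  have h1 : (1 : ℝ) < gapSign β * P / (2 * Λ ^ r) := by
    rw [one_lt_div (by positivity)]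
    exact hlt
  have h2 : HasDerivAt (fun x => gapSign β * (curvePoly z).eval x / (2 * Λ ^ r))
      (gapSign β * (curvePoly z).derivative.eval x / (2 * Λ ^ r)) x :=
    (((curvePoly z).hasDerivAt x).const_mul _).div_const _
  have h3 := (Real.hasDerivAt_arcosh h1).comp x h2
  refine h3.congr_deriv ?_
  have hsign : ((SignType.sign P : SignType) : ℝ) = gapSign β := by
    rcases gapSign_eq_or β with h4 | h4 <;> rw [h4] at hlt ⊢
    · rw [sign_pos (by linarith)]
      simp
    · rw [sign_neg (by linarith)]
      simp
  have h5 : (gapSign β * P / (2 * Λ ^ r)) ^ 2 - 1 =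
      (P ^ 2 - 4 * Λ ^ (2 * r)) / (2 * Λ ^ r) ^ 2 := by
    have := gapSign_mul_self β
    rw [pow_mul' Λ 2 r]
    field_simp
    linear_combination (P ^ 2) * this
  rw [hsign, h5, Real.sqrt_div' _ (by positivity), Real.sqrt_sq (by positivity)]
  have hpos : 0 < P ^ 2 - 4 * Λ ^ (2 * r) := by
    rw [pow_mul' Λ 2 r]
    have := gapSign_mul_self β
    have h6 : P ^ 2 = (gapSign β * P) ^ 2 := by linear_combination (-P ^ 2) * this
    rw [h6]
    nlinarith
  have hs := Real.sqrt_pos.2 hpos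
  have hg : gapSign β ≠ 0 := fun h0 => by
    have := gapSign_mul_self β
    rw [h0] at this
    norm_num at this
  have hgg : gapSign β ^ 2 = 1 := by
    rw [sq]
    exact gapSign_mul_self β
  field_simp
  rw [hgg]
  ring

theorem gapSign_mul_eval_gapEnd {r : ℕ} [NeZero r] (hr : 2 ≤ r) {z : Fin r → ℝ} {τ : ℝ}
    (h : (ofRealVec z, (τ : ℂ)) ∈ cutDomain r) {β : Fin r} (hβ : β ≠ 0) :
    gapSign β * (curvePoly z).eval (gapLeft z τ β) = 2 * τ ∧
      gapSign β * (curvePoly z).eval (gapRight z τ β) = 2 * τ := by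
  have h1 := gapSign_mul_eval hr h hβ (gapLeft z τ β)
  have h2 := gapSign_mul_eval hr h hβ (gapRight z τ β)
  rw [sub_self] at h1 h2
  constructor
  · linarith
  · rw [mul_zero, zero_mul] at h2
    linarith

theorem gapLog_gapEnd {r : ℕ} [NeZero r] (hr : 2 ≤ r) {z : Fin r → ℝ} {τ : ℝ} (hτ : 0 < τ)
    (h : (ofRealVec z, (τ : ℂ)) ∈ cutDomain r) {β : Fin r} (hβ : β ≠ 0) :
    gapLog z τ β (gapLeft z τ β) = 0 ∧ gapLog z τ β (gapRight z τ β) = 0 := by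
  obtain ⟨h1, h2⟩ := gapSign_mul_eval_gapEnd hr h hβ
  rw [gapLog, gapLog, h1, h2, div_self (by positivity), Real.arcosh_zero]
  exact ⟨rfl, rfl⟩

theorem continuousOn_gapLog {r : ℕ} [NeZero r] (hr : 2 ≤ r) {z : Fin r → ℝ} {τ : ℝ} (hτ : 0 < τ)
    (h : (ofRealVec z, (τ : ℂ)) ∈ cutDomain r) {β : Fin r} (hβ : β ≠ 0) :
    ContinuousOn (gapLog z τ β) (Icc (gapLeft z τ β) (gapRight z τ β)) := by
  refine Real.continuousOn_arcosh.comp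
    (f := fun x => gapSign β * (curvePoly z).eval x / (2 * τ)) ?_ fun x hx => ?_
  · exact ((continuous_const.mul (curvePoly z).continuous).div_const _).continuousOn
  · have h1 := gapSign_mul_eval hr h hβ x
    have hC := gapCofactor_cutRoot_pos hr h hβ (mem_Icc_of_mem_gap hr h hx) (gapSign_mem β)
    have h2 := mul_nonneg (mul_nonneg (sub_nonneg.2 hx.1) (sub_nonneg.2 hx.2)) hC.le
    rw [← h1] at h2
    rw [mem_Ici, one_le_div (by positivity)]
    linarith

/-- The integrand is the derivative of `arcsin` after an affine change of variable, and it is not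
negative. -/
theorem integrableOn_inv_sqrt_mul {a b : ℝ} (hab : a < b) :
    IntegrableOn (fun x => 1 / √((x - a) * (b - x))) (Ioc a b) := by
  have hba : 0 < b - a := sub_pos.2 hab
  refine intervalIntegral.integrableOn_deriv_of_nonneg
    (g := fun x => Real.arcsin ((2 * x - a - b) / (b - a)))
    (Real.continuous_arcsin.comp (by fun_prop)).continuousOn (fun x hx => ?_)
    fun x _ => by positivity
  have hxa : 0 < x - a := sub_pos.2 hx.1
  have hbx : 0 < b - x := sub_pos.2 hx.2
  have h1 : HasDerivAt (fun x => (2 * x - a - b) / (b - a)) (2 / (b - a)) x := by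
    simpa using (((((hasDerivAt_id x).const_mul 2).sub_const a).sub_const b).div_const (b - a))
  have h2 : (2 * x - a - b) / (b - a) ≠ -1 := by
    rw [ne_eq, div_eq_iff hba.ne']
    intro h
    linarith
  have h3 : (2 * x - a - b) / (b - a) ≠ 1 := by
    rw [ne_eq, div_eq_iff hba.ne']
    intro h
    linarith
  refine ((Real.hasDerivAt_arcsin h2 h3).comp x h1).congr_deriv ?_
  have h4 : 1 - ((2 * x - a - b) / (b - a)) ^ 2 = (x - a) * (b - x) * (2 / (b - a)) ^ 2 := by
    field_simp
    ring
  rw [h4, Real.sqrt_mul (by positivity), Real.sqrt_sq (by positivity)]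
  have := Real.sqrt_pos.2 (mul_pos hxa hbx)
  field_simp

/-- The differential has inverse square-root singularities at the ends of the gap. -/
theorem integrableOn_mul_gapLog_deriv {r : ℕ} [NeZero r] (hr : 2 ≤ r) {z : Fin r → ℝ} {Λ : ℝ}
    (hΛ : 0 < Λ) (h : (ofRealVec z, ((Λ ^ r : ℝ) : ℂ)) ∈ cutDomain r) {β : Fin r} (hβ : β ≠ 0) :
    IntegrableOn (fun x => x * ((curvePoly z).derivative.eval x /
      (SignType.sign ((curvePoly z).eval x) *
        √(((curvePoly z).eval x) ^ 2 - 4 * Λ ^ (2 * r)))))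
      (Ioo (gapLeft z (Λ ^ r) β) (gapRight z (Λ ^ r) β)) := by
  have hτ : 0 < Λ ^ r := pow_pos hΛ r
  set a := gapLeft z (Λ ^ r) β
  set b := gapRight z (Λ ^ r) β
  have hab : a < b := cutRoot_sub_one_sub_pos hr h hβ (gapSign_mem β) (gapSign_mem β)
  obtain ⟨M, hM⟩ := (isCompact_Icc (a := a) (b := b)).exists_bound_of_continuousOn
    (f := fun x => x * (curvePoly z).derivative.eval x)
    (continuous_id.mul (curvePoly z).derivative.continuous).continuousOn
  -- `P² - 4Λ^(2r)` is `(x - a) (b - x)` times a factor that is bounded below by `4Λ^r c`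
  obtain ⟨x₀, hx₀, hmin⟩ := (isCompact_Icc (a := a) (b := b)).exists_isMinOn
    (nonempty_Icc.2 hab.le)
    (continuous_gapCofactor (cutRoot z (Λ ^ r) (gapSign β)) β).continuousOn
  set c := gapCofactor (cutRoot z (Λ ^ r) (gapSign β)) β x₀
  have hc : 0 < c :=
    gapCofactor_cutRoot_pos hr h hβ (mem_Icc_of_mem_gap hr h hx₀) (gapSign_mem β)
  have hk : 0 < 4 * Λ ^ r * c := by positivity
  have hdom := ((integrableOn_inv_sqrt_mul hab).mono_set Ioo_subset_Ioc_self).const_mul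
    (M / √(4 * Λ ^ r * c))
  refine Integrable.mono' hdom ?_ ?_
  · refine Measurable.aestronglyMeasurable ?_
    have h1 : Measurable fun x : ℝ => (curvePoly z).eval x := (curvePoly z).continuous.measurable
    have h2 : Measurable fun x : ℝ => (curvePoly z).derivative.eval x :=
      (curvePoly z).derivative.continuous.measurable
    have h3 : Measurable fun x : ℝ => ((SignType.sign ((curvePoly z).eval x) : SignType) : ℝ) := by
      have h4 : Measurable fun y : ℝ => ((SignType.sign y : SignType) : ℝ) := by
        have h5 : (fun y : ℝ => ((SignType.sign y : SignType) : ℝ)) =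
            fun y => if 0 < y then 1 else if y < 0 then -1 else 0 := by
          funext y
          rw [sign_apply]
          split_ifs <;> simp
        rw [h5]
        exact Measurable.ite measurableSet_Ioi measurable_const
          (Measurable.ite measurableSet_Iio measurable_const measurable_const)
      exact h4.comp h1
    fun_prop
  · filter_upwards [ae_restrict_mem measurableSet_Ioo] with x hx
    have hlt := two_mul_lt_gapSign_mul_eval hr h hβ hx
    have hE := gapSign_mul_eval hr h hβ x
    have hxa : 0 < x - a := sub_pos.2 hx.1
    have hbx : 0 < b - x := sub_pos.2 hx.2
    set P := (curvePoly z).eval x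
    have hcx : c ≤ gapCofactor (cutRoot z (Λ ^ r) (gapSign β)) β x :=
      hmin (Ioo_subset_Icc_self hx)
    have hsq : (4 * Λ ^ r * c) * ((x - a) * (b - x)) ≤ P ^ 2 - 4 * Λ ^ (2 * r) := by
      have h6 : P ^ 2 - 4 * Λ ^ (2 * r) =
          (gapSign β * P - 2 * Λ ^ r) * (gapSign β * P + 2 * Λ ^ r) := by
        have := gapSign_mul_self β
        rw [pow_mul' Λ 2 r]
        linear_combination (-P ^ 2) * this
      rw [h6, hE]
      calc (4 * Λ ^ r * c) * ((x - a) * (b - x)) = (x - a) * (b - x) * c * (4 * Λ ^ r) := by ring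
        _ ≤ _ := mul_le_mul
          (mul_le_mul_of_nonneg_left hcx (mul_pos hxa hbx).le) (by linarith) (by positivity)
          (mul_pos (mul_pos hxa hbx) (hc.trans_le hcx)).le
    have hpos : 0 < √((x - a) * (b - x)) := Real.sqrt_pos.2 (mul_pos hxa hbx)
    have hle : √(4 * Λ ^ r * c) * √((x - a) * (b - x)) ≤ √(P ^ 2 - 4 * Λ ^ (2 * r)) := by
      rw [← Real.sqrt_mul hk.le]
      exact Real.sqrt_le_sqrt hsq
    have hkpos := Real.sqrt_pos.2 hk
    have hS : 0 < √(P ^ 2 - 4 * Λ ^ (2 * r)) := (mul_pos hkpos hpos).trans_le hle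
    have hsign : ‖((SignType.sign P : SignType) : ℝ)‖ = 1 := by
      have hP0 : P ≠ 0 := by
        intro h0
        rw [h0, mul_zero] at hlt
        linarith
      rcases lt_or_gt_of_ne hP0 with h1 | h1
      · rw [sign_neg h1]
        simp
      · rw [sign_pos h1]
        simp
    have hMx := hM x (Ioo_subset_Icc_self hx)
    rw [← mul_div_assoc, norm_div, norm_mul (SignType.sign P : ℝ), hsign, one_mul,
      Real.norm_of_nonneg hS.le, div_mul_div_comm, mul_one]
    exact div_le_div₀ ((norm_nonneg _).trans hMx) hMx (mul_pos hkpos hpos) hle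

/-- Integration by parts: `gapLog` vanishes at both ends of the gap, and `cutPrimitive` is a
primitive of `gapLog + log τ`. -/
theorem integral_gap {r : ℕ} [NeZero r] (hr : 2 ≤ r) {z : Fin r → ℝ} {Λ : ℝ}
    (hΛ : 0 < Λ) (h : (ofRealVec z, ((Λ ^ r : ℝ) : ℂ)) ∈ cutDomain r) {β : Fin r} (hβ : β ≠ 0) :
    ∫ x in Ioo (gapLeft z (Λ ^ r) β) (gapRight z (Λ ^ r) β),
      x * ((curvePoly z).derivative.eval x / (SignType.sign ((curvePoly z).eval x) *
        √(((curvePoly z).eval x) ^ 2 - 4 * Λ ^ (2 * r)))) =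
      (cutPrimitive z (Λ ^ r) (gapLeft z (Λ ^ r) β) - Real.log (Λ ^ r) * gapLeft z (Λ ^ r) β) -
        (cutPrimitive z (Λ ^ r) (gapRight z (Λ ^ r) β) -
          Real.log (Λ ^ r) * gapRight z (Λ ^ r) β) := by
  have hτ : 0 < Λ ^ r := pow_pos hΛ r
  have hint := integrableOn_mul_gapLog_deriv hr hΛ h hβ
  obtain ⟨e1, e2⟩ := gapLog_gapEnd hr hτ h hβ
  have hab : gapLeft z (Λ ^ r) β < gapRight z (Λ ^ r) β :=
    cutRoot_sub_one_sub_pos hr h hβ (gapSign_mem β) (gapSign_mem β)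
  have hcont : ContinuousOn (fun x => x * gapLog z (Λ ^ r) β x - cutPrimitive z (Λ ^ r) x +
      Real.log (Λ ^ r) * x) (Icc (gapLeft z (Λ ^ r) β) (gapRight z (Λ ^ r) β)) :=
    ((continuousOn_id.mul (continuousOn_gapLog hr hτ h hβ)).sub
      (continuous_cutPrimitive hr h).continuousOn).add (by fun_prop)
  have hftc := intervalIntegral.integral_eq_sub_of_hasDerivAt_of_le hab.le hcont
    (fun x hx => ?_) ((intervalIntegrable_iff_integrableOn_Ioo_of_le hab.le).2 hint)
  · rw [← integral_Ioc_eq_integral_Ioo, ← intervalIntegral.integral_of_le hab.le, hftc, e1, e2]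
    ring
  · refine (((hasDerivAt_id x).fun_mul (hasDerivAt_gapLog hr hΛ h hβ hx)).fun_sub
      (hasDerivAt_cutPrimitive hr hτ h hβ hx)).fun_add
      ((hasDerivAt_id x).const_mul (Real.log (Λ ^ r))) |>.congr_deriv ?_
    simp only [id]
    ring

/-! ### The dual periods -/

theorem orderedLog_ofReal {r : ℕ} {α β : Fin r} {t : ℝ} (h1 : α < β → 0 < t)
    (h2 : ¬α < β → t < 0) : orderedLog α β t = (Real.log t : ℂ) := by
  rw [orderedLog]
  split_ifs with h
  · rw [Complex.ofReal_log (h1 h).le]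
  · rw [← Real.log_neg_eq_log, Complex.ofReal_log (by linarith [h2 h]), Complex.ofReal_neg]

theorem cutPoint_eq_cutRoot {r : ℕ} (hr : 2 ≤ r) {z : Fin r → ℝ} {τ : ℝ} {b : Fin r → ℂ}
    (hp : (b, (τ : ℂ)) ∈ periodDomain r) (hc : centers (b, (τ : ℂ)) = ofRealVec z) {u : ℝ}
    (hu : u ∈ Icc (-1 : ℝ) 1) (α : Fin r) :
    cutPoint α ((b, (τ : ℂ)), (u : ℂ)) = (cutRoot z τ u α : ℂ) := by
  have h := centers_mem_cutDomain hr hp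
  rw [hc] at h
  rw [ofReal_cutRoot hr h hu, cutPoint, hc]

/-- For real data the potential of the cuts is the primitive of the logarithmic potential, up to
the normalization of the logarithm. -/
theorem slope_eq {r : ℕ} (hr : 2 ≤ r) {z : Fin r → ℝ} {τ : ℝ} (hτ : 0 < τ) {b : Fin r → ℂ}
    (hp : (b, (τ : ℂ)) ∈ periodDomain r) (hc : centers (b, (τ : ℂ)) = ofRealVec z) {u : ℝ}
    (hu : u ∈ Icc (-1 : ℝ) 1) (γ : Fin r) :
    slope (b, (τ : ℂ)) γ = cutPrimitive z τ (cutRoot z τ u γ) -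
      Real.log τ * (cutRoot z τ u γ - b γ) := by
  have h := centers_mem_cutDomain hr hp
  rw [hc] at h
  have hp2 : ((b, (τ : ℂ)) : (Fin r → ℂ) × ℂ).2 ≠ 0 := by
    simpa using hτ.ne'
  set x := cutRoot z τ u γ with hx
  have hlog : ∀ u' ∈ Icc (-1 : ℝ) 1, ∀ δ ≠ γ, orderedLog γ δ ((x : ℂ) - (cutRoot z τ u' δ : ℝ)) =
      (Real.log (x - cutRoot z τ u' δ) : ℂ) := by
    intro u' hu' δ hδ
    have h1 := separated_cutVec hr hp hu hu'
    rw [← Complex.ofReal_sub]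
    refine orderedLog_ofReal (fun hlt => ?_) fun hlt => ?_
    · have := (h1 γ δ hlt).1
      rw [cutVec, cutVec, cutPoint_eq_cutRoot hr hp hc hu, cutPoint_eq_cutRoot hr hp hc hu',
        ← Complex.ofReal_sub, Complex.ofReal_re] at this
      exact this
    · have := (h1 δ γ (lt_of_le_of_ne (not_lt.1 hlt) hδ)).2
      rw [cutVec, cutVec, cutPoint_eq_cutRoot hr hp hc hu, cutPoint_eq_cutRoot hr hp hc hu',
        ← Complex.ofReal_sub, Complex.ofReal_re] at this
      linarith
  have hPx : (curvePoly z).eval x = 2 * τ * u := by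
    have := prod_sub_cutRoot hr h hu x
    rw [Finset.prod_eq_zero (Finset.mem_univ γ) (sub_self _)] at this
    linarith
  -- the kernels of the potential, for real points, with `log τ` missing in the diagonal one only
  have hpt : ∀ᵐ u' ∂arcsine, ∑ δ, cutKernel (b, (τ : ℂ)) γ δ u u' =
      ((∑ δ, logPrimitive (x - cutRoot z τ u' δ) -
        Real.log τ * (x - cutRoot z τ u' γ) : ℝ) : ℂ) := by
    filter_upwards [ae_arcsine_mem] with u' hu'
    rw [← Finset.add_sum_erase _ _ (Finset.mem_univ γ),
      ← Finset.add_sum_erase _ _ (Finset.mem_univ γ)]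
    have hoff : ∀ δ ∈ Finset.univ.erase γ, cutKernel (b, (τ : ℂ)) γ δ u u' =
        (logPrimitive (x - cutRoot z τ u' δ) : ℂ) := by
      intro δ hδ
      have hne := Finset.ne_of_mem_erase hδ
      rw [cutKernel, kernel, kernelLog, if_neg hne.symm, cutVec, cutVec,
        cutPoint_eq_cutRoot hr hp hc hu, cutPoint_eq_cutRoot hr hp hc hu', ← hx,
        hlog u' hu' δ hne, logPrimitive]
      push_cast
      ring
    have hdiag : cutKernel (b, (τ : ℂ)) γ γ u u' =
        (logPrimitive (x - cutRoot z τ u' γ) - Real.log τ * (x - cutRoot z τ u' γ) : ℝ) := by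
      rw [cutKernel, kernel, kernelLog, if_pos rfl]
      have hs : ∑ δ ∈ Finset.univ.erase γ, orderedLog γ δ (cutVec ((b, (τ : ℂ)), (u : ℂ)) γ -
          cutVec ((b, (τ : ℂ)), (u' : ℂ)) δ) =
          ∑ δ ∈ Finset.univ.erase γ, (Real.log (x - cutRoot z τ u' δ) : ℂ) := by
        refine Finset.sum_congr rfl fun δ hδ => ?_
        rw [cutVec, cutVec, cutPoint_eq_cutRoot hr hp hc hu, cutPoint_eq_cutRoot hr hp hc hu',
          ← hx, hlog u' hu' δ (Finset.ne_of_mem_erase hδ)]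
      rw [hs, cutVec, cutVec, cutPoint_eq_cutRoot hr hp hc hu, cutPoint_eq_cutRoot hr hp hc hu',
        ← hx]
      rcases eq_or_ne u u' with rfl | hne
      · simp [← hx, logPrimitive]
      -- the logarithm of `∏_δ (x - y_δ) = 2τ(u - u')` gives the diagonal logarithm
      have hprod := prod_sub_cutRoot hr h hu' x
      rw [hPx] at hprod
      have hne0 : 2 * τ * u - 2 * τ * u' ≠ 0 := by
        rw [← mul_sub]
        exact mul_ne_zero (by positivity) (sub_ne_zero.2 hne)
      have hfac : ∀ δ, x - cutRoot z τ u' δ ≠ 0 := by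
        rw [← hprod] at hne0
        exact fun δ => Finset.prod_ne_zero_iff.1 hne0 δ (Finset.mem_univ δ)
      have hl := congrArg Real.log hprod
      rw [Real.log_prod fun δ _ => hfac δ, ← Finset.add_sum_erase _ _ (Finset.mem_univ γ)] at hl
      have h3 : 2 * τ * u - 2 * τ * u' = τ * (2 * u - 2 * u') := by ring
      have h5 : 2 * u - 2 * u' ≠ 0 := by
        rw [← mul_sub]
        exact mul_ne_zero two_ne_zero (sub_ne_zero.2 hne)
      rw [h3, Real.log_mul hτ.ne' h5, ← Real.log_abs (2 * u - 2 * u')] at hl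
      rw [logPrimitive, ← Complex.ofReal_sum]
      have h4 : logDist u u' - ∑ δ ∈ Finset.univ.erase γ, Real.log (x - cutRoot z τ u' δ) =
          Real.log (x - cutRoot z τ u' γ) - Real.log τ := by
        rw [logDist]
        linarith
      rw [← Complex.ofReal_sub (logDist u u'), h4]
      push_cast
      ring
    rw [hdiag, Finset.sum_congr rfl hoff, ← Complex.ofReal_sum]
    push_cast
    ring
  have hi1 : Integrable (fun u' => ∑ δ, logPrimitive (x - cutRoot z τ u' δ)) arcsine :=
    integrable_arcsine_of_continuousOn ((continuousOn_logPrimitive_sub hr h).comp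
      (f := fun u : ℝ => (x, u)) (by fun_prop) fun u hu => ⟨mem_univ _, hu⟩)
  have hi2 : Integrable (fun u' => cutRoot z τ u' γ) arcsine :=
    integrable_arcsine_of_continuousOn (continuousOn_cutRoot hr h γ)
  have hb : b γ = ((∫ u', cutRoot z τ u' γ ∂arcsine : ℝ) : ℂ) := by
    rw [← integral_complex_ofReal]
    refine (integral_cutPoint hr hp γ).symm.trans (integral_congr_ae ?_)
    filter_upwards [ae_arcsine_mem] with u' hu' using cutPoint_eq_cutRoot hr hp hc hu' γ
  have hi3 : Integrable (fun u' => Real.log τ * (x - cutRoot z τ u' γ)) arcsine :=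
    ((integrable_const x).sub hi2).const_mul _
  rw [← potential_eq_slope hr hp hp2 γ hu, potential, integral_congr_ae hpt,
    integral_complex_ofReal, integral_sub hi1 hi3, integral_const_mul,
    integral_sub (integrable_const x) hi2, integral_const, probReal_univ, one_smul, hb,
    cutPrimitive]
  push_cast
  ring

/-- The integral over a gap is a difference of the constant potentials of the adjacent cuts,
evaluated at the ends of the gap. -/
theorem cPeriod_eq {r : ℕ} [NeZero r] (hr : 2 ≤ r) {z : Fin r → ℝ} {Λ : ℝ} (hΛ : 0 < Λ)
    {b : Fin r → ℂ} (hp : (b, ((Λ ^ r : ℝ) : ℂ)) ∈ periodDomain r)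
    (hc : centers (b, ((Λ ^ r : ℝ) : ℂ)) = ofRealVec z) {β : Fin r} (hβ : β ≠ 0) :
    Real.pi * (cPeriod z Λ β : ℂ) =
      (slope (b, ((Λ ^ r : ℝ) : ℂ)) β - Real.log (Λ ^ r) * b β) -
        (slope (b, ((Λ ^ r : ℝ) : ℂ)) (β - 1) - Real.log (Λ ^ r) * b (β - 1)) := by
  have hτ : 0 < Λ ^ r := pow_pos hΛ r
  have h := centers_mem_cutDomain hr hp
  rw [hc] at h
  have h1 : ∀ x, swDiffReal z Λ x = -(1 / (2 * Real.pi)) *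
      (x * ((curvePoly z).derivative.eval x / (SignType.sign ((curvePoly z).eval x) *
        √(((curvePoly z).eval x) ^ 2 - 4 * Λ ^ (2 * r))))) := fun x => by
    rw [swDiffReal, ← mul_div_assoc, ← mul_div_assoc]
  have hpi := Real.pi_ne_zero
  have h2 : Real.pi * cPeriod z Λ β =
      (cutPrimitive z (Λ ^ r) (gapLeft z (Λ ^ r) β) - Real.log (Λ ^ r) * gapLeft z (Λ ^ r) β) -
        (cutPrimitive z (Λ ^ r) (gapRight z (Λ ^ r) β) -
          Real.log (Λ ^ r) * gapRight z (Λ ^ r) β) := by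
    rw [cPeriod, gapSegment_eq hr hΛ h hβ]
    simp only [h1]
    rw [integral_const_mul, integral_gap hr hΛ h hβ]
    field_simp
  have h3 := congrArg (fun x : ℝ => (x : ℂ)) h2
  push_cast at h3
  rw [slope_eq hr hτ hp hc (gapSign_mem β) β, slope_eq hr hτ hp hc (gapSign_mem β) (β - 1)]
  simp only [gapLeft, gapRight] at h3
  rw [h3]
  ring

theorem sum_Ioc_zero_sub {r : ℕ} [NeZero r] (f : Fin r → ℂ) (α : Fin r) :
    ∑ β ∈ Finset.Ioc 0 α, (f β - f (β - 1)) = f α - f 0 := by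
  obtain ⟨n, hn⟩ := α
  induction n with
  | zero =>
    have h : (⟨0, hn⟩ : Fin r) = 0 := Fin.ext (by simp)
    rw [h, Finset.Ioc_self, Finset.sum_empty, sub_self]
  | succ n ih =>
    have h1 : (⟨n + 1, hn⟩ : Fin r) ≠ 0 := fun h => by
      have := congrArg Fin.val h
      simp at this
    have h2 : (⟨n + 1, hn⟩ : Fin r) - 1 = ⟨n, by omega⟩ := Fin.ext (by
      rw [Fin.val_sub_one_of_ne_zero h1]
      simp)
    have h3 : Finset.Ioc 0 (⟨n + 1, hn⟩ : Fin r) =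
        insert ⟨n + 1, hn⟩ (Finset.Ioc 0 ⟨n, by omega⟩) := by
      ext β
      simp only [Finset.mem_Ioc, Finset.mem_insert, Fin.lt_def, Fin.le_def, Fin.ext_iff,
        Fin.val_zero]
      omega
    rw [h3, Finset.sum_insert (by simp [Fin.le_def]), ih (by omega), h2]
    ring

/-- The dual periods are differences of the constant potentials, by summation over the gaps. -/
theorem aDual_eq {r : ℕ} [NeZero r] (hr : 2 ≤ r) {z : Fin r → ℝ} {Λ : ℝ} (hΛ : 0 < Λ)
    {b : Fin r → ℂ} (hp : (b, ((Λ ^ r : ℝ) : ℂ)) ∈ periodDomain r)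
    (hc : centers (b, ((Λ ^ r : ℝ) : ℂ)) = ofRealVec z) (α : Fin r) :
    aDual z Λ α = 2 * Complex.I *
      ((slope (b, ((Λ ^ r : ℝ) : ℂ)) α - Real.log (Λ ^ r) * b α) -
        (slope (b, ((Λ ^ r : ℝ) : ℂ)) 0 - Real.log (Λ ^ r) * b 0)) := by
  rw [← sum_Ioc_zero_sub (fun β => slope (b, ((Λ ^ r : ℝ) : ℂ)) β - Real.log (Λ ^ r) * b β) α,
    Finset.sum_congr rfl fun β hβ => (cPeriod_eq hr hΛ hp hc
      (Finset.mem_Ioc.1 hβ).1.ne').symm, aDual, ← Finset.mul_sum]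
  push_cast
  ring

theorem ofReal_exp_log {Λ : ℝ} (hΛ : 0 < Λ) (r : ℕ) :
    Complex.exp (r * (Real.log Λ : ℂ)) = ((Λ ^ r : ℝ) : ℂ) := by
  rw [Complex.exp_nat_mul, ← Complex.ofReal_exp, Real.exp_log hΛ]
  push_cast
  rfl

theorem mem_cutDomain_of_lt {r : ℕ} (hr : 2 ≤ r) {z : Fin r → ℂ} {Λ : ℝ} (hΛ : 0 < Λ)
    (h : 8 * Λ < orderGap z) : (z, ((Λ ^ r : ℝ) : ℂ)) ∈ cutDomain r := by
  refine ⟨by linarith, ?_⟩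
  rw [Complex.norm_real, Real.norm_of_nonneg (by positivity)]
  exact pow_lt_pow_left₀ (by linarith) hΛ.le (by omega)

/-- Existence of the prepotential. -/
theorem isPrepotential_energyPrepotential {r : ℕ} [NeZero r] (hr : 2 ≤ r) :
    IsPrepotential r cutBound energyPrepotential where
  holomorphic p hp := by
    obtain ⟨L, hL, -⟩ := hasFDerivAt_energyPrepotential hr hp.1 hp.2
    exact hL.differentiableAt.differentiableWithinAt
  dual_period z Λ hz hsum hΛ hgap hdom α hα := by
    have hgap' : rootGap (ofRealVec z) = orderGap (ofRealVec z) := rootGap_ofRealVec hr hz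
    have h8 : 8 * Λ < orderGap (ofRealVec z) := by
      rw [← hgap']
      exact hgap
    have hcut := mem_cutDomain_of_lt hr hΛ h8
    have hpow : ((Λ ^ r : ℝ) : ℂ) = (Λ : ℂ) ^ r := by push_cast; rfl
    set a := aPeriod (ofRealVec z) Λ with ha
    have haP : a = -Complex.I • (ofRealVec z + meanShift (ofRealVec z) ((Λ : ℂ) ^ r)) :=
      aPeriod_eq hr (by exact_mod_cast hΛ.ne') hgap' (by rwa [← hpow])
    have hb : Complex.I • a = ofRealVec z + meanShift (ofRealVec z) ((Λ ^ r : ℝ) : ℂ) := by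
      rw [haP, smul_smul, hpow]
      simp
    have ha1 : a ∈ chamber r := hdom.1
    have ha2 : Real.exp ((Real.log Λ : ℂ)).re < cutBound a := hdom.2
    have hp := mem_periodDomain_of_lt hr ha1 ha2
    rw [ofReal_exp_log hΛ] at hp
    have hc : centers (Complex.I • a, ((Λ ^ r : ℝ) : ℂ)) = ofRealVec z := by
      rw [hb] at hp ⊢
      exact centers_of_periods hr hcut hp
    have h1 := partialA_energyPrepotential hr ha1 ha2 α
    rw [ofReal_exp_log hΛ] at h1
    refine (aDual_eq hr hΛ hp hc α).trans ?_
    rw [show partialA energyPrepotential α (aPeriod (fun α => (z α : ℂ)) Λ, (Real.log Λ : ℂ)) =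
      _ from h1, Real.log_pow]
    simp only [Pi.smul_apply, smul_eq_mul]
    push_cast
    linear_combination (-2 * r * (Real.log Λ : ℂ) * (a α - a 0)) * Complex.I_sq
  euler p hp := euler_energyPrepotential hr hp
  monodromy a l l' h h' := by
    rw [monodromy_energyPrepotential hr h.1 h.2, monodromy_energyPrepotential hr h'.1 h'.2]

/-! ### Uniqueness of the prepotential -/

/-- A holomorphic function that vanishes at the real points near some real point is zero. -/
theorem eqOn_zero_of_eventually_ofReal {f : ℂ → ℂ} {U : Set ℂ} (hU : IsOpen U)
    (hc : IsPreconnected U) (hf : DifferentiableOn ℂ f U) {t : ℝ} (ht : (t : ℂ) ∈ U)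
    (h : ∀ᶠ s : ℝ in 𝓝 t, f s = 0) : EqOn f 0 U := by
  refine (hf.analyticOnNhd hU).eqOn_zero_of_preconnected_of_frequently_eq_zero hc ht ?_
  have h1 : Tendsto (fun s : ℝ => (s : ℂ)) (𝓝[≠] t) (𝓝[≠] (t : ℂ)) :=
    Complex.continuous_ofReal.continuousWithinAt.tendsto_nhdsWithin fun s hs => by
      simpa using hs
  exact h1.frequently (h.filter_mono nhdsWithin_le_nhds).frequently

theorem halfPlane_eq {c : ℝ} (hc : 0 < c) :
    {l : ℂ | Real.exp l.re < c} = {l : ℂ | l.re < Real.log c} := by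
  ext l
  exact (Real.lt_log_iff_exp_lt hc).symm

theorem isOpen_halfPlane (c : ℝ) : IsOpen {l : ℂ | Real.exp l.re < c} :=
  isOpen_lt (by fun_prop) continuous_const

theorem isPreconnected_halfPlane {c : ℝ} (hc : 0 < c) :
    IsPreconnected {l : ℂ | Real.exp l.re < c} := by
  rw [halfPlane_eq hc]
  exact (convex_halfSpace_re_lt _).isPreconnected

theorem orderGap_ofRealVec_pos {r : ℕ} (hr : 2 ≤ r) {b : Fin r → ℝ} (hb : StrictAnti b) :
    0 < orderGap (ofRealVec b) := lt_orderGap hr fun α β h => by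
  simpa [ofRealVec] using hb h

theorem neg_I_smul_mem_chamber {r : ℕ} {b : Fin r → ℝ} (hb : StrictAnti b) (hs : ∑ α, b α = 0) :
    -Complex.I • ofRealVec b ∈ chamber r := by
  refine ⟨?_, fun α β h => ?_⟩
  · simp only [Pi.smul_apply, smul_eq_mul, ← Finset.mul_sum, ofRealVec]
    rw [← Complex.ofReal_sum, hs]
    simp
  · simpa [ofRealVec] using hb h

/-- Every purely imaginary vector of the chamber is a vector of periods for all small `Λ > 0`. -/
theorem exists_aPeriod_eq {r : ℕ} (hr : 2 ≤ r) {b : Fin r → ℝ} (hb : StrictAnti b)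
    (hs : ∑ α, b α = 0) {Λ : ℝ} (hΛ : 0 < Λ) (hlt : Λ < orderGap (ofRealVec b) / 16) :
    ∃ z : Fin r → ℝ, StrictAnti z ∧ ∑ α, z α = 0 ∧ 8 * Λ < rootGap (fun α => (z α : ℂ)) ∧
      aPeriod (fun α => (z α : ℂ)) Λ = -Complex.I • ofRealVec b := by
  have hg := orderGap_ofRealVec_pos hr hb
  have hp : (ofRealVec b, ((Λ ^ r : ℝ) : ℂ)) ∈ periodDomain r := by
    refine ⟨hg, ?_⟩
    rw [Complex.norm_real, Real.norm_of_nonneg (by positivity)]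
    exact pow_lt_pow_left₀ hlt hΛ.le (by omega)
  obtain ⟨z, hz⟩ := exists_centers_eq_ofRealVec hr hp
  obtain ⟨h1, h2⟩ := centers_spec hr hp
  rw [hz] at h1 h2
  have h3 := orderGap_sub_le hr (ofRealVec b) (ofRealVec z)
  rw [mem_closedBall_iff_norm, norm_sub_rev] at h1
  have h4 : 8 * Λ < orderGap (ofRealVec z) := by
    simp only at h1
    linarith
  have hanti : StrictAnti z := fun α β h => by
    have := orderGap_le_sub z h
    linarith
  have hcut := mem_cutDomain_of_lt hr hΛ h4
  have hpow : ((Λ ^ r : ℝ) : ℂ) = (Λ : ℂ) ^ r := by push_cast; rfl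
  have hgap := rootGap_ofRealVec hr hanti
  have hshift : ofRealVec z + meanShift (ofRealVec z) ((Λ ^ r : ℝ) : ℂ) = ofRealVec b := by
    have h5 := sub_eq_iff_eq_add.1 h2
    exact h5.symm
  refine ⟨z, hanti, ?_, ?_, ?_⟩
  -- the averages of the displacements sum to zero because `∑_γ x_γ = ∑_γ z_γ` for every `u`
  · have h5 : ∑ α, meanShift (ofRealVec z) ((Λ ^ r : ℝ) : ℂ) α = 0 := by
      simp only [meanShift]
      rw [← integral_finsetSum _ fun α _ => integrable_rootShift hr hcut α]
      refine (integral_congr_ae (g := fun _ => (0 : ℂ)) ?_).trans (by simp)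
      filter_upwards [ae_arcsine_mem] with u hu
      have := sum_root hr (mem_rootDomain_of_cutDomain hcut hu)
      simpa [root, Finset.sum_add_distrib] using this
    have h6 := congrArg (fun v : Fin r → ℂ => ∑ α, v α) hshift
    simp only [Pi.add_apply, Finset.sum_add_distrib, h5, add_zero, ofRealVec] at h6
    rw [← Complex.ofReal_sum, ← Complex.ofReal_sum, hs] at h6
    exact_mod_cast h6
  · exact h4.trans_eq hgap.symm
  · refine (aPeriod_eq hr (by exact_mod_cast hΛ.ne') hgap (by rwa [← hpow])).trans ?_
    rw [← hpow, hshift]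

/-- Slices of a prepotential are holomorphic in `l = log Λ`. -/
theorem IsPrepotential.differentiableOn_slice {r : ℕ} [NeZero r] {ρ : (Fin r → ℂ) → ℝ}
    {F : (Fin r → ℂ) × ℂ → ℂ} (hF : IsPrepotential r ρ F) {a : Fin r → ℂ} (ha : a ∈ chamber r) :
    DifferentiableOn ℂ (fun l => F (a, l)) {l : ℂ | Real.exp l.re < ρ a} :=
  hF.holomorphic.comp (f := fun l : ℂ => (a, l)) (by fun_prop) fun _ hl => ⟨ha, hl⟩

/-- The real dual periods and the homogeneity determine a prepotential up to a multiple of `Λ²`, and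
the monodromy in `Λ^(2r)` excludes this term. -/
theorem IsPrepotential.eq_of_imaginary {r : ℕ} [NeZero r] (hr : 2 ≤ r) {ρ : (Fin r → ℂ) → ℝ}
    {F G : (Fin r → ℂ) × ℂ → ℂ} (hρ : IsBound r ρ) (hF : IsPrepotential r ρ F)
    (hG : IsPrepotential r ρ G) {b : Fin r → ℝ} (hb : StrictAnti b) (hs : ∑ α, b α = 0) {l : ℂ}
    (hl : Real.exp l.re < ρ (-Complex.I • ofRealVec b)) :
    F (-Complex.I • ofRealVec b, l) = G (-Complex.I • ofRealVec b, l) := by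
  set a := -Complex.I • ofRealVec b with ha
  have hac : a ∈ chamber r := neg_I_smul_mem_chamber hb hs
  have hρa : 0 < ρ a := hρ.2 a hac
  have hg := orderGap_ofRealVec_pos hr hb
  set U := {l : ℂ | Real.exp l.re < ρ a} with hUdef
  have hUo : IsOpen U := isOpen_halfPlane _
  have hUc : IsPreconnected U := isPreconnected_halfPlane hρa
  have dF := hF.differentiableOn_slice hac
  have dG := hG.differentiableOn_slice hac
  set h : ℂ → ℂ := fun l => F (a, l) - G (a, l) with hh
  have dh : DifferentiableOn ℂ h U := dF.sub dG
  have dh' : DifferentiableOn ℂ (deriv h) U := dh.deriv hUo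
  -- the differential equation `h' = 2h` on a real ray
  have hreal : ∀ s : ℝ, Real.exp s < ρ a → Real.exp s < orderGap (ofRealVec b) / 16 →
      deriv h s - 2 * h s = 0 := by
    intro s hs1 hs2
    obtain ⟨z, z1, z2, z3, z4⟩ := exists_aPeriod_eq hr hb hs (Real.exp_pos s) hs2
    have hmem : (a, (s : ℂ)) ∈ domain r ρ := ⟨hac, by simpa using hs1⟩
    have hmem' : (aPeriod (fun α => (z α : ℂ)) (Real.exp s), (Real.log (Real.exp s) : ℂ)) ∈
        domain r ρ := by
      rw [z4, Real.log_exp]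
      exact hmem
    have hA : ∀ α, α ≠ 0 → partialA F α (a, (s : ℂ)) = partialA G α (a, (s : ℂ)) := by
      intro α hα
      have e1 := hF.dual_period z _ z1 z2 (Real.exp_pos s) z3 hmem' α hα
      have e2 := hG.dual_period z _ z1 z2 (Real.exp_pos s) z3 hmem' α hα
      rw [e1, z4, Real.log_exp, neg_inj] at e2
      exact e2
    have e1 := hF.euler _ hmem
    have e2 := hG.euler _ hmem
    rw [Finset.sum_congr rfl fun α hα =>
      congrArg (fun t => a α * t) (hA α (Finset.ne_of_mem_erase hα))] at e1
    have hsU : (s : ℂ) ∈ U := by simpa [hUdef] using hs1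
    have e3 : deriv h s = partialLog F (a, (s : ℂ)) - partialLog G (a, (s : ℂ)) :=
      deriv_fun_sub (dF.differentiableAt (hUo.mem_nhds hsU))
        (dG.differentiableAt (hUo.mem_nhds hsU))
    rw [e3]
    simp only [hh]
    linear_combination e1 - e2
  set m := min (ρ a) (orderGap (ofRealVec b) / 16) with hm
  have hm0 : 0 < m := lt_min hρa (by positivity)
  have hode : EqOn (fun l => deriv h l - 2 * h l) 0 U := by
    have hlt : Real.exp (Real.log m - 1) < m := by
      rw [← Real.lt_log_iff_exp_lt hm0]
      linarith
    refine eqOn_zero_of_eventually_ofReal hUo hUc (dh'.sub (dh.const_mul 2))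
      (t := Real.log m - 1) ?_ ?_
    · have : Real.exp (Real.log m - 1) < ρ a := hlt.trans_le (min_le_left _ _)
      simpa only [hUdef, mem_ofPred_eq, Complex.ofReal_re] using this
    · filter_upwards [Real.continuous_exp.continuousAt.eventually_lt continuousAt_const hlt]
        with s hs1
      exact hreal s (hs1.trans_le (min_le_left _ _)) (hs1.trans_le (min_le_right _ _))
  -- hence `h` is a multiple of `exp (2l)`
  obtain ⟨c, hc⟩ : ∃ c, ∀ l ∈ U, h l = c * Complex.exp (2 * l) := by
    have hd : ∀ l ∈ U, HasDerivAt (fun l => h l * Complex.exp (-(2 * l))) 0 l := by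
      intro l hl
      have h1 := (dh.differentiableAt (hUo.mem_nhds hl)).hasDerivAt
      have h2 : HasDerivAt (fun l : ℂ => Complex.exp (-(2 * l)))
          (Complex.exp (-(2 * l)) * -(2 * 1)) l :=
        (((hasDerivAt_id l).const_mul 2).neg).cexp
      refine (h1.fun_mul h2).congr_deriv ?_
      have h3 := hode hl
      simp only [Pi.zero_apply] at h3
      linear_combination Complex.exp (-(2 * l)) * h3
    refine ⟨h l * Complex.exp (-(2 * l)), fun l' hl' => ?_⟩
    have hconst := hUo.is_const_of_deriv_eq_zero hUc
      (fun l hl => (hd l hl).differentiableAt.differentiableWithinAt)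
      (fun l hl => (hd l hl).deriv) hl' (show l ∈ U from hl)
    rw [← hconst, mul_assoc, ← Complex.exp_add]
    simp
  -- the monodromy forces the constant to vanish
  have hshift : ∀ l ∈ U, l + Real.pi * Complex.I / r ∈ U := by
    intro l hl
    have : (l + Real.pi * Complex.I / r).re = l.re := by
      have h1 : (Real.pi * Complex.I / r : ℂ) = ((Real.pi / r : ℝ) : ℂ) * Complex.I := by
        push_cast
        ring
      rw [h1]
      simp
    simpa only [hUdef, mem_ofPred_eq, this] using hl
  have hlU : l ∈ U := hl
  have hl1 : l - 1 ∈ U := by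
    refine lt_trans (Real.exp_lt_exp.2 ?_) hl
    simp
  have hmono : h (l + Real.pi * Complex.I / r) - h l =
      h (l - 1 + Real.pi * Complex.I / r) - h (l - 1) := by
    have e1 := hF.monodromy a l (l - 1) ⟨hac, hlU⟩ ⟨hac, hl1⟩
    have e2 := hG.monodromy a l (l - 1) ⟨hac, hlU⟩ ⟨hac, hl1⟩
    simp only [hh]
    linear_combination e1 - e2
  rw [hc _ (hshift l hlU), hc _ hlU, hc _ (hshift _ hl1), hc _ hl1] at hmono
  set q := Complex.exp (2 * (Real.pi * Complex.I / r)) with hq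
  -- here `r ≥ 2` is needed: `Λ²` has nontrivial monodromy in `Λ^(2r)`
  have hq1 : q ≠ 1 := by
    have h1 : (2 * (Real.pi * Complex.I / r) : ℂ) = 2 * Real.pi * Complex.I / r := by ring
    rw [hq, h1]
    exact (Complex.isPrimitiveRoot_exp r (by omega)).ne_one (by omega)
  have he1 : Complex.exp (2 * (l + Real.pi * Complex.I / r)) = Complex.exp (2 * l) * q := by
    rw [mul_add, Complex.exp_add]
  have he2 : Complex.exp (2 * (l - 1 + Real.pi * Complex.I / r)) =
      Complex.exp (2 * l) * Complex.exp (-2) * q := by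
    rw [mul_add, mul_sub, sub_eq_add_neg, Complex.exp_add, Complex.exp_add, mul_one]
  have he3 : Complex.exp (2 * (l - 1)) = Complex.exp (2 * l) * Complex.exp (-2) := by
    rw [mul_sub, sub_eq_add_neg, Complex.exp_add, mul_one]
  rw [he1, he2, he3] at hmono
  have hne : (1 : ℂ) - Complex.exp (-2) ≠ 0 := by
    have h1 : Complex.exp (-2) = ((Real.exp (-2) : ℝ) : ℂ) := by
      push_cast
      rfl
    have h2 : Real.exp (-2) < 1 := Real.exp_lt_one_iff.2 (by norm_num)
    rw [h1, sub_ne_zero]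
    exact_mod_cast h2.ne'
  have hprod : c * Complex.exp (2 * l) * ((q - 1) * (1 - Complex.exp (-2))) = 0 := by
    linear_combination hmono
  have hzero : h l = 0 := by
    rw [hc l hlU]
    exact (mul_eq_zero.1 hprod).resolve_right (mul_ne_zero (sub_ne_zero.2 hq1) hne)
  exact sub_eq_zero.1 hzero

/-- Uniqueness of the prepotential: a vector of the chamber is joined to purely imaginary ones by a
complex line. -/
theorem IsPrepotential.eqOn {r : ℕ} [NeZero r] (hr : 2 ≤ r) {ρ : (Fin r → ℂ) → ℝ}
    {F G : (Fin r → ℂ) × ℂ → ℂ} (hρ : IsBound r ρ) (hF : IsPrepotential r ρ F)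
    (hG : IsPrepotential r ρ G) : EqOn F G (domain r ρ) := by
  rintro ⟨a, l⟩ ⟨hac, hl⟩
  simp only at hac hl
  set x : Fin r → ℝ := fun α => (Complex.I * a α).re with hx
  set y : Fin r → ℝ := fun α => (Complex.I * a α).im with hy
  have hsum : ∑ α, Complex.I * a α = 0 := by rw [← Finset.mul_sum, hac.1, mul_zero]
  have hxs : ∑ α, x α = 0 := by
    rw [hx, ← Complex.re_sum, hsum, Complex.zero_re]
  have hys : ∑ α, y α = 0 := by
    rw [hy, ← Complex.im_sum, hsum, Complex.zero_im]
  have hxa : StrictAnti x := fun α β h => hac.2 α β h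
  -- the complex line through `a` that is purely imaginary, `a = -i b` with real `b`, at real
  -- parameters
  set A : ℂ → Fin r → ℂ := fun ζ => -Complex.I • (ofRealVec x + ζ • ofRealVec y) with hA
  have hAcont : Continuous A := by
    rw [hA]
    fun_prop
  have hAdiff : Differentiable ℂ A := by
    rw [hA]
    fun_prop
  have hAI : A Complex.I = a := by
    funext α
    have h1 : (x α : ℂ) + Complex.I * (y α : ℂ) = Complex.I * a α := by
      rw [mul_comm Complex.I (y α : ℂ)]
      exact Complex.re_add_im (Complex.I * a α)
    simp only [hA, Pi.smul_apply, Pi.add_apply, smul_eq_mul, ofRealVec]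
    rw [h1, ← mul_assoc]
    simp
  have hAre : ∀ t : ℝ, A t = -Complex.I • ofRealVec fun α => x α + t * y α := by
    intro t
    funext α
    simp only [hA, Pi.smul_apply, Pi.add_apply, smul_eq_mul, ofRealVec]
    push_cast
    rfl
  have hAmem : ∀ ζ : ℂ, StrictAnti (fun α => x α + ζ.re * y α) → A ζ ∈ chamber r := by
    intro ζ h
    refine ⟨?_, fun α β hαβ => ?_⟩
    · simp only [hA, Pi.smul_apply, Pi.add_apply, smul_eq_mul, ← Finset.mul_sum, ofRealVec,
        Finset.sum_add_distrib]
      rw [← Complex.ofReal_sum, ← Complex.ofReal_sum, hxs, hys]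
      simp
    · simpa [hA, ofRealVec, add_comm] using h hαβ
  -- near the imaginary axis the line stays in the chamber
  have hnhds : ∀ᶠ t : ℝ in 𝓝 0, StrictAnti (fun α => x α + t * y α) := by
    have h1 : ∀ α β : Fin r, α < β → ∀ᶠ t : ℝ in 𝓝 0, x β + t * y β < x α + t * y α := by
      intro α β h
      refine ContinuousAt.eventually_lt (by fun_prop) (by fun_prop) ?_
      simpa using hxa h
    have h2 : ∀ᶠ t : ℝ in 𝓝 0, ∀ α β : Fin r, α < β → x β + t * y β < x α + t * y α := by
      simp only [eventually_all]
      exact h1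
    filter_upwards [h2] with t ht α β h using ht α β h
  obtain ⟨ε, hε, hball⟩ := Metric.eventually_nhds_iff_ball.1 hnhds
  have hanti : ∀ t : ℝ, |t| ≤ ε / 2 → StrictAnti (fun α => x α + t * y α) := fun t ht =>
    hball t (by
      rw [mem_ball_zero_iff, Real.norm_eq_abs]
      linarith)
  -- a compact rectangle containing `0` and `i`, on which the bound `ρ` stays above some `m > 0`
  set R : Set ℂ := Icc (-(ε / 2)) (ε / 2) ×ℂ Icc (-1) 2 with hR
  have hRc : IsCompact R := isCompact_Icc.reProdIm isCompact_Icc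
  have hRmem : ∀ ζ ∈ R, A ζ ∈ chamber r := fun ζ hζ => hAmem ζ (hanti _ (abs_le.2 hζ.1))
  have h0R : (0 : ℂ) ∈ R := by
    refine ⟨⟨?_, ?_⟩, ⟨?_, ?_⟩⟩ <;> simp <;> positivity
  obtain ⟨ζ₀, hζ₀, hmin⟩ := hRc.exists_isMinOn ⟨0, h0R⟩
    (hρ.1.comp hAcont.continuousOn hRmem)
  set m := ρ (A ζ₀) with hm
  have hm0 : 0 < m := hρ.2 _ (hRmem _ hζ₀)
  set V : Set ℂ := Ioo (-(ε / 2)) (ε / 2) ×ℂ Ioo (-1) 2 with hV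
  have hVR : V ⊆ R := fun ζ hζ => ⟨Ioo_subset_Icc_self hζ.1, Ioo_subset_Icc_self hζ.2⟩
  have hVo : IsOpen V := isOpen_Ioo.reProdIm isOpen_Ioo
  have hVc : IsPreconnected V :=
    (((convex_Ioo _ _).linear_preimage Complex.reLm).inter
      ((convex_Ioo _ _).linear_preimage Complex.imLm)).isPreconnected
  have hIV : Complex.I ∈ V := by
    refine ⟨⟨?_, ?_⟩, ⟨?_, ?_⟩⟩ <;> simp <;> positivity
  have h0V : ((0 : ℝ) : ℂ) ∈ V := by
    refine ⟨⟨?_, ?_⟩, ⟨?_, ?_⟩⟩ <;> simp <;> positivity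
  -- for small `l` the identity theorem applies on the line, with `l` fixed
  have hsmall : ∀ l : ℂ, Real.exp l.re < m → F (a, l) - G (a, l) = 0 := by
    intro l hl
    have hdom : ∀ ζ ∈ V, (A ζ, l) ∈ domain r ρ := fun ζ hζ =>
      ⟨hRmem _ (hVR hζ), hl.trans_le (hmin (hVR hζ))⟩
    have hd : DifferentiableOn ℂ (fun ζ => F (A ζ, l) - G (A ζ, l)) V := by
      have h1 : DifferentiableOn ℂ (fun ζ => (A ζ, l)) V :=
        (hAdiff.prodMk (differentiable_const l)).differentiableOn
      exact (hF.holomorphic.comp h1 hdom).sub (hG.holomorphic.comp h1 hdom)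
    have hz := eqOn_zero_of_eventually_ofReal hVo hVc hd h0V (by
      filter_upwards [Metric.ball_mem_nhds (0 : ℝ) (half_pos hε)] with t ht
      rw [mem_ball_zero_iff, Real.norm_eq_abs] at ht
      have htV : (t : ℂ) ∈ V := by
        have := abs_lt.1 ht
        exact ⟨⟨by simpa using this.1, by simpa using this.2⟩, by simp⟩
      have h2 : ∑ α, (x α + t * y α) = 0 := by
        rw [Finset.sum_add_distrib, ← Finset.mul_sum, hxs, hys]
        simp
      have h3 := (hdom _ htV).2
      simp only at h3
      rw [hAre] at h3 ⊢
      rw [hF.eq_of_imaginary hr hρ hG (hanti t ht.le) h2 h3, sub_self])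
    have := hz hIV
    simpa only [hAI, Pi.zero_apply] using this
  have hρa : 0 < ρ a := hρ.2 a hac
  -- for the remaining `l` it applies in `l`, with `a` fixed
  have hfin := eqOn_zero_of_eventually_ofReal (isOpen_halfPlane (ρ a))
    (isPreconnected_halfPlane hρa)
    ((hF.differentiableOn_slice hac).sub (hG.differentiableOn_slice hac))
    (t := Real.log (min m (ρ a)) - 1) (by
      have h1 : Real.exp (Real.log (min m (ρ a)) - 1) < min m (ρ a) := by
        rw [← Real.lt_log_iff_exp_lt (lt_min hm0 hρa)]
        linarith
      have := h1.trans_le (min_le_right _ _)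
      simpa only [mem_ofPred_eq, Complex.ofReal_re] using this) (by
      have h1 : Real.exp (Real.log (min m (ρ a)) - 1) < m := by
        refine lt_of_lt_of_le ?_ (min_le_left m (ρ a))
        rw [← Real.lt_log_iff_exp_lt (lt_min hm0 hρa)]
        linarith
      filter_upwards [Real.continuous_exp.continuousAt.eventually_lt continuousAt_const h1]
        with s hs using hsmall s (by simpa using hs))
  exact sub_eq_zero.1 (hfin hl)

/-! ### The perturbative part -/

theorem IsPrepotential.mono {r : ℕ} [NeZero r] {ρ ρ' : (Fin r → ℂ) → ℝ}
    {F : (Fin r → ℂ) × ℂ → ℂ} (hF : IsPrepotential r ρ F) (h : ∀ a, ρ' a ≤ ρ a) :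
    IsPrepotential r ρ' F := by
  have hsub : domain r ρ' ⊆ domain r ρ := fun p hp => ⟨hp.1, hp.2.trans_le (h _)⟩
  exact ⟨hF.holomorphic.mono hsub,
    fun z Λ h1 h2 h3 h4 h5 => hF.dual_period z Λ h1 h2 h3 h4 (hsub h5),
    fun p hp => hF.euler p (hsub hp),
    fun a l l' h1 h2 => hF.monodromy a l l' (hsub h1) (hsub h2)⟩

theorem differentiableAt_energy {r : ℕ} (hr : 2 ≤ r) {p : (Fin r → ℂ) × ℂ}
    (hp : p ∈ periodDomain r) : DifferentiableAt ℂ energy p :=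
  (hasFDerivAt_energy hr hp).choose_spec.1.differentiableAt

/-- The energy differs from that of collapsed cuts by `O(τ²)`, `τ = Λ^r`, since it is even in
`τ`. -/
theorem exists_norm_energy_sub_le {r : ℕ} (hr : 2 ≤ r) {K : Set (Fin r → ℂ)} (hK : IsCompact K)
    {d : ℝ} (hd : 0 < d) (hKd : ∀ b ∈ K, d < orderGap b / 16) :
    ∃ C : ℝ, ∀ b ∈ K, ∀ τ : ℂ, ‖τ‖ < d ^ r → ‖energy (b, τ) - energy (b, 0)‖ ≤ C * ‖τ‖ ^ 2 := by
  have hmem : ∀ b ∈ K, ∀ τ : ℂ, ‖τ‖ ≤ d ^ r → (b, τ) ∈ periodDomain r := fun b hb τ hτ =>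
    ⟨by linarith [hKd b hb], hτ.trans_lt (pow_lt_pow_left₀ (hKd b hb) hd.le (by omega))⟩
  have hR : 0 < d ^ r := pow_pos hd r
  obtain ⟨M, hM⟩ := (hK.prod (isCompact_closedBall (0 : ℂ) (d ^ r))).exists_bound_of_continuousOn
    (f := fun p : (Fin r → ℂ) × ℂ => energy p - energy (p.1, 0)) (by
      rintro ⟨b, τ⟩ ⟨hb, hτ⟩
      rw [mem_closedBall_zero_iff] at hτ
      have h1 := (differentiableAt_energy hr (hmem b hb τ hτ)).continuousAt
      have h2 := (differentiableAt_energy hr (hmem b hb 0 (by simpa using hR.le))).continuousAt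
      have h3 : ContinuousAt (fun p : (Fin r → ℂ) × ℂ => energy (p.1, 0)) (b, τ) :=
        ContinuousAt.comp (g := energy) (f := fun p : (Fin r → ℂ) × ℂ => (p.1, (0 : ℂ))) h2
          (by fun_prop)
      exact (h1.sub h3).continuousWithinAt)
  refine ⟨M / (d ^ r) ^ 2, fun b hb τ hτ => ?_⟩
  have h1 := norm_sub_le_of_even (f := fun τ => energy (b, τ)) hR
    (fun τ hτ => by
      rw [mem_ball_zero_iff] at hτ
      have h2 := differentiableAt_energy hr (hmem b hb τ hτ.le)
      exact (DifferentiableAt.comp τ (g := energy) (f := fun τ : ℂ => (b, τ)) h2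
        (by fun_prop)).differentiableWithinAt)
    (fun τ hτ => by
      rw [mem_ball_zero_iff] at hτ
      exact energy_neg hr (hmem b hb τ hτ.le))
    (fun τ hτ => hM (b, τ) ⟨hb, Metric.ball_subset_closedBall hτ⟩)
    (mem_ball_zero_iff.2 hτ)
  calc _ ≤ _ := h1
    _ = _ := by
      rw [div_pow]
      ring

/-- By uniqueness on the smaller of the two domains, every prepotential is `energyPrepotential` near
`Λ = 0`, to which `exists_norm_energy_sub_le` applies. -/
theorem IsPrepotential.exists_norm_sub_pertPart_le {r : ℕ} [NeZero r] (hr : 2 ≤ r)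
    {ρ : (Fin r → ℂ) → ℝ} {F : (Fin r → ℂ) × ℂ → ℂ} (hρ : IsBound r ρ)
    (hF : IsPrepotential r ρ F) {K : Set (Fin r → ℂ)} (hKc : K ⊆ chamber r) (hK : IsCompact K) :
    ∃ C δ : ℝ, 0 < δ ∧ ∀ a ∈ K, ∀ l : ℂ, ‖Complex.exp l‖ < δ → (a, l) ∈ domain r ρ ∧
      ‖F (a, l) - pertPart a l‖ ≤ C * ‖Complex.exp l‖ ^ (2 * r) := by
  rcases K.eq_empty_or_nonempty with rfl | hne
  · exact ⟨0, 1, one_pos, fun a ha => absurd ha (notMem_empty a)⟩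
  have hcb := isBound_cutBound hr
  set ρ' : (Fin r → ℂ) → ℝ := fun a => min (ρ a) (cutBound a) with hρ'
  have hb : IsBound r ρ' :=
    ⟨hρ.1.inf hcb.1, fun a ha => lt_min (hρ.2 a ha) (hcb.2 a ha)⟩
  have heq := (hF.mono fun a => min_le_left (ρ a) (cutBound a)).eqOn hr hb
    ((isPrepotential_energyPrepotential hr).mono fun a => min_le_right (ρ a) (cutBound a))
  obtain ⟨a₀, ha₀, hmin⟩ := hK.exists_isMinOn hne (hb.1.mono hKc)
  have hd0 : 0 < ρ' a₀ := hb.2 a₀ (hKc ha₀)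
  have hlt : ∀ a ∈ K, ρ' a₀ / 2 < ρ' a := fun a ha => by
    have h1 : ρ' a₀ ≤ ρ' a := hmin ha
    linarith
  obtain ⟨C, hC⟩ := exists_norm_energy_sub_le hr (hK.image (continuous_const_smul Complex.I))
    (half_pos hd0) (by
      rintro b ⟨a, ha, rfl⟩
      exact (hlt a ha).trans_le (min_le_right _ _))
  refine ⟨C, ρ' a₀ / 2, half_pos hd0, fun a ha l hl => ?_⟩
  rw [Complex.norm_exp] at hl ⊢
  have hdom : (a, l) ∈ domain r ρ' := ⟨hKc ha, hl.trans (hlt a ha)⟩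
  refine ⟨⟨hdom.1, hdom.2.trans_le (min_le_left _ _)⟩, ?_⟩
  have h1 := hC (Complex.I • a) ⟨a, ha, rfl⟩ (Complex.exp (r * l)) (by
    rw [norm_exp_nat_mul]
    exact pow_lt_pow_left₀ hl (Real.exp_pos _).le (by omega))
  rw [heq hdom, pertPart_eq hr (hKc ha), energyPrepotential, sub_sub_sub_cancel_right]
  refine h1.trans_eq ?_
  rw [norm_exp_nat_mul, ← pow_mul, mul_comm r 2]

/-! ### Mellin transforms divided by the Gamma function -/

theorem inv_Gamma_mul_Gamma_add_nat {w : ℂ} {k : ℕ} (hw : -(k : ℝ) < w.re) :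
    (Complex.Gamma w)⁻¹ * Complex.Gamma (w + k) = (ascPochhammer ℂ k).eval w := by
  by_cases h : ∀ j : ℕ, w ≠ -j
  · rw [← Complex.Gamma_add_nat_div_Gamma_eq w h]
    field_simp
  · push Not at h
    obtain ⟨j, rfl⟩ := h
    have hjk : j < k := by
      simp only [Complex.neg_re, Complex.natCast_re] at hw
      exact_mod_cast neg_lt_neg_iff.mp hw
    rw [Complex.Gamma_neg_nat_eq_zero, inv_zero, zero_mul,
      ascPochhammer_eval_neg_coe_nat_of_lt hjk]

theorem hasMellin_exp_neg_mul_pow {w : ℂ} {k : ℕ} (hw : -(k : ℝ) < w.re) :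
    HasMellin (fun t : ℝ => Complex.exp (-t) * (t : ℂ) ^ k) w (Complex.Gamma (w + k)) := by
  have hre : 0 < (w + k).re := by simp; linarith
  have hEq : ∀ t ∈ Ioi (0 : ℝ), Complex.exp (-t) * (t : ℂ) ^ (w + k - 1) =
      (t : ℂ) ^ (w - 1) • (Complex.exp (-t) * (t : ℂ) ^ k) := by
    intro t ht
    have ht' : (t : ℂ) ≠ 0 := Complex.ofReal_ne_zero.mpr (ne_of_gt ht)
    rw [show w + k - 1 = (w - 1) + k by ring, Complex.cpow_add _ _ ht', Complex.cpow_natCast,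
      smul_eq_mul]
    ring
  have hconv := Complex.GammaIntegral_convergent hre
  refine ⟨?_, ?_⟩
  · refine (hconv.congr_fun ?_ measurableSet_Ioi)
    intro t ht
    simp only
    rw [← hEq t ht]
    simp
  · rw [Complex.Gamma_eq_integral hre, mellin, Complex.GammaIntegral]
    refine (setIntegral_congr_fun measurableSet_Ioi ?_).symm
    intro t ht
    simp only
    rw [← hEq t ht]
    simp

/-- If `f` decays exponentially and extends analytically through `0`, then `mellin f / Γ` is entire.
Subtracting `exp (-t)` times a Taylor polynomial of `exp t * f t` from `f` moves the half-plane of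
convergence to the left, and the Mellin transform of `exp (-t) * t ^ k` divided by `Γ w` is the
polynomial `w (w + 1) ⋯ (w + k - 1)`. -/
theorem exists_differentiable_eq_inv_Gamma_mul_mellin {f : ℝ → ℂ} {g : ℂ → ℂ} {a : ℝ} (ha : 0 < a)
    (hfc : LocallyIntegrableOn f (Ioi 0)) (htop : f =O[atTop] fun t => Real.exp (-a * t))
    (hg : AnalyticAt ℂ g 0) (hfg : ∀ t : ℝ, 0 < t → f t = g t) :
    ∃ H : ℂ → ℂ, Differentiable ℂ H ∧
      ∀ w : ℂ, 0 < w.re → H w = (Complex.Gamma w)⁻¹ * mellin f w := by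
  -- the Taylor coefficients of `exp t * f t`
  obtain ⟨p, hp⟩ : AnalyticAt ℂ (fun z => g z * Complex.exp z) 0 := hg.mul (by fun_prop)
  let q : ℕ → ℝ → ℂ := fun n t => ∑ k ∈ Finset.range n, (t : ℂ) ^ k * p.coeff k
  let φ : ℕ → ℝ → ℂ := fun n t => f t - Complex.exp (-t) * q n t
  have hq : ∀ n, Continuous (q n) := fun n => by
    simp only [q]; fun_prop
  have hloc : ∀ n, LocallyIntegrableOn (φ n) (Ioi 0) := fun n => by
    refine hfc.sub ?_
    have : Continuous (fun t : ℝ => Complex.exp (-t) * q n t) := by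
      have := hq n
      fun_prop
    exact (this.locallyIntegrable).locallyIntegrableOn _
  have hzero : ∀ n, φ n =O[𝓝[>] 0] (fun t : ℝ => t ^ (-(-(n : ℝ)))) := fun n => by
    have h1 := hp.isBigO_sub_partialSum_pow n
    have h2 : Tendsto (fun t : ℝ => (t : ℂ)) (𝓝[>] 0) (𝓝 0) := by
      have : Tendsto (fun t : ℝ => (t : ℂ)) (𝓝 0) (𝓝 ((0 : ℝ) : ℂ)) :=
        Complex.continuous_ofReal.tendsto 0
      simpa using this.mono_left nhdsWithin_le_nhds
    have h3 := h1.comp_tendsto h2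
    have h4 : (fun t : ℝ => Complex.exp (-t)) =O[𝓝[>] 0] (fun _ => (1 : ℝ)) := by
      refine Tendsto.isBigO_one (c := Complex.exp (-((0 : ℝ) : ℂ))) ℝ ?_
      refine Tendsto.mono_left ?_ nhdsWithin_le_nhds
      exact Continuous.tendsto (f := fun t : ℝ => Complex.exp (-(t : ℂ))) (by fun_prop) 0
    refine (h4.mul h3).congr' ?_ ?_
    · filter_upwards [self_mem_nhdsWithin] with t ht
      simp only [Function.comp, FormalMultilinearSeries.partialSum,
        FormalMultilinearSeries.apply_eq_pow_smul_coeff, zero_add, smul_eq_mul, φ, q, hfg t ht]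
      rw [mul_sub, mul_comm (g t), ← mul_assoc, ← Complex.exp_add]
      simp
    · filter_upwards [self_mem_nhdsWithin] with t ht
      have : 0 < t := ht
      simp [abs_of_pos this]
  have htopn : ∀ n, φ n =O[atTop] fun t => Real.exp (-(min a (1 / 2)) * t) := fun n => by
    have hexp : ∀ b, min a (1 / 2) ≤ b → (fun t : ℝ => Real.exp (-b * t)) =O[atTop]
        fun t => Real.exp (-(min a (1 / 2)) * t) := fun b hb => by
      refine Asymptotics.IsBigO.of_bound 1 ?_
      filter_upwards [eventually_ge_atTop 0] with t ht
      rw [one_mul, Real.norm_of_nonneg (Real.exp_pos _).le, Real.norm_of_nonneg (Real.exp_pos _).le]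
      gcongr
    refine (htop.trans (hexp a (min_le_left _ _))).sub ?_
    simp only [q, Finset.mul_sum]
    refine Asymptotics.IsBigO.fun_sum fun k _ => ?_
    have h := (isLittleO_pow_exp_pos_mul_atTop (b := 1 / 2) k (by norm_num)).isBigO
    have h5 : (fun t : ℝ => Complex.exp (-t)) =O[atTop] fun t => Real.exp (-t) := by
      refine Asymptotics.IsBigO.of_bound 1 (Eventually.of_forall fun t => ?_)
      rw [Complex.norm_exp]
      simp
    have h6 : (fun t : ℝ => (t : ℂ) ^ k * p.coeff k) =O[atTop] fun t => t ^ k := by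
      refine Asymptotics.IsBigO.of_bound ‖p.coeff k‖ (Eventually.of_forall fun t => ?_)
      simp [mul_comm]
    refine ((h5.mul (h6.trans h)).congr_right fun t => ?_).trans (hexp (1 / 2) (min_le_right _ _))
    rw [← Real.exp_add]
    congr 1
    ring
  have hmin : 0 < min a (1 / 2) := lt_min ha (by norm_num)
  -- `W n` is the continuation to `Re w > -n`; the functions agree on their overlaps
  let W : ℕ → ℂ → ℂ := fun n w =>
    ∑ k ∈ Finset.range n, p.coeff k * (ascPochhammer ℂ k).eval w +
      (Complex.Gamma w)⁻¹ * mellin (φ n) w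
  have hWd : ∀ (n : ℕ) (w : ℂ), -(n : ℝ) < w.re → DifferentiableAt ℂ (W n) w := fun n w hw => by
    refine DifferentiableAt.add ?_ (Complex.differentiable_one_div_Gamma.differentiableAt.mul
      (mellin_differentiableAt_of_isBigO_rpow_exp hmin (hloc n) (htopn n) (hzero n) hw))
    refine DifferentiableAt.fun_sum fun k _ => ?_
    exact ((ascPochhammer ℂ k).differentiable.differentiableAt).const_mul _
  have hWs : ∀ (n : ℕ) (w : ℂ), -(n : ℝ) < w.re → W n w = W (n + 1) w := fun n w hw => by
    have hc : MellinConvergent (φ n) w :=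
      mellinConvergent_of_isBigO_rpow_exp hmin (hloc n) (htopn n) (hzero n) hw
    have he := hasMellin_exp_neg_mul_pow hw
    have hce := hasMellin_const_smul he.1 (p.coeff n)
    have hs := (hasMellin_sub hc hce.1).2
    have hφ : φ (n + 1) = fun t => φ n t - p.coeff n • (Complex.exp (-t) * (t : ℂ) ^ n) := by
      funext t
      simp only [φ, q, Finset.sum_range_succ, smul_eq_mul]
      ring
    simp only [W, hφ]
    rw [hs, hce.2, he.2, Finset.sum_range_succ, ← inv_Gamma_mul_Gamma_add_nat hw]
    simp only [smul_eq_mul]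
    ring
  have hWle : ∀ (n m : ℕ) (w : ℂ), n ≤ m → -(n : ℝ) < w.re → W n w = W m w := fun n m w hnm hw => by
    induction m, hnm using Nat.le_induction with
    | base => rfl
    | succ m hm ih =>
      rw [ih]
      refine hWs m w (lt_of_le_of_lt ?_ hw)
      have : (n : ℝ) ≤ m := by exact_mod_cast hm
      linarith
  have hidx : ∀ w : ℂ, -((⌈‖w‖⌉₊ + 1 : ℕ) : ℝ) < w.re := fun w => by
    have h1 := Nat.le_ceil ‖w‖
    have h2 := neg_le_of_abs_le (Complex.abs_re_le_norm w)
    push_cast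
    linarith
  -- any index beyond `‖w‖` serves at `w`
  refine ⟨fun w => W (⌈‖w‖⌉₊ + 1) w, fun w₀ => ?_, fun w hw => ?_⟩
  · have hloc' : (fun w => W (⌈‖w‖⌉₊ + 1) w) =ᶠ[𝓝 w₀] W (⌈‖w₀‖⌉₊ + 2) := by
      filter_upwards [Metric.ball_mem_nhds w₀ one_pos] with w hw
      refine hWle _ _ w ?_ (hidx w)
      have h1 : ‖w‖ ≤ ‖w₀‖ + 1 := by
        have := norm_sub_norm_le w w₀
        rw [Metric.mem_ball, dist_eq_norm] at hw
        linarith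
      have h2 : ⌈‖w‖⌉₊ ≤ ⌈‖w₀‖⌉₊ + 1 := by
        refine Nat.ceil_le.mpr (h1.trans ?_)
        push_cast
        linarith [Nat.le_ceil ‖w₀‖]
      omega
    refine (hWd _ w₀ (lt_of_le_of_lt ?_ (hidx w₀))).congr_of_eventuallyEq hloc'
    push_cast
    linarith
  · simp only
    rw [← hWle 0 _ w (Nat.zero_le _) (by simpa using hw)]
    simp [W, φ, q]

theorem integrableOn_cpow_mul_exp_neg_mul {c x : ℂ} (hc : -1 < c.re) (hx : 0 < x.re) :
    IntegrableOn (fun t : ℝ => (t : ℂ) ^ c * Complex.exp (-(t * x))) (Ioi 0) := by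
  have h := integrableOn_rpow_mul_exp_neg_mul_rpow hc one_pos hx
  refine h.mono' ?_ ?_
  · refine ContinuousOn.aestronglyMeasurable (fun t ht => ?_) measurableSet_Ioi
    have h1 : ContinuousAt (fun t : ℝ => (t : ℂ) ^ c) t :=
      Complex.continuousAt_ofReal_cpow_const t c (Or.inr (ne_of_gt ht))
    exact (h1.mul (by fun_prop)).continuousWithinAt
  · refine (ae_restrict_mem measurableSet_Ioi).mono fun t ht => ?_
    rw [norm_mul, Complex.norm_cpow_eq_rpow_re_of_pos ht, Complex.norm_exp]
    simp [mul_comm]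

/-- The integral of `t ^ (c - 1) * exp (-t * x)` is `x ^ (-c) * Γ c` for complex `x` in the right
half-plane, by continuation from real `x`. -/
theorem integral_cpow_mul_exp_neg_mul_complex {c x : ℂ} (hc : 0 < c.re) (hx : 0 < x.re) :
    ∫ t in Ioi (0 : ℝ), (t : ℂ) ^ (c - 1) * Complex.exp (-(t * x)) =
      x ^ (-c) * Complex.Gamma c := by
  set U : Set ℂ := {x | 0 < x.re} with hU
  have hUo : IsOpen U := isOpen_lt continuous_const Complex.continuous_re
  have hUc : IsPreconnected U := (convex_halfSpace_re_gt 0).isPreconnected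
  have hd1 : DifferentiableOn ℂ
      (fun x => ∫ t in Ioi (0 : ℝ), (t : ℂ) ^ (c - 1) * Complex.exp (-(t * x))) U := by
    intro x₀ hx₀
    have hx0 : 0 < x₀.re := hx₀
    have hre : -1 < (c - 1).re := by simp; linarith
    have hre' : -1 < c.re := by linarith
    have hx2 : 0 < ((x₀.re / 2 : ℝ) : ℂ).re := by simp; linarith
    have hball : ∀ y ∈ Metric.ball x₀ (x₀.re / 2), x₀.re / 2 < y.re := fun y hy => by
      have h1 := Complex.abs_re_le_norm (y - x₀)
      rw [Metric.mem_ball, dist_eq_norm] at hy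
      have h2 := neg_le_of_abs_le h1
      rw [Complex.sub_re] at h2
      linarith
    have key := hasDerivAt_integral_of_dominated_loc_of_deriv_le
      (μ := volume.restrict (Ioi (0 : ℝ)))
      (F := fun (x : ℂ) (t : ℝ) => (t : ℂ) ^ (c - 1) * Complex.exp (-(t * x)))
      (F' := fun (x : ℂ) (t : ℝ) => (t : ℂ) ^ (c - 1) * (Complex.exp (-(t * x)) * -(t : ℂ)))
      (x₀ := x₀) (s := Metric.ball x₀ (x₀.re / 2))
      (bound := fun t => t ^ c.re * Real.exp (-(x₀.re / 2) * t))
      (Metric.ball_mem_nhds x₀ (by linarith)) ?_ ?_ ?_ ?_ ?_ ?_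
    · exact key.2.differentiableAt.differentiableWithinAt
    · filter_upwards [Metric.ball_mem_nhds x₀ (half_pos hx0)] with y hy
      exact (integrableOn_cpow_mul_exp_neg_mul hre
        ((half_pos hx0).trans (hball y hy))).aestronglyMeasurable
    · exact integrableOn_cpow_mul_exp_neg_mul hre hx0
    · have h1 := (integrableOn_cpow_mul_exp_neg_mul hre hx0).aestronglyMeasurable
      have h2 : Continuous fun t : ℝ => -(t : ℂ) := by fun_prop
      refine (h1.mul h2.aestronglyMeasurable).congr (Eventually.of_forall fun t => ?_)
      simp only [Pi.mul_apply]
      ring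
    · refine (ae_restrict_mem measurableSet_Ioi).mono fun t ht y hy => ?_
      have ht0 : 0 < t := ht
      rw [norm_mul, norm_mul, Complex.norm_cpow_eq_rpow_re_of_pos ht, Complex.norm_exp, norm_neg,
        Complex.norm_real, Real.norm_of_nonneg ht0.le]
      have h1 : t ^ c.re = t ^ (c - 1).re * t := by
        rw [Complex.sub_re, Complex.one_re, Real.rpow_sub_one ht0.ne', div_mul_cancel₀ _ ht0.ne']
      rw [h1, mul_assoc, mul_comm t]
      have h2 : (-((t : ℂ) * y)).re ≤ -(x₀.re / 2) * t := by
        have := hball y hy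
        simp only [Complex.neg_re, Complex.mul_re, Complex.ofReal_re, Complex.ofReal_im]
        nlinarith
      gcongr
    · have h := integrableOn_rpow_mul_exp_neg_mul_rpow hre' one_pos (half_pos hx0)
      simpa [IntegrableOn] using h
    · refine Eventually.of_forall fun t y _ => ?_
      have h1 : HasDerivAt (fun x : ℂ => -((t : ℂ) * x)) (-(t : ℂ)) y := by
        simpa using ((hasDerivAt_id y).const_mul (t : ℂ)).fun_neg
      exact h1.cexp.const_mul _
  have hd2 : DifferentiableOn ℂ (fun x => x ^ (-c) * Complex.Gamma c) U := fun y hy =>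
    (((differentiableAt_id).cpow_const (Or.inl hy)).mul_const _).differentiableWithinAt
  have h1 : ((1 : ℝ) : ℂ) ∈ U := by simp [hU]
  have := eqOn_zero_of_eventually_ofReal hUo hUc (hd1.sub hd2) (t := 1) h1 ?_ hx
  · exact sub_eq_zero.mp this
  · filter_upwards [eventually_gt_nhds one_pos] with y hy
    have h := Complex.integral_cpow_mul_exp_neg_mul_Ioi hc hy
    simp only [mul_comm (y : ℂ)] at h
    simp only [Pi.sub_apply]
    rw [h, sub_eq_zero, one_div, Complex.inv_cpow _ _ , Complex.cpow_neg]
    rw [Complex.arg_ofReal_of_nonneg hy.le]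
    exact Real.pi_pos.ne

/-! ### The generating function of the Bernoulli numbers -/

/-- `y / (exp y - 1)`, with value `1` at `y = 0`. It is holomorphic where `dslope exp 0` does not
vanish. -/
def bernGen (y : ℂ) : ℂ := (dslope Complex.exp 0 y)⁻¹

/-- The coefficient of `y` in `bernGen`. -/
def bernOne : ℂ := dslope bernGen 0 0

/-- The coefficient of `y ^ 2` in `bernGen`. -/
def bernTwo : ℂ := dslope (dslope bernGen 0) 0 0

/-- The remainder of `bernGen` after the quadratic Taylor polynomial, divided by `y ^ 3`. -/
def bernTail : ℂ → ℂ := dslope (dslope (dslope bernGen 0) 0) 0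

theorem bernGen_zero : bernGen 0 = 1 := by simp [bernGen]

theorem bernGen_eq_div {y : ℂ} (hy : y ≠ 0) : bernGen y = y / (Complex.exp y - 1) := by
  rw [bernGen, dslope_of_ne _ hy, slope_def_field]
  simp

theorem eq_add_mul_dslope_zero (f : ℂ → ℂ) (y : ℂ) : f y = f 0 + y * dslope f 0 y := by
  have := sub_smul_dslope f 0 y
  simp only [sub_zero, smul_eq_mul] at this
  rw [this]
  ring

theorem bernGen_eq_taylor (y : ℂ) :
    bernGen y = 1 + bernOne * y + bernTwo * y ^ 2 + y ^ 3 * bernTail y := by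
  rw [eq_add_mul_dslope_zero bernGen y, eq_add_mul_dslope_zero (dslope bernGen 0) y,
    eq_add_mul_dslope_zero (dslope (dslope bernGen 0) 0) y, bernGen_zero, bernOne, bernTwo, bernTail]
  ring

theorem differentiable_dslope_exp : Differentiable ℂ (dslope Complex.exp 0) := by
  rw [← differentiableOn_univ, Complex.differentiableOn_dslope univ_mem, differentiableOn_univ]
  exact Complex.differentiable_exp

theorem isOpen_dslope_exp_ne_zero : IsOpen {y | dslope Complex.exp 0 y ≠ 0} :=
  isOpen_ne_fun differentiable_dslope_exp.continuous continuous_const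

theorem dslope_exp_ofReal_ne_zero (y : ℝ) : dslope Complex.exp 0 y ≠ 0 := by
  rcases eq_or_ne y 0 with rfl | hy
  · simp
  · rw [dslope_of_ne _ (Complex.ofReal_ne_zero.mpr hy), slope_def_field]
    refine div_ne_zero (sub_ne_zero.mpr ?_) (by simpa using hy)
    rw [Complex.exp_zero, ← Complex.ofReal_exp]
    exact_mod_cast Real.exp_eq_one_iff y |>.not.mpr hy

theorem differentiableOn_bernTail : DifferentiableOn ℂ bernTail {y | dslope Complex.exp 0 y ≠ 0} := by
  have h0 : {y | dslope Complex.exp 0 y ≠ 0} ∈ 𝓝 (0 : ℂ) :=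
    isOpen_dslope_exp_ne_zero.mem_nhds (by simp)
  rw [bernTail, Complex.differentiableOn_dslope h0, Complex.differentiableOn_dslope h0,
    Complex.differentiableOn_dslope h0]
  exact fun y hy => (differentiable_dslope_exp y).differentiableWithinAt.inv hy

theorem continuous_bernTail_ofReal : Continuous fun t : ℝ => bernTail t :=
  differentiableOn_bernTail.continuousOn.comp_continuous Complex.continuous_ofReal
    dslope_exp_ofReal_ne_zero

theorem norm_bernGen_ofReal_le (y : ℝ) : ‖bernGen y‖ ≤ 1 + |y| := by
  rcases eq_or_ne y 0 with rfl | hy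
  · simp [bernGen_zero]
  rw [bernGen_eq_div (Complex.ofReal_ne_zero.mpr hy), norm_div, ← Complex.ofReal_exp,
    ← Complex.ofReal_one, ← Complex.ofReal_sub, Complex.norm_real, Complex.norm_real,
    Real.norm_eq_abs, Real.norm_eq_abs]
  have hpos : 0 < |Real.exp y - 1| := by
    rw [abs_pos, sub_ne_zero]
    exact (Real.exp_eq_one_iff y).not.mpr hy
  rw [div_le_iff₀ hpos]
  rcases lt_or_gt_of_ne hy with h | h
  · -- `1 - exp y ≥ -y / (1 - y)` for negative `y`
    have h1 : Real.exp y * (1 - y) ≤ 1 := by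
      have h3 : Real.exp y * Real.exp (-y) = 1 := by rw [← Real.exp_add]; simp
      have := Real.add_one_le_exp (-y)
      nlinarith [Real.exp_pos y]
    rw [abs_of_neg h, abs_of_neg (by linarith [Real.exp_lt_one_iff.mpr h])]
    nlinarith
  · have h1 := Real.add_one_le_exp y
    rw [abs_of_pos h, abs_of_pos (by linarith)]
    nlinarith

theorem exists_norm_bernTail_le : ∃ M : ℝ, 0 ≤ M ∧ ∀ t : ℝ, ‖bernTail t‖ ≤ M := by
  obtain ⟨M, hM⟩ := (isCompact_Icc (a := (-1 : ℝ)) (b := 1)).exists_bound_of_continuousOn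
    continuous_bernTail_ofReal.continuousOn
  refine ⟨max M (3 + ‖bernOne‖ + ‖bernTwo‖), le_max_of_le_right (by positivity), fun t => ?_⟩
  by_cases ht : |t| ≤ 1
  · exact (hM t (abs_le.mp ht)).trans (le_max_left _ _)
  · push Not at ht
    refine le_max_of_le_right ?_
    have h1 : (t : ℂ) ^ 3 * bernTail t = bernGen t - 1 - bernOne * t - bernTwo * t ^ 2 := by
      rw [bernGen_eq_taylor t]; ring
    have h2 : |t| ^ 3 * ‖bernTail t‖ ≤ (1 + |t|) + 1 + ‖bernOne‖ * |t| + ‖bernTwo‖ * |t| ^ 2 := by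
      have h3 : ‖(t : ℂ) ^ 3 * bernTail t‖ = |t| ^ 3 * ‖bernTail t‖ := by simp
      rw [← h3, h1]
      refine (norm_sub_le _ _).trans (add_le_add ((norm_sub_le _ _).trans (add_le_add
        ((norm_sub_le _ _).trans (add_le_add (norm_bernGen_ofReal_le t) (by simp))) ?_)) ?_)
      · simp
      · simp
    have h4 : 1 ≤ |t| ^ 2 := one_le_pow₀ ht.le
    have h5 : |t| ≤ |t| ^ 3 := by nlinarith
    have h6 : |t| ^ 2 ≤ |t| ^ 3 := by nlinarith
    have h7 : |t| ^ 3 * ‖bernTail t‖ ≤ |t| ^ 3 * (3 + ‖bernOne‖ + ‖bernTwo‖) := by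
      nlinarith [mul_le_mul_of_nonneg_left h5 (norm_nonneg bernOne),
        mul_le_mul_of_nonneg_left h6 (norm_nonneg bernTwo)]
    exact le_of_mul_le_mul_left h7 (by positivity)

/-! ### The perturbative gamma function -/

/-- The coefficient of `t` in `bernGen (ε₁ * t) * bernGen (ε₂ * t)`. -/
def bernPairOne (ε₁ ε₂ : ℝ) : ℂ := bernOne * (ε₁ + ε₂)

/-- The coefficient of `t ^ 2` in `bernGen (ε₁ * t) * bernGen (ε₂ * t)`. -/
def bernPairTwo (ε₁ ε₂ : ℝ) : ℂ := bernTwo * (ε₁ ^ 2 + ε₂ ^ 2) + bernOne ^ 2 * (ε₁ * ε₂)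

/-- The remainder of `bernGen (ε₁ * z) * bernGen (ε₂ * z)` after its quadratic Taylor polynomial in
`z`, divided by `z ^ 3`. -/
def bernPairTail (ε₁ ε₂ : ℝ) (z : ℂ) : ℂ :=
  bernOne * bernTwo * (ε₁ * ε₂ * (ε₁ + ε₂)) + bernTwo ^ 2 * (ε₁ ^ 2 * ε₂ ^ 2) * z +
    ε₁ ^ 3 * bernTail (ε₁ * z) * (1 + bernOne * (ε₂ * z) + bernTwo * (ε₂ * z) ^ 2) +
    ε₂ ^ 3 * bernTail (ε₂ * z) * (1 + bernOne * (ε₁ * z) + bernTwo * (ε₁ * z) ^ 2) +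
    ε₁ ^ 3 * ε₂ ^ 3 * z ^ 3 * bernTail (ε₁ * z) * bernTail (ε₂ * z)

theorem bernGen_mul_bernGen (ε₁ ε₂ : ℝ) (z : ℂ) : bernGen (ε₁ * z) * bernGen (ε₂ * z) =
    1 + bernPairOne ε₁ ε₂ * z + bernPairTwo ε₁ ε₂ * z ^ 2 + z ^ 3 * bernPairTail ε₁ ε₂ z := by
  rw [bernGen_eq_taylor (ε₁ * z), bernGen_eq_taylor (ε₂ * z), bernPairOne, bernPairTwo,
    bernPairTail]
  ring

theorem analyticAt_bernPairTail (ε₁ ε₂ : ℝ) : AnalyticAt ℂ (bernPairTail ε₁ ε₂) 0 := by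
  have h : ∀ ε : ℝ, AnalyticAt ℂ (fun z : ℂ => bernTail (ε * z)) 0 := fun ε => by
    have h0 : AnalyticAt ℂ bernTail ((fun z : ℂ => ε * z) 0) :=
      differentiableOn_bernTail.analyticAt (isOpen_dslope_exp_ne_zero.mem_nhds (by simp))
    exact h0.comp (f := fun z : ℂ => ε * z) (by fun_prop)
  have h1 := h ε₁
  have h2 := h ε₂
  unfold bernPairTail
  fun_prop

theorem continuous_bernPairTail_ofReal (ε₁ ε₂ : ℝ) :
    Continuous fun t : ℝ => bernPairTail ε₁ ε₂ t := by
  have h : ∀ ε : ℝ, Continuous fun t : ℝ => bernTail (ε * t) := fun ε => by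
    simpa [Function.comp_def] using continuous_bernTail_ofReal.comp (continuous_const_mul ε)
  have h1 := h ε₁
  have h2 := h ε₂
  unfold bernPairTail
  fun_prop

/-- The bound on `bernPairTail` for real argument: it vanishes with `ε₁, ε₂` and grows at most
cubically. -/
theorem exists_norm_bernPairTail_le : ∃ K : ℝ, 0 ≤ K ∧ ∀ (ε₁ ε₂ t : ℝ), 0 ≤ t →
    ‖bernPairTail ε₁ ε₂ t‖ ≤
      K * ((|ε₁| + |ε₂|) * (1 + (|ε₁| + |ε₂|)) ^ 5) * (1 + t) ^ 3 := by
  obtain ⟨M, hM0, hM⟩ := exists_norm_bernTail_le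
  -- one constant bounds all the coefficients and the remainder
  obtain ⟨k, hk⟩ : ∃ k, k = 1 + ‖bernOne‖ + ‖bernTwo‖ + M := ⟨_, rfl⟩
  have hb1 : ‖bernOne‖ ≤ k := by linarith [norm_nonneg bernTwo]
  have hb2 : ‖bernTwo‖ ≤ k := by linarith [norm_nonneg bernOne]
  have hk1 : 1 ≤ k := by linarith [norm_nonneg bernOne, norm_nonneg bernTwo]
  have hMk : ∀ t : ℝ, ‖bernTail t‖ ≤ k := fun t => by
    linarith [hM t, norm_nonneg bernOne, norm_nonneg bernTwo]
  refine ⟨6 * k ^ 2, by positivity, fun ε₁ ε₂ t ht => ?_⟩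
  obtain ⟨η, hη⟩ : ∃ η, η = |ε₁| + |ε₂| := ⟨_, rfl⟩
  rw [← hη]
  have he1 : |ε₁| ≤ η := by linarith [abs_nonneg ε₂]
  have he2 : |ε₂| ≤ η := by linarith [abs_nonneg ε₁]
  have hη0 : 0 ≤ η := (abs_nonneg ε₁).trans he1
  have hk0 : 0 ≤ k := zero_le_one.trans hk1
  have hC : ∀ ε : ℝ, ‖bernTail (ε * t)‖ ≤ k := fun ε => by simpa using hMk (ε * t)
  have hP : ∀ ε : ℝ, |ε| ≤ η → ‖1 + bernOne * (ε * t) + bernTwo * (ε * t) ^ 2‖ ≤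
      k * ((1 + η) ^ 2 * (1 + t) ^ 2) := fun ε hε => by
    have h1 : |ε| * t ≤ η * t := by gcongr
    calc ‖1 + bernOne * (ε * t) + bernTwo * (ε * t) ^ 2‖
        ≤ 1 + ‖bernOne‖ * (|ε| * t) + ‖bernTwo‖ * (|ε| * t) ^ 2 := by
          refine (norm_add_le _ _).trans (add_le_add ((norm_add_le _ _).trans (add_le_add ?_ ?_)) ?_)
          · simp
          · simp [abs_of_nonneg ht]
          · simp [abs_of_nonneg ht]
      _ ≤ k + k * (η * t) + k * (η * t) ^ 2 := by gcongr
      _ ≤ k * (1 + η * t) ^ 2 := by 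
          have h2 : 0 ≤ k * (η * t) := by positivity
          linarith [show k * (1 + η * t) ^ 2 =
            k + k * (η * t) + k * (η * t) ^ 2 + k * (η * t) by ring]
      _ ≤ k * ((1 + η) * (1 + t)) ^ 2 := by
          gcongr
          linarith [show (1 + η) * (1 + t) = 1 + η * t + (η + t) by ring]
      _ = _ := by ring
  have h1η : 1 ≤ 1 + η := by linarith
  have h1t : 1 ≤ 1 + t := by linarith
  have hηh : η ≤ 1 + η := by linarith
  have htt : t ≤ 1 + t := by linarith
  have he1' : |ε₁| ≤ 1 + η := he1.trans hηh
  have he2' : |ε₂| ≤ 1 + η := he2.trans hηh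
  -- every summand is at most this
  obtain ⟨B, hB⟩ : ∃ B, B = k ^ 2 * (η * (1 + η) ^ 5) * (1 + t) ^ 3 := ⟨_, rfl⟩
  have hpow : ∀ i j : ℕ, i ≤ 5 → j ≤ 3 → k ^ 2 * (η * (1 + η) ^ i) * (1 + t) ^ j ≤ B := by
    intro i j hi hj
    rw [hB]
    gcongr
  have s1 : ‖bernOne * bernTwo * (ε₁ * ε₂ * (ε₁ + ε₂))‖ ≤ B := by
    have h : ‖(ε₁ : ℂ) + ε₂‖ ≤ η := by
      simpa [hη] using norm_add_le (ε₁ : ℂ) ε₂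
    have h' := h.trans hηh
    calc ‖bernOne * bernTwo * (ε₁ * ε₂ * (ε₁ + ε₂))‖
        = ‖bernOne‖ * ‖bernTwo‖ * (|ε₁| * |ε₂| * ‖(ε₁ : ℂ) + ε₂‖) := by simp
      _ ≤ k * k * (η * (1 + η) * (1 + η)) := by gcongr
      _ = k ^ 2 * (η * (1 + η) ^ 2) * (1 + t) ^ 0 := by ring
      _ ≤ B := hpow _ _ (by norm_num) (by norm_num)
  have s2 : ‖bernTwo ^ 2 * (ε₁ ^ 2 * ε₂ ^ 2) * (t : ℂ)‖ ≤ B := by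
    calc ‖bernTwo ^ 2 * (ε₁ ^ 2 * ε₂ ^ 2) * (t : ℂ)‖
        = ‖bernTwo‖ ^ 2 * (|ε₁| * |ε₁| * |ε₂| ^ 2) * t := by
          simp [abs_of_nonneg ht, pow_two]
      _ ≤ k ^ 2 * (η * (1 + η) * (1 + η) ^ 2) * (1 + t) := by gcongr
      _ = k ^ 2 * (η * (1 + η) ^ 3) * (1 + t) ^ 1 := by ring
      _ ≤ B := hpow _ _ (by norm_num) (by norm_num)
  have s3 : ∀ a b : ℝ, |a| ≤ η → |b| ≤ η → ‖a ^ 3 * bernTail (a * t) *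
      (1 + bernOne * (b * t) + bernTwo * (b * t) ^ 2)‖ ≤ B := fun a b ha hb => by
    calc ‖a ^ 3 * bernTail (a * t) * (1 + bernOne * (b * t) + bernTwo * (b * t) ^ 2)‖
        = |a| * |a| ^ 2 * ‖bernTail (a * t)‖ *
            ‖1 + bernOne * (b * t) + bernTwo * (b * t) ^ 2‖ := by
          rw [norm_mul, norm_mul, norm_pow, Complex.norm_real, Real.norm_eq_abs]
          ring
      _ ≤ η * (1 + η) ^ 2 * k * (k * ((1 + η) ^ 2 * (1 + t) ^ 2)) := by
          have ha' := ha.trans hηh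
          gcongr
          · exact hC a
          · exact hP b hb
      _ = k ^ 2 * (η * (1 + η) ^ 4) * (1 + t) ^ 2 := by ring
      _ ≤ B := hpow _ _ (by norm_num) (by norm_num)
  have s5 : ‖ε₁ ^ 3 * ε₂ ^ 3 * (t : ℂ) ^ 3 * bernTail (ε₁ * t) * bernTail (ε₂ * t)‖ ≤ B := by
    calc ‖ε₁ ^ 3 * ε₂ ^ 3 * (t : ℂ) ^ 3 * bernTail (ε₁ * t) * bernTail (ε₂ * t)‖
        = |ε₁| * |ε₁| ^ 2 * |ε₂| ^ 3 * t ^ 3 * ‖bernTail (ε₁ * t)‖ * ‖bernTail (ε₂ * t)‖ := by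
          simp only [norm_mul, norm_pow, Complex.norm_real, Real.norm_eq_abs, abs_of_nonneg ht]
          ring
      _ ≤ η * (1 + η) ^ 2 * (1 + η) ^ 3 * (1 + t) ^ 3 * k * k := by
          gcongr
          · exact hC ε₁
          · exact hC ε₂
      _ = k ^ 2 * (η * (1 + η) ^ 5) * (1 + t) ^ 3 := by ring
      _ ≤ B := hB.ge
  have hB0 : 0 ≤ B := by rw [hB]; positivity
  calc ‖bernPairTail ε₁ ε₂ t‖ ≤ B + B + B + B + B := by
        refine (norm_add_le _ _).trans (add_le_add ((norm_add_le _ _).trans (add_le_add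
          ((norm_add_le _ _).trans (add_le_add ((norm_add_le _ _).trans (add_le_add s1 s2)) ?_)) ?_))
          s5)
        · exact s3 ε₁ ε₂ he1 he2
        · exact s3 ε₂ ε₁ he2 he1
    _ ≤ 6 * B := by linarith
    _ = _ := by rw [hB]; ring

/-- The integrand left over from `γ_{ε₁,ε₂}` when the quadratic Taylor polynomial of
`bernGen (ε₁ * t) * bernGen (ε₂ * t)` is removed. -/
def gammaTail (ε₁ ε₂ : ℝ) (x : ℂ) (t : ℝ) : ℂ := Complex.exp (-(t * x)) * bernPairTail ε₁ ε₂ t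

theorem continuous_gammaTail (ε₁ ε₂ : ℝ) (x : ℂ) : Continuous (gammaTail ε₁ ε₂ x) := by
  have := continuous_bernPairTail_ofReal ε₁ ε₂
  unfold gammaTail
  fun_prop

/-- The cubic growth of `bernPairTail` is absorbed by half of the exponential decay. -/
theorem exists_norm_gammaTail_le {x : ℂ} (hx : 0 < x.re) : ∃ Q : ℝ, ∀ ε₁ ε₂ t : ℝ, 0 ≤ t →
    ‖gammaTail ε₁ ε₂ x t‖ ≤ Q * ((|ε₁| + |ε₂|) * (1 + (|ε₁| + |ε₂|)) ^ 5) *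
      Real.exp (-(x.re / 2) * t) := by
  obtain ⟨K, hK0, hK⟩ := exists_norm_bernPairTail_le
  -- three factors `exp (b t)`, one for each power of `1 + t`, cost half of `x.re`
  set b := x.re / 6 with hb
  have hb0 : 0 < b := by positivity
  refine ⟨K * (1 + b⁻¹) ^ 3, fun ε₁ ε₂ t ht => ?_⟩
  have h1 : 1 + t ≤ (1 + b⁻¹) * Real.exp (b * t) := by
    have h2 : b * t + 1 ≤ Real.exp (b * t) := Real.add_one_le_exp _
    have h3 : (1 + b⁻¹) * (b * t + 1) = 1 + t + (b * t + b⁻¹) := by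
      field_simp
      ring
    have h4 : 0 ≤ b * t + b⁻¹ := by positivity
    have h5 : (1 + b⁻¹) * (b * t + 1) ≤ (1 + b⁻¹) * Real.exp (b * t) := by gcongr
    linarith
  have h2 : ‖Complex.exp (-(t * x))‖ = Real.exp (-(x.re * t)) := by
    rw [Complex.norm_exp]
    simp [mul_comm]
  rw [gammaTail, norm_mul, h2]
  calc Real.exp (-(x.re * t)) * ‖bernPairTail ε₁ ε₂ t‖
      ≤ Real.exp (-(x.re * t)) * (K * ((|ε₁| + |ε₂|) * (1 + (|ε₁| + |ε₂|)) ^ 5) *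
          ((1 + b⁻¹) * Real.exp (b * t)) ^ 3) := by
        gcongr
        exact (hK ε₁ ε₂ t ht).trans (by gcongr)
    _ = K * (1 + b⁻¹) ^ 3 * ((|ε₁| + |ε₂|) * (1 + (|ε₁| + |ε₂|)) ^ 5) *
          (Real.exp (-(x.re * t)) * Real.exp (b * t) ^ 3) := by ring
    _ = _ := by
        rw [← Real.exp_nat_mul, ← Real.exp_add]
        congr 2
        rw [hb]
        push_cast
        ring

theorem gammaTail_isBigO_exp {x : ℂ} (hx : 0 < x.re) (ε₁ ε₂ : ℝ) :
    gammaTail ε₁ ε₂ x =O[atTop] fun t => Real.exp (-(x.re / 2) * t) := by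
  obtain ⟨Q, hQ⟩ := exists_norm_gammaTail_le hx
  refine Asymptotics.IsBigO.of_bound (Q * ((|ε₁| + |ε₂|) * (1 + (|ε₁| + |ε₂|)) ^ 5)) ?_
  filter_upwards [eventually_ge_atTop 0] with t ht
  rw [Real.norm_of_nonneg (Real.exp_pos _).le]
  exact hQ ε₁ ε₂ t ht

theorem mellinConvergent_gammaTail {x : ℂ} (hx : 0 < x.re) (ε₁ ε₂ : ℝ) {w : ℂ} (hw : 0 < w.re) :
    MellinConvergent (gammaTail ε₁ ε₂ x) w := by
  have hc := continuous_gammaTail ε₁ ε₂ x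
  refine mellinConvergent_of_isBigO_rpow_exp (half_pos hx)
    (hc.locallyIntegrable.locallyIntegrableOn _) (gammaTail_isBigO_exp hx ε₁ ε₂) (b := 0) ?_ hw
  simp only [neg_zero, Real.rpow_zero]
  exact ((hc.tendsto 0).mono_left nhdsWithin_le_nhds).isBigO_one ℝ

/-- The closed form of `γ_{ε₁,ε₂}(x; exp l)`; the last summand vanishes in the limit
`ε₁, ε₂ → 0`. -/
def pertGamma (x l : ℂ) (ε₁ ε₂ : ℝ) : ℂ :=
  (ε₁ * ε₂ : ℂ)⁻¹ * (l * (x ^ 2 / 2 - bernPairOne ε₁ ε₂ * x + bernPairTwo ε₁ ε₂) +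
    x ^ 2 * (3 / 4 - Complex.log x / 2) + bernPairOne ε₁ ε₂ * (x * Complex.log x - x) -
    bernPairTwo ε₁ ε₂ * Complex.log x + mellin (gammaTail ε₁ ε₂ x) 1)

/-- The integrand of `γ_{ε₁,ε₂}`, expanded by the quadratic Taylor polynomial of `bernGen (ε₁ * t) *
bernGen (ε₂ * t)`. -/
theorem pertGamma_integrand_eq {ε₁ ε₂ : ℝ} (h₁ : ε₁ ≠ 0) (h₂ : ε₂ ≠ 0) (x s : ℂ) {t : ℝ}
    (ht : 0 < t) : (t : ℂ) ^ (s - 1) * Complex.exp (-(t * x)) /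
        ((Complex.exp (ε₁ * t) - 1) * (Complex.exp (ε₂ * t) - 1)) =
      (ε₁ * ε₂ : ℂ)⁻¹ * ((t : ℂ) ^ (s - 2 - 1) * Complex.exp (-(t * x)) +
        bernPairOne ε₁ ε₂ * ((t : ℂ) ^ (s - 1 - 1) * Complex.exp (-(t * x))) +
        bernPairTwo ε₁ ε₂ * ((t : ℂ) ^ (s - 1) * Complex.exp (-(t * x))) +
        (t : ℂ) ^ (s + 1 - 1) • gammaTail ε₁ ε₂ x t) := by
  have ht' : (t : ℂ) ≠ 0 := Complex.ofReal_ne_zero.mpr ht.ne'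
  have h₁' : (ε₁ : ℂ) ≠ 0 := Complex.ofReal_ne_zero.mpr h₁
  have h₂' : (ε₂ : ℂ) ≠ 0 := Complex.ofReal_ne_zero.mpr h₂
  have hp1 : (t : ℂ) ^ (s - 1) = (t : ℂ) ^ (s - 2 - 1) * t ^ 2 := by
    rw [← Complex.cpow_natCast, ← Complex.cpow_add _ _ ht']
    congr 1
    push_cast
    ring
  have hp2 : (t : ℂ) ^ (s - 1 - 1) = (t : ℂ) ^ (s - 2 - 1) * t := by
    nth_rw 3 [← Complex.cpow_one (t : ℂ)]
    rw [← Complex.cpow_add _ _ ht']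
    congr 1
    ring
  have hp3 : (t : ℂ) ^ (s + 1 - 1) = (t : ℂ) ^ (s - 2 - 1) * t ^ 3 := by
    rw [← Complex.cpow_natCast, ← Complex.cpow_add _ _ ht']
    congr 1
    push_cast
    ring
  have hne : ∀ ε : ℝ, ε ≠ 0 → Complex.exp (ε * t) - 1 ≠ 0 := fun ε hε => by
    rw [sub_ne_zero, ← Complex.ofReal_mul, ← Complex.ofReal_exp]
    exact_mod_cast (Real.exp_eq_one_iff _).not.mpr (mul_ne_zero hε ht.ne')
  have hb := bernGen_mul_bernGen ε₁ ε₂ t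
  rw [bernGen_eq_div (mul_ne_zero h₁' ht'), bernGen_eq_div (mul_ne_zero h₂' ht')] at hb
  rw [hp1, hp2, hp3, gammaTail, smul_eq_mul]
  set E₁ := Complex.exp (ε₁ * t) - 1
  set E₂ := Complex.exp (ε₂ * t) - 1
  have hE₁ : E₁ ≠ 0 := hne ε₁ h₁
  have hE₂ : E₂ ≠ 0 := hne ε₂ h₂
  have hq : (t : ℂ) ^ 2 / (E₁ * E₂) = (ε₁ * ε₂ : ℂ)⁻¹ * (ε₁ * t / E₁ * (ε₂ * t / E₂)) := by
    field_simp
  calc (t : ℂ) ^ (s - 2 - 1) * t ^ 2 * Complex.exp (-(t * x)) / (E₁ * E₂)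
      = (t : ℂ) ^ (s - 2 - 1) * Complex.exp (-(t * x)) * ((t : ℂ) ^ 2 / (E₁ * E₂)) := by ring
    _ = _ := by rw [hq, hb]; ring

/-- The three terms of the Taylor polynomial give explicit Gamma integrals with poles at `1` and
`2`, and the remainder gives an entire function. The derivative at `s = 0` is read off. -/
theorem isPertGamma_pertGamma {x : ℂ} (l : ℂ) (hx : 0 < x.re) {ε₁ ε₂ : ℝ} (h₁ : ε₁ ≠ 0)
    (h₂ : ε₂ ≠ 0) : IsPertGamma ε₁ ε₂ x l (pertGamma x l ε₁ ε₂) := by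
  have hx0 : x ≠ 0 := fun h => by simp [h] at hx
  have hc := continuous_gammaTail ε₁ ε₂ x
  obtain ⟨H, hH, hHeq⟩ := exists_differentiable_eq_inv_Gamma_mul_mellin (half_pos hx)
    (hc.locallyIntegrable.locallyIntegrableOn _) (gammaTail_isBigO_exp hx ε₁ ε₂)
    (g := fun z => Complex.exp (-(z * x)) * bernPairTail ε₁ ε₂ z)
    ((by fun_prop : AnalyticAt ℂ (fun z : ℂ => Complex.exp (-(z * x))) 0).mul
      (analyticAt_bernPairTail ε₁ ε₂)) (fun _ _ => rfl)
  set c₁ := bernPairOne ε₁ ε₂ with hc₁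
  set c₂ := bernPairTwo ε₁ ε₂ with hc₂
  have hcpow : ∀ (a s : ℂ), HasDerivAt (fun s => x ^ (a - s)) (-(x ^ (a - s) * Complex.log x)) s :=
    fun a s => by
      have h := ((hasDerivAt_id s).const_sub a).const_cpow (c := x) (Or.inl hx0)
      simpa using h
  -- the derivative away from the poles
  have hZ : ∀ s : ℂ, s - 1 ≠ 0 → s - 2 ≠ 0 → HasDerivAt (fun s => (ε₁ * ε₂ : ℂ)⁻¹ *
      (Complex.exp (l * s) * (x ^ (2 - s) * ((s - 1) * (s - 2))⁻¹ + c₁ * (x ^ (1 - s) * (s - 1)⁻¹) +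
        c₂ * x ^ (0 - s) + s * H (s + 1))))
      ((ε₁ * ε₂ : ℂ)⁻¹ * (Complex.exp (l * s) * (l * 1) *
        (x ^ (2 - s) * ((s - 1) * (s - 2))⁻¹ + c₁ * (x ^ (1 - s) * (s - 1)⁻¹) +
        c₂ * x ^ (0 - s) + s * H (s + 1)) + Complex.exp (l * s) *
        ((-(x ^ (2 - s) * Complex.log x) * ((s - 1) * (s - 2))⁻¹ +
            x ^ (2 - s) * (-(1 * (s - 2) + (s - 1) * 1) / ((s - 1) * (s - 2)) ^ 2)) +
          c₁ * (-(x ^ (1 - s) * Complex.log x) * (s - 1)⁻¹ + x ^ (1 - s) * (-1 / (s - 1) ^ 2)) +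
          c₂ * (-(x ^ (0 - s) * Complex.log x)) +
          (1 * H (s + 1) + s * deriv H (s + 1))))) s := by
    intro s hs1 hs2
    have d1 := (hasDerivAt_id s).sub_const 1
    have d2 := (hasDerivAt_id s).sub_const 2
    have dH : HasDerivAt (fun s => H (s + 1)) (deriv H (s + 1)) s :=
      (hH (s + 1)).hasDerivAt.comp_add_const s 1
    exact ((((hasDerivAt_id s).const_mul l).cexp).fun_mul
      (((((hcpow 2 s).fun_mul ((d1.fun_mul d2).fun_inv (mul_ne_zero hs1 hs2))).fun_add
        (((hcpow 1 s).fun_mul (d1.fun_inv hs1)).const_mul c₁)).fun_add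
        ((hcpow 0 s).const_mul c₂)).fun_add ((hasDerivAt_id s).fun_mul dH))).const_mul _
  refine ⟨_, fun s hs => ?_, fun s hs => ?_, (hZ 0 (by norm_num) (by norm_num)).deriv.trans ?_⟩
  · simp only [mem_compl_iff, mem_insert_iff, mem_singleton_iff, not_or] at hs
    exact (hZ s (sub_ne_zero.mpr hs.1) (sub_ne_zero.mpr hs.2)).differentiableAt
      |>.differentiableWithinAt
  · have hs0 : 0 < s.re := by linarith
    have re2 : 0 < (s - 2).re := by simpa using hs
    have re1 : 0 < (s - 1).re := by simp; linarith
    have rep : 0 < (s + 1).re := by simp; linarith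
    have n1 : s - 1 ≠ 0 := fun h => by simp [h] at re1
    have n2 : s - 2 ≠ 0 := fun h => by simp [h] at re2
    have n0 : s ≠ 0 := fun h => by simp [h] at hs0
    have i2 := integrableOn_cpow_mul_exp_neg_mul (c := s - 2 - 1) (x := x)
      (by rw [Complex.sub_re, Complex.one_re]; linarith) hx
    have i1 := integrableOn_cpow_mul_exp_neg_mul (c := s - 1 - 1) (x := x)
      (by rw [Complex.sub_re, Complex.one_re]; linarith) hx
    have i0 := integrableOn_cpow_mul_exp_neg_mul (c := s - 1) (x := x)
      (by rw [Complex.sub_re, Complex.one_re]; linarith) hx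
    have im := mellinConvergent_gammaTail hx ε₁ ε₂ rep
    rw [setIntegral_congr_fun measurableSet_Ioi
        (fun t ht => pertGamma_integrand_eq h₁ h₂ x s (mem_Ioi.mp ht)),
      integral_const_mul, integral_add ((i2.fun_add (i1.const_mul _)).fun_add (i0.const_mul _)) im,
      integral_add (i2.fun_add (i1.const_mul _)) (i0.const_mul _),
      integral_add i2 (i1.const_mul _), integral_const_mul, integral_const_mul,
      integral_cpow_mul_exp_neg_mul_complex re2 hx, integral_cpow_mul_exp_neg_mul_complex re1 hx,
      integral_cpow_mul_exp_neg_mul_complex hs0 hx, ← mellin, hHeq _ rep, ← hc₁, ← hc₂]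
    -- `Γ s` in terms of `Γ (s - 2)` produces the factors `(s - 1)⁻¹` and `(s - 2)⁻¹`
    have g2 : Complex.Gamma (s - 1) = (s - 2) * Complex.Gamma (s - 2) := by
      rw [← Complex.Gamma_add_one _ n2]
      congr 1
      ring
    have g1 : Complex.Gamma s = (s - 1) * Complex.Gamma (s - 1) := by
      rw [← Complex.Gamma_add_one _ n1]
      congr 1
      ring
    have hg := Complex.Gamma_ne_zero_of_re_pos re2
    rw [Complex.Gamma_add_one _ n0, g1, g2, neg_sub, neg_sub, zero_sub]
    have h₁' : (ε₁ : ℂ) ≠ 0 := Complex.ofReal_ne_zero.mpr h₁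
    have h₂' : (ε₂ : ℂ) ≠ 0 := Complex.ofReal_ne_zero.mpr h₂
    field_simp
  · have h1 : H 1 = mellin (gammaTail ε₁ ε₂ x) 1 := by simp [hHeq 1 (by simp)]
    rw [pertGamma, ← h1]
    simp only [mul_zero, Complex.exp_zero, zero_add, sub_zero, Complex.cpow_ofNat, Complex.cpow_one,
      Complex.cpow_zero, zero_sub]
    ring

/-- The coefficient of `1 / (ε₁ ε₂)`: all terms except the leading one vanish with `ε₁, ε₂`. -/
theorem tendsto_pertGamma {x : ℂ} (l : ℂ) (hx : 0 < x.re) :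
    Tendsto (fun p : ℝ × ℝ => (p.1 * p.2 : ℂ) * -pertGamma x l p.1 p.2)
      (𝓝[{p : ℝ × ℝ | p.1 ≠ 0 ∧ p.2 ≠ 0}] 0) (𝓝 (gammaZero x l)) := by
  obtain ⟨Q, hQ⟩ := exists_norm_gammaTail_le hx
  set J := ∫ t in Ioi (0 : ℝ), Real.exp (-(x.re / 2) * t) with hJ
  have hT : Tendsto (fun p : ℝ × ℝ => mellin (gammaTail p.1 p.2 x) 1) (𝓝 0) (𝓝 0) := by
    refine squeeze_zero_norm (a := fun p : ℝ × ℝ =>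
      Q * ((|p.1| + |p.2|) * (1 + (|p.1| + |p.2|)) ^ 5) * J) (fun p => ?_) ?_
    · rw [mellin, hJ, ← integral_const_mul]
      refine norm_integral_le_of_norm_le ((exp_neg_integrableOn_Ioi 0 (half_pos hx)).const_mul _)
        ((ae_restrict_mem measurableSet_Ioi).mono fun t ht => ?_)
      simpa using hQ p.1 p.2 t (le_of_lt ht)
    · have h : Continuous fun p : ℝ × ℝ =>
          Q * ((|p.1| + |p.2|) * (1 + (|p.1| + |p.2|)) ^ 5) * J := by fun_prop
      simpa using h.tendsto 0
  have hM : Tendsto (fun p : ℝ × ℝ => -(l * (x ^ 2 / 2 - bernPairOne p.1 p.2 * x +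
      bernPairTwo p.1 p.2) + x ^ 2 * (3 / 4 - Complex.log x / 2) +
      bernPairOne p.1 p.2 * (x * Complex.log x - x) - bernPairTwo p.1 p.2 * Complex.log x))
      (𝓝 0) (𝓝 (gammaZero x l)) := by
    have h : Continuous fun p : ℝ × ℝ => -(l * (x ^ 2 / 2 - bernPairOne p.1 p.2 * x +
        bernPairTwo p.1 p.2) + x ^ 2 * (3 / 4 - Complex.log x / 2) +
        bernPairOne p.1 p.2 * (x * Complex.log x - x) -
        bernPairTwo p.1 p.2 * Complex.log x) := by
      unfold bernPairOne bernPairTwo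
      fun_prop
    have h0 := h.tendsto 0
    convert h0 using 2
    simp [gammaZero, logRatio, bernPairOne, bernPairTwo]
    ring
  have hs := (hM.sub hT).mono_left
    (nhdsWithin_le_nhds (s := {p : ℝ × ℝ | p.1 ≠ 0 ∧ p.2 ≠ 0}))
  rw [sub_zero] at hs
  refine hs.congr' ?_
  filter_upwards [self_mem_nhdsWithin] with p hp
  have h₁ : (p.1 : ℂ) ≠ 0 := Complex.ofReal_ne_zero.mpr hp.1
  have h₂ : (p.2 : ℂ) ≠ 0 := Complex.ofReal_ne_zero.mpr hp.2
  rw [pertGamma, mul_neg, ← mul_assoc, mul_inv_cancel₀ (mul_ne_zero h₁ h₂)]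
  ring

end SeibergWitten

end

theorem mainTheorem7 (r : ℕ) [NeZero r] (hr : 2 ≤ r) :
    -- the prepotential exists
    (∃ (ρ : (Fin r → ℂ) → ℝ) (F : (Fin r → ℂ) × ℂ → ℂ),
      SeibergWitten.IsBound r ρ ∧ SeibergWitten.IsPrepotential r ρ F) ∧
    -- it is unique
    (∀ (ρ : (Fin r → ℂ) → ℝ) (F G : (Fin r → ℂ) × ℂ → ℂ), SeibergWitten.IsBound r ρ →
      SeibergWitten.IsPrepotential r ρ F → SeibergWitten.IsPrepotential r ρ G →
      Set.EqOn F G (SeibergWitten.domain r ρ)) ∧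
    -- it is its perturbative part plus `O(Λ^(2r))`, locally uniformly in `a`
    (∀ (ρ : (Fin r → ℂ) → ℝ) (F : (Fin r → ℂ) × ℂ → ℂ), SeibergWitten.IsBound r ρ →
      SeibergWitten.IsPrepotential r ρ F →
      ∀ K ⊆ SeibergWitten.chamber r, IsCompact K → ∃ C δ : ℝ, 0 < δ ∧
        ∀ a ∈ K, ∀ l : ℂ, ‖Complex.exp l‖ < δ →
          (a, l) ∈ SeibergWitten.domain r ρ ∧
          ‖F (a, l) - SeibergWitten.pertPart a l‖ ≤ C * ‖Complex.exp l‖ ^ (2 * r)) ∧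
    -- `γ₀` is the coefficient of `1/(ε₁ε₂)` in `-γ_{ε₁,ε₂}`
    (∀ x l : ℂ, 0 < x.re → ∃ γ : ℝ → ℝ → ℂ,
      (∀ ε₁ ε₂ : ℝ, ε₁ ≠ 0 → ε₂ ≠ 0 →
        SeibergWitten.IsPertGamma ε₁ ε₂ x l (γ ε₁ ε₂)) ∧
      Tendsto (fun p : ℝ × ℝ => (p.1 * p.2 : ℂ) * -γ p.1 p.2)
        (𝓝[{p : ℝ × ℝ | p.1 ≠ 0 ∧ p.2 ≠ 0}] 0) (𝓝 (SeibergWitten.gammaZero x l))) := by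
  refine ⟨⟨SeibergWitten.cutBound, SeibergWitten.energyPrepotential,
    SeibergWitten.isBound_cutBound hr, SeibergWitten.isPrepotential_energyPrepotential hr⟩,
    fun ρ F G hρ hF hG => hF.eqOn hr hρ hG,
    fun ρ F hρ hF K hKc hK => hF.exists_norm_sub_pertPart_le hr hρ hKc hK,
    fun x l hx => ⟨SeibergWitten.pertGamma x l,
      fun ε₁ ε₂ h₁ h₂ => SeibergWitten.isPertGamma_pertGamma l hx h₁ h₂,
      SeibergWitten.tendsto_pertGamma l hx⟩⟩
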